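/- Let $d\ge 1$, $l\ge 0$ be integers and let $P$ be a probability measure on $\mathbb R^d$ (Euclidean norm $\|\cdot\|$, Lebesgue measure $|\cdot|$, closed balls $B(x,r)$). There is a constant $C>0$, depending only on $d$, $l$ and $P$, such that the following holds. Let $\mathcal X\subset\mathbb R^d$ and let $Q$ be a probability measure on $\mathbb R^d$, with $P(\mathcal X)=Q(\mathcal X)=1$, such that - (X1) $\mathcal X$ is compact; - (X2) for some $c>0$, $|B(x,r)\cap\mathcal X|\ge c\,|B(x,r)|$ for all $x\in\mathcal X$ and $0\le r\le\operatorname{diam}(\mathcal X)$; - (X3) $P$ and $Q$ have Lebesgue densities $p$ and $q$, and $p\ge\underline p>0$ and $q\le\overline q<\infty$ on $\mathcal X$; and such that in addition $p\le\overline p<\infty$ on $\mathcal X$. (No other relation between the supports of $P$ and $Q$ is assumed.) Let $(X,Y)$ and $(X^*,Y^*)$ be random vectors in $\mathbb R^d\times\mathbb R$ with $X\sim P$ and $X^*\sim Q$, let $h$ be measurable with $h(X,Y)$ and $h(X^*,Y^*)$ integrable, and let the regression functions agree: $g(x)=\mathbb E[h(X,Y)\mid X=x]$ for $P$-almost every $x$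 and $g(x)=\mathbb E[h(X^*,Y^*)\mid X^*=x]$ for $Q$-almost every $x$. Assume that $g$ is of class $C^l$ on an open convex set containing $\mathcal X$, and that for some $\beta\in(0,1]$ and $\Lambda>0$ all its partial derivatives of order $l$ are $\beta$-Hölder continuous with constant $\Lambda$ on the convex hull of $\mathcal X$. Put $e(h)=\mathbb E[h(X^*,Y^*)]$. Let $(X_1,Y_1),\dots,(X_n,Y_n)$ be i.i.d. copies of $(X,Y)$ and, independently of them, let $X_1^*,\dots,X_m^*$ be i.i.d. copies of $X^*$, with $m\ge 1$. For $1\le k\le n$ let $\hat\tau_k(x)$ be the $k$-th order statistic of $(\|X_i-x\|)_{1\le i\le n}$. Let $\zeta(x,z)=\big(\prod_{i=1}^d(z_i-x_i)^{\alpha_i}\big)_{\alpha}$, where $\alpha$ runs over the multi-indices in $\mathbb N^d$ with $|\alpha|\le l$; let $K^*$ be their number and $D=\sum_{i=1}^l i\binom{d+i-1}{i}$. Let $$M(x)=\sum_{i=1}^n\zeta(x,X_i)\zeta(x,X_i)^\top\mathbf 1\{\|X_i-x\|\le\hat\tau_k(x)\},$$ and let $\hat g(x)$ be the coordinate of index $\alpha=0$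 of $$M(x)^{-1}\sum_{i=1}^n h(X_i,Y_i)\,\zeta(x,X_i)\,\mathbf 1\{\|X_i-x\|\le\hat\tau_k(x)\},$$ that is, the constant coefficient of the least squares polynomial fit of degree $l$ around $x$ on the $k$ nearest neighbours (when $M(x)$ is singular, put $\hat g(x)=0$). Let $\hat e_l(h)=\frac1m\sum_{j=1}^m\hat g(X_j^*)$. If $k\ge(2D+1)K^*+1$, then $\hat e_l(h)$ is integrable, and the conditional bias $B_n=\mathbb E[\hat e_l(h)-e(h)\mid X_1,\dots,X_n]$ is square integrable and satisfies $$\mathbb E[B_n^2]\le C\,\Lambda^2\left(\frac kn\right)^{2(l+\beta)/d}.$$ -/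

import Mathlib

open MeasureTheory ProbabilityTheory Finset
open scoped ENNReal Matrix

noncomputable section

/-- The Euclidean space `ℝ^d`, with the Euclidean norm and Lebesgue measure `volume`. -/
abbrev RSpace (d : ℕ) : Type := EuclideanSpace ℝ (Fin d)

/-! ### Conditions on the domain and on the covariate distributions -/

/-- The ball-volume condition: for some `c > 0`, `|B(x,r) ∩ S| ≥ c |B(x,r)|` for all `x ∈ S` and all
`0 ≤ r ≤ diam S`, with closed balls and Lebesgue measure. -/
def BallVolumeCondition {d : ℕ} (S : Set (RSpace d)) : Prop :=
  ∃ c : ℝ, 0 < c ∧ ∀ x ∈ S, ∀ r : ℝ, 0 ≤ r → r ≤ Metric.diam S →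
    ENNReal.ofReal c * volume (Metric.closedBall x r) ≤ volume (Metric.closedBall x r ∩ S)

/-- `P` has Lebesgue density `p` and is carried by the set `S`. -/
structure HasDensityOn {d : ℕ} (P : Measure (RSpace d)) (S : Set (RSpace d))
    (p : RSpace d → ℝ) : Prop where
  measurable : Measurable p
  nonneg : ∀ x, 0 ≤ p x
  eq_withDensity : P = volume.withDensity (fun x => ENNReal.ofReal (p x))
  compl_null : P Sᶜ = 0

/-! ### Local polynomials -/

/-- The set of `d`-tuples of natural numbers whose sum is at most `L` (the entries are then
automatically at most `L`). It indexes the local monomials directly, in place of an enumeration. -/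
abbrev MultiIndex (d L : ℕ) : Type := {a : Fin d → Fin (L + 1) // ∑ i, (a i : ℕ) ≤ L}

/-- The zero multi-index, which corresponds to the constant monomial. -/
def zeroIndex (d L : ℕ) : MultiIndex d L := ⟨fun _ => 0, by simp⟩

/-- `K^*`, the number of monomials of degree at most `L` in `d` variables. -/
def numMonomials (d L : ℕ) : ℕ := Fintype.card (MultiIndex d L)

/-- `D = ∑_{i=1}^L i * C(d+i-1, i)`, the sum of the degrees of all monomials of degree at most `L`
in `d` variables. -/
def degreeSum (d L : ℕ) : ℕ := ∑ i ∈ Finset.Icc 1 L, i * Nat.choose (d + i - 1) i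

/-- The local monomial `ζ_a(x,z) = ∏_i (z_i - x_i)^{a_i}`. -/
def localMonomial {d L : ℕ} (x z : RSpace d) (a : MultiIndex d L) : ℝ :=
  ∏ i, (z i - x i) ^ (a.1 i : ℕ)

/-! ### The `k`-nearest-neighbour local polynomial estimator -/

/-- The `k`-nearest-neighbour radius of `x`: the least `r` such that at least `k` of the points `X_i`
satisfy `‖X_i - x‖ ≤ r`, that is (for `1 ≤ k ≤ n`) the `k`-th order statistic of the distances
`‖X_i - x‖`. -/
def knnRadius {d n : ℕ} (k : ℕ) (X : Fin n → RSpace d) (x : RSpace d) : ℝ :=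
  sInf {r : ℝ | k ≤ #{i : Fin n | ‖X i - x‖ ≤ r}}

/-- The indices `i` with `‖X_i - x‖` at most the `k`-nearest-neighbour radius of `x`. -/
def knnIndices {d n : ℕ} (k : ℕ) (X : Fin n → RSpace d) (x : RSpace d) : Finset (Fin n) :=
  {i : Fin n | ‖X i - x‖ ≤ knnRadius k X x}

/-- The matrix `M(x) = ∑_i ζ(x,X_i) ζ(x,X_i)ᵀ 1{‖X_i - x‖ ≤ τ_k(x)}`. -/
def localGram {d n : ℕ} (L k : ℕ) (X : Fin n → RSpace d) (x : RSpace d) :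
    Matrix (MultiIndex d L) (MultiIndex d L) ℝ :=
  Matrix.of fun a b => ∑ i ∈ knnIndices k X x, localMonomial x (X i) a * localMonomial x (X i) b

/-- The least squares coefficients `M(x)⁻¹ ∑_i Z_i ζ(x,X_i) 1{‖X_i - x‖ ≤ τ_k(x)}` of the local
polynomial regression of the responses `Z_i` on the `X_i` around `x`. -/
def localCoeffs {d n : ℕ} (L k : ℕ) (X : Fin n → RSpace d) (Z : Fin n → ℝ) (x : RSpace d) :
    MultiIndex d L → ℝ :=
  (localGram L k X x)⁻¹ *ᵥ fun a => ∑ i ∈ knnIndices k X x, Z i * localMonomial x (X i) a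

/-- The local least squares criterion. -/
def localLoss {d n : ℕ} (L k : ℕ) (X : Fin n → RSpace d) (Z : Fin n → ℝ) (x : RSpace d)
    (γ : MultiIndex d L → ℝ) : ℝ :=
  ∑ i ∈ knnIndices k X x, (Z i - ∑ a, γ a * localMonomial x (X i) a) ^ 2

/-- When `M(x)` is invertible, `localCoeffs` is the unique minimiser of the local least squares
criterion. -/
theorem localCoeffs_unique_argmin {d n : ℕ} (L k : ℕ) (X : Fin n → RSpace d) (Z : Fin n → ℝ)
    (x : RSpace d) (hM : IsUnit (localGram L k X x).det) (γ : MultiIndex d L → ℝ)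
    (hγ : γ ≠ localCoeffs L k X Z x) :
    localLoss L k X Z x (localCoeffs L k X Z x) < localLoss L k X Z x γ := by
  classical
  set g := localCoeffs L k X Z x with hg
  set N := knnIndices k X x with hN
  have normal : localGram L k X x *ᵥ g
      = fun a => ∑ i ∈ N, Z i * localMonomial x (X i) a := by
    rw [hg, localCoeffs, Matrix.mulVec_mulVec, Matrix.mul_nonsing_inv _ hM, Matrix.one_mulVec]
  have mv : ∀ v : MultiIndex d L → ℝ, ∀ a, (localGram L k X x *ᵥ v) a
      = ∑ i ∈ N, localMonomial x (X i) a * ∑ b, v b * localMonomial x (X i) b := by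
    intro v a
    simp only [Matrix.mulVec, dotProduct, localGram, Matrix.of_apply, Finset.sum_mul,
      Finset.mul_sum]
    rw [Finset.sum_comm]
    exact Finset.sum_congr rfl fun i _ => Finset.sum_congr rfl fun b _ => by ring
  set δ : MultiIndex d L → ℝ := fun a => γ a - g a with hδ
  have cross : ∑ i ∈ N, (Z i - ∑ b, g b * localMonomial x (X i) b) *
      (∑ a, δ a * localMonomial x (X i) a) = 0 := by
    have h1 : ∀ a : MultiIndex d L, ∑ i ∈ N, (Z i - ∑ b, g b * localMonomial x (X i) b) *
        localMonomial x (X i) a = 0 := by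
      intro a
      have h2 := congrFun normal a
      rw [mv] at h2
      simp only [sub_mul, Finset.sum_sub_distrib]
      rw [← h2, sub_eq_zero]
      exact Finset.sum_congr rfl fun i _ => by ring
    calc _ = ∑ a, δ a * ∑ i ∈ N, (Z i - ∑ b, g b * localMonomial x (X i) b) *
        localMonomial x (X i) a := by
          simp only [Finset.mul_sum]
          rw [Finset.sum_comm]
          exact Finset.sum_congr rfl fun i _ => Finset.sum_congr rfl fun b _ => by ring
      _ = 0 := by simp [h1]
  have expand : localLoss L k X Z x γ = localLoss L k X Z x g
      + ∑ i ∈ N, (∑ a, δ a * localMonomial x (X i) a) ^ 2 := by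
    have h3 : ∀ i, ∑ a, γ a * localMonomial x (X i) a
        = ∑ a, g a * localMonomial x (X i) a + ∑ a, δ a * localMonomial x (X i) a := by
      intro i
      rw [← Finset.sum_add_distrib]
      exact Finset.sum_congr rfl fun a _ => by simp only [hδ]; ring
    have h4 : localLoss L k X Z x γ = localLoss L k X Z x g
        - 2 * ∑ i ∈ N, (Z i - ∑ b, g b * localMonomial x (X i) b) *
          (∑ a, δ a * localMonomial x (X i) a)
        + ∑ i ∈ N, (∑ a, δ a * localMonomial x (X i) a) ^ 2 := by
      simp only [localLoss, h3]
      rw [Finset.mul_sum, ← Finset.sum_sub_distrib, ← Finset.sum_add_distrib]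
      exact Finset.sum_congr rfl fun i _ => by ring
    rw [h4, cross]; ring
  have hnn : 0 ≤ ∑ i ∈ N, (∑ a, δ a * localMonomial x (X i) a) ^ 2 :=
    Finset.sum_nonneg fun i _ => sq_nonneg _
  rcases hnn.lt_or_eq with hlt | heq
  · linarith
  · exfalso
    apply hγ
    have h5 : ∀ i ∈ N, ∑ a, δ a * localMonomial x (X i) a = 0 := by
      intro i hi
      have := (Finset.sum_eq_zero_iff_of_nonneg (fun i _ => sq_nonneg _)).1 heq.symm i hi
      exact pow_eq_zero_iff (two_ne_zero) |>.1 this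
    have h6 : localGram L k X x *ᵥ δ = 0 := by
      funext a
      rw [mv]
      exact Finset.sum_eq_zero fun i hi => by rw [h5 i hi, mul_zero]
    have h7 : δ = 0 := by
      have := congrArg (fun v => (localGram L k X x)⁻¹ *ᵥ v) h6
      simpa [Matrix.mulVec_mulVec, Matrix.nonsing_inv_mul _ hM] using this
    funext a
    have := congrFun h7 a
    simp only [hδ, Pi.zero_apply] at this
    linarith

/-- The local polynomial regression estimate at `x`: the constant coefficient of the fit. -/
def localPolyEstimate {d n : ℕ} (L k : ℕ) (X : Fin n → RSpace d) (Z : Fin n → ℝ) (x : RSpace d) :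
    ℝ :=
  localCoeffs L k X Z x (zeroIndex d L)

/-- The estimator `(1/m) ∑_j ĝ(X*_j)` of the target expectation, computed from the source
covariates `X_i`, the responses `Z_i` and the target covariates `X*_j`. -/
def targetEstimate {d n m : ℕ} (L k : ℕ) (X : Fin n → RSpace d) (Z : Fin n → ℝ)
    (Xs : Fin m → RSpace d) : ℝ :=
  (1 / (m : ℝ)) * ∑ j, localPolyEstimate L k X Z (Xs j)

/-! ### The sampling scheme and the conditional bias -/

/-- `(X_i, Y_i)` are i.i.d. with law `R`, `X*_j` are i.i.d. with law `Q`, and the two samples are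
independent of each other. -/
structure IsCovariateShiftSample {d n m : ℕ} {Ω : Type*} [MeasurableSpace Ω] (μ : Measure Ω)
    (R : Measure (RSpace d × ℝ)) (Q : Measure (RSpace d))
    (X : Fin n → Ω → RSpace d) (Y : Fin n → Ω → ℝ) (Xs : Fin m → Ω → RSpace d) : Prop where
  measurable_X : ∀ i, Measurable (X i)
  measurable_Y : ∀ i, Measurable (Y i)
  measurable_Xs : ∀ j, Measurable (Xs j)
  law_source : ∀ i, μ.map (fun ω => (X i ω, Y i ω)) = R
  law_target : ∀ j, μ.map (Xs j) = Q
  indep_source : iIndepFun (fun i ω => (X i ω, Y i ω)) μ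
  indep_target : iIndepFun Xs μ
  indep_source_target :
    IndepFun (fun ω (i : Fin n) => (X i ω, Y i ω)) (fun ω (j : Fin m) => Xs j ω) μ

/-- The estimator of the target expectation as a random variable, with responses `h(X_i, Y_i)`. -/
def estimatorRV {d n m : ℕ} {Ω : Type*} (L k : ℕ) (h : RSpace d → ℝ → ℝ)
    (X : Fin n → Ω → RSpace d) (Y : Fin n → Ω → ℝ) (Xs : Fin m → Ω → RSpace d) (ω : Ω) : ℝ :=
  targetEstimate L k (fun i => X i ω) (fun i => h (X i ω) (Y i ω)) (fun j => Xs j ω)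

/-- The conditional bias `E[ê_L(h) - e | X_1, …, X_n]`. -/
def conditionalBias {d n m : ℕ} {Ω : Type*} [MeasurableSpace Ω] (μ : Measure Ω) (L k : ℕ)
    (h : RSpace d → ℝ → ℝ) (e : ℝ)
    (X : Fin n → Ω → RSpace d) (Y : Fin n → Ω → ℝ) (Xs : Fin m → Ω → RSpace d) : Ω → ℝ :=
  μ[(fun ω => estimatorRV L k h X Y Xs ω - e) |
    MeasurableSpace.comap (fun ω (i : Fin n) => X i ω) inferInstance]

/-- All partial derivatives of order `l` of `g` are Hölder continuous on `K`, of order `β` with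
constant `Λ`. -/
def PartialsHolderOn {d : ℕ} (l : ℕ) (β Λ : ℝ) (g : RSpace d → ℝ) (K : Set (RSpace d)) : Prop :=
  ∀ s : Fin l → Fin d, ∀ x ∈ K, ∀ y ∈ K,
    |iteratedFDeriv ℝ l g x (fun a => EuclideanSpace.single (s a) 1)
      - iteratedFDeriv ℝ l g y (fun a => EuclideanSpace.single (s a) 1)| ≤ Λ * ‖x - y‖ ^ β

end

/-! ### Negative moments of polynomials -/

/-! Write `ĝ(x) = ∑ w_i h(X_i,Y_i)` with weights `w_i` depending only on the covariates and `x`.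
Given the covariates, responses average to `g`, so `B_n` is the integral over `Q` of the pointwise
bias `∑ w_i g(X_i) - g(x)` (`IsCovariateShiftSample.conditionalBias_eq`). By Jensen and Tonelli it
suffices to bound the mean squared pointwise bias uniformly over `x` in the domain
(`exists_lintegral_localBias_sq_le`).

When `M(x)` is invertible the weights reproduce polynomials of degree at most `l`, so the Taylor
polynomial of `g` at `x` can be subtracted. Cauchy-Schwarz bounds the squared bias by a multiple of
`Λ² τ^(2(l+β)) k v`, where `τ` is the neighbour radius, `k` is almost surely the number of
neighbours and `v = ∑ w_i² = (M⁻¹)₀₀` (`localBias_sq_le`). It remains to see that `k v` has bounded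
mean given `τ`, and that `τ^d` is of order `k/n` in all moments.

For `v`, cut neighbours into `B` blocks of `G` disjoint groups of `K*` points, and let `Δ` be the
scaled Vandermonde determinant of a group. Cramer's rule gives `Δ² v² ≤ (K*!)² ∑ w_i²` over the
group; summing over groups and dividing by `v`, `v ∑ Δ² ≤ (K*!)²`. The arithmetic-geometric
inequality inside a block and the arithmetic-harmonic one across blocks then give `B v ≤ (K*!)² B⁻¹
∑_b ∏_c |Δ_bc|^(-2/G)` (`ofReal_sum_sq_localWeight_le`). Groups are independent, so only the moment
of `|Δ|` of order `-2/G` is needed.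

Along a suitable common translation of its nodes, `Δ` is a polynomial in one variable of degree `D`
whose leading coefficient is a fixed nonzero number (`exists_polynomial_det_scaledVandermonde`). The
integral of its `-t`-th power over the unit interval is bounded uniformly in the other coefficients
as soon as `t D < 1` (`lintegral_abs_eval_rpow_neg_le`). With `t = 2/G` the choice `G = 2D+1` works.
One group structure then uses `(2D+1)K*` points besides the `k`-th neighbour, which is the condition
on `k`.

For `τ`, decompose according to which point is the `k`-th neighbour and which `k-1` points lie
inside (`lintegral_le_sum_kth`). Given the `k`-th neighbour, the inner points are independent with
law `P` restricted to the ball, which is comparable to Lebesgue measure there. Integer moments of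
the ball mass follow by comparison with a larger sample (`lintegral_ballMass_moment_le`).

The constant depends on `P` and not on the domain because an admissible domain is determined by `P`
(`IsRegularOn.subset_of_isClosed`). -/

theorem ENNReal.rpow_neg_le_rpow_neg {a b : ℝ≥0∞} (hab : a ≤ b) {t : ℝ} (ht : 0 ≤ t) :
    b ^ (-t) ≤ a ^ (-t) := by
  rw [ENNReal.rpow_neg, ENNReal.rpow_neg]
  exact ENNReal.inv_le_inv.2 (ENNReal.rpow_le_rpow hab ht)

/-- The local negative moment `∫_{-1}^1 |u|^{-θ} du`, increased by one. -/
noncomputable def absNegMoment (θ : ℝ) : ℝ≥0∞ :=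
  1 + ∫⁻ u in Set.Icc (-1 : ℝ) 1, ENNReal.ofReal |u| ^ (-θ)

theorem absNegMoment_lt_top {θ : ℝ} (hθ : θ < 1) : absNegMoment θ < ⊤ := by
  have key : IntegrableOn (fun u : ℝ => u ^ (-θ)) (Set.Ioc 0 1) := by
    have := intervalIntegral.intervalIntegrable_rpow' (a := 0) (b := 1) (r := -θ) (by linarith)
    rwa [intervalIntegrable_iff_integrableOn_Ioc_of_le zero_le_one] at this
  have hpos : ∫⁻ u in Set.Ioc (0 : ℝ) 1, ENNReal.ofReal |u| ^ (-θ) < ⊤ := by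
    refine lt_of_le_of_lt (le_of_eq ?_) key.2
    refine setLIntegral_congr_fun measurableSet_Ioc fun u hu => ?_
    have hu0 : 0 < u := hu.1
    simp only
    rw [abs_of_pos hu0, ENNReal.ofReal_rpow_of_pos hu0, Real.enorm_eq_ofReal
      (Real.rpow_nonneg hu0.le _)]
  have hneg : ∫⁻ u in Set.Ico (-1 : ℝ) 0, ENNReal.ofReal |u| ^ (-θ) < ⊤ := by
    have h := (Measure.measurePreserving_neg (volume : Measure ℝ)).setLIntegral_comp_preimage
      (s := Set.Ioc (0 : ℝ) 1) (f := fun u => ENNReal.ofReal |u| ^ (-θ)) measurableSet_Ioc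
      (by fun_prop)
    simp only [abs_neg, Set.neg_preimage, Set.neg_Ioc, neg_zero] at h
    rw [h]; exact hpos
  refine ENNReal.add_lt_top.2 ⟨ENNReal.one_lt_top, ?_⟩
  have hsub : Set.Icc (-1 : ℝ) 1 ⊆ (Set.Ico (-1 : ℝ) 0 ∪ Set.Ioc 0 1) ∪ {0} := by
    intro u hu
    rcases lt_trichotomy u 0 with h | h | h
    · exact Or.inl (Or.inl ⟨hu.1, h⟩)
    · exact Or.inr h
    · exact Or.inl (Or.inr ⟨h, hu.2⟩)
  refine lt_of_le_of_lt (lintegral_mono_set hsub) (lt_of_le_of_lt (lintegral_union_le _ _ _) ?_)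
  refine ENNReal.add_lt_top.2 ⟨lt_of_le_of_lt (lintegral_union_le _ _ _)
    (ENNReal.add_lt_top.2 ⟨hneg, hpos⟩), ?_⟩
  simp

/-- Where `|s - ρ| > 1` the integrand is at most one, and what remains is a translate of the
integral over `[-1,1]`. Uniformity in `ρ` makes the position of the roots of a polynomial
irrelevant. -/
theorem lintegral_abs_sub_rpow_neg_le {θ : ℝ} (hθ : 0 ≤ θ) (ρ : ℝ) :
    ∫⁻ s in Set.Icc (0 : ℝ) 1, ENNReal.ofReal |s - ρ| ^ (-θ) ≤ absNegMoment θ := by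
  have h1 : ∀ s : ℝ, ENNReal.ofReal |s - ρ| ^ (-θ) ≤
      1 + (Set.Icc (-1 : ℝ) 1).indicator (fun u => ENNReal.ofReal |u| ^ (-θ)) (s - ρ) := by
    intro s
    by_cases hs : s - ρ ∈ Set.Icc (-1 : ℝ) 1
    · rw [Set.indicator_of_mem hs]; exact le_add_self
    · refine le_add_right ?_
      have h1 : (1 : ℝ≥0∞) ≤ ENNReal.ofReal |s - ρ| := by
        rw [ENNReal.one_le_ofReal]
        by_contra h
        exact hs (abs_le.1 (not_le.1 h).le)
      simpa using ENNReal.rpow_neg_le_rpow_neg h1 hθ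
  calc ∫⁻ s in Set.Icc (0 : ℝ) 1, ENNReal.ofReal |s - ρ| ^ (-θ)
      ≤ ∫⁻ s in Set.Icc (0 : ℝ) 1, (1 + (Set.Icc (-1 : ℝ) 1).indicator
          (fun u => ENNReal.ofReal |u| ^ (-θ)) (s - ρ)) := lintegral_mono fun s => h1 s
    _ = 1 + ∫⁻ s in Set.Icc (0 : ℝ) 1, (Set.Icc (-1 : ℝ) 1).indicator
          (fun u => ENNReal.ofReal |u| ^ (-θ)) (s - ρ) := by
        rw [lintegral_add_left measurable_const]; simp
    _ ≤ 1 + ∫⁻ s, (Set.Icc (-1 : ℝ) 1).indicator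
          (fun u => ENNReal.ofReal |u| ^ (-θ)) (s - ρ) := by
        gcongr; exact Measure.restrict_le_self
    _ = absNegMoment θ := by
        rw [lintegral_sub_right_eq_self
          (fun s => (Set.Icc (-1 : ℝ) 1).indicator (fun u => ENNReal.ofReal |u| ^ (-θ)) s) ρ,
          lintegral_indicator measurableSet_Icc, absNegMoment]

/-- Factor over `ℂ`. Moving a root to its real part only shrinks the factor, and a product of
`natDegree` singular factors is at most a power of the largest, hence at most the sum of these
powers. The summand one covers the case without roots. -/
theorem abs_eval_rpow_neg_le (p : Polynomial ℝ) (hp : p ≠ 0) {t : ℝ} (ht : 0 ≤ t) (s : ℝ) :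
    ENNReal.ofReal |p.eval s| ^ (-t) ≤ ENNReal.ofReal |p.leadingCoeff| ^ (-t) *
      (1 + ∑ z ∈ (p.map (algebraMap ℝ ℂ)).roots.toFinset,
        ENNReal.ofReal |s - z.re| ^ (-(t * p.natDegree))) := by
  set P := p.map (algebraMap ℝ ℂ) with hP
  have hsplit : P.Splits := IsAlgClosed.splits P
  have hP0 : P ≠ 0 := (Polynomial.map_ne_zero_iff (algebraMap ℝ ℂ).injective).2 hp
  have hcard : P.roots.card = p.natDegree := by
    rw [← hsplit.natDegree_eq_card_roots, hP, Polynomial.natDegree_map]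
  have hev : ((p.eval s : ℝ) : ℂ) = p.leadingCoeff * (P.roots.map fun z => (s : ℂ) - z).prod := by
    have h1 := hsplit.eval_eq_prod_roots (x := (s : ℂ))
    have h2 : P.eval (s : ℂ) = ((p.eval s : ℝ) : ℂ) := by
      rw [hP, Polynomial.eval_map_algebraMap]
      exact Polynomial.aeval_algebraMap_apply_eq_algebraMap_eval s p
    have h3 : P.leadingCoeff = (p.leadingCoeff : ℂ) := by
      rw [hP, Polynomial.leadingCoeff_map]; rfl
    rw [← h2, h1, h3]
  have hnorm : |p.eval s| = |p.leadingCoeff| * (P.roots.map fun z => ‖(s : ℂ) - z‖).prod := by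
    have h1 := congrArg norm hev
    rw [Complex.norm_real, norm_mul, Complex.norm_real] at h1
    rw [Real.norm_eq_abs, Real.norm_eq_abs] at h1
    rw [h1]
    congr 1
    have h2 := map_multiset_prod (normHom : ℂ →*₀ ℝ) (P.roots.map fun z => (s : ℂ) - z)
    simpa [Multiset.map_map, Function.comp_def] using h2
  have hprod : ∀ m : Multiset ℂ, ENNReal.ofReal ((m.map fun z => ‖(s : ℂ) - z‖).prod) ^ (-t) ≤
      (m.map fun z => ENNReal.ofReal |s - z.re| ^ (-t)).prod := by
    intro m
    induction m using Multiset.induction_on with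
    | empty => simp
    | cons a m ih =>
      rw [Multiset.map_cons, Multiset.prod_cons, Multiset.map_cons, Multiset.prod_cons,
        ENNReal.ofReal_mul (norm_nonneg _)]
      have hle : ENNReal.ofReal ‖(s : ℂ) - a‖ ^ (-t) ≤ ENNReal.ofReal |s - a.re| ^ (-t) := by
        refine ENNReal.rpow_neg_le_rpow_neg (ENNReal.ofReal_le_ofReal ?_) ht
        simpa using Complex.abs_re_le_norm ((s : ℂ) - a)
      rw [ENNReal.mul_rpow_of_ne_top ENNReal.ofReal_ne_top ENNReal.ofReal_ne_top]
      exact mul_le_mul' hle ih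
  rw [hnorm, ENNReal.ofReal_mul (abs_nonneg _),
    ENNReal.mul_rpow_of_ne_top ENNReal.ofReal_ne_top ENNReal.ofReal_ne_top]
  refine mul_le_mul' le_rfl ((hprod _).trans ?_)
  rcases P.roots.toFinset.eq_empty_or_nonempty with he | hne
  · rw [Multiset.toFinset_eq_empty.1 he]; simp
  · obtain ⟨z, hz, hmax⟩ := Finset.exists_max_image P.roots.toFinset
      (fun z => ENNReal.ofReal |s - z.re| ^ (-t)) hne
    have h1 : (P.roots.map fun z => ENNReal.ofReal |s - z.re| ^ (-t)).prod ≤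
        (ENNReal.ofReal |s - z.re| ^ (-t)) ^ p.natDegree := by
      have := Multiset.prod_le_pow_card (P.roots.map fun z => ENNReal.ofReal |s - z.re| ^ (-t))
        (ENNReal.ofReal |s - z.re| ^ (-t)) (by
          intro u hu
          obtain ⟨y, hy, rfl⟩ := Multiset.mem_map.1 hu
          exact hmax y (Multiset.mem_toFinset.2 hy))
      rwa [Multiset.card_map, hcard] at this
    refine h1.trans (le_add_left ?_)
    rw [← ENNReal.rpow_natCast, ← ENNReal.rpow_mul, neg_mul]
    exact Finset.single_le_sum (f := fun z : ℂ => ENNReal.ofReal |s - z.re| ^ (-(t * p.natDegree)))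
      (fun _ _ => zero_le) hz

/-- The negative moment of order `t` over `[0,1]` of a polynomial of degree `D` with given leading
coefficient is bounded, uniformly in the remaining coefficients, when `t * D < 1`. -/
theorem lintegral_abs_eval_rpow_neg_le (p : Polynomial ℝ) {D : ℕ} (hdeg : p.natDegree ≤ D)
    (hD : p.coeff D ≠ 0) {t : ℝ} (ht : 0 ≤ t) :
    ∫⁻ s in Set.Icc (0 : ℝ) 1, ENNReal.ofReal |p.eval s| ^ (-t) ≤
      ENNReal.ofReal |p.coeff D| ^ (-t) * (1 + D * absNegMoment (t * D)) := by
  have hdeg' : p.natDegree = D := le_antisymm hdeg (Polynomial.le_natDegree_of_ne_zero hD)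
  have hp : p ≠ 0 := by rintro rfl; simp at hD
  have hlead : p.leadingCoeff = p.coeff D := by rw [Polynomial.leadingCoeff, hdeg']
  set T := (p.map (algebraMap ℝ ℂ)).roots.toFinset with hT
  have hcard : (#T : ℝ≥0∞) ≤ D := by
    have h1 : #T ≤ D := (Multiset.toFinset_card_le _).trans
      ((Polynomial.card_roots' _).trans (by rw [Polynomial.natDegree_map, hdeg']))
    exact_mod_cast h1
  calc ∫⁻ s in Set.Icc (0 : ℝ) 1, ENNReal.ofReal |p.eval s| ^ (-t)
      ≤ ∫⁻ s in Set.Icc (0 : ℝ) 1, ENNReal.ofReal |p.coeff D| ^ (-t) *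
        (1 + ∑ z ∈ T, ENNReal.ofReal |s - z.re| ^ (-(t * D))) := by
        refine lintegral_mono fun s => ?_
        have := abs_eval_rpow_neg_le p hp ht s
        rwa [hdeg', hlead] at this
    _ = ENNReal.ofReal |p.coeff D| ^ (-t) *
        (1 + ∑ z ∈ T, ∫⁻ s in Set.Icc (0 : ℝ) 1, ENNReal.ofReal |s - z.re| ^ (-(t * D))) := by
        rw [lintegral_const_mul _ (by fun_prop), lintegral_add_left measurable_const,
          lintegral_finsetSum _ (fun z _ => by fun_prop)]
        simp
    _ ≤ ENNReal.ofReal |p.coeff D| ^ (-t) * (1 + ∑ z ∈ T, absNegMoment (t * D)) := by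
        gcongr with z hz
        exact lintegral_abs_sub_rpow_neg_le (by positivity) _
    _ ≤ _ := by
        rw [Finset.sum_const, nsmul_eq_mul]
        gcongr

/-! ### Vandermonde matrices of local monomials -/

/-- The total degree of a multi-index. -/
def MultiIndex.degree {d L : ℕ} (a : MultiIndex d L) : ℕ := ∑ i, (a.1 i : ℕ)

theorem MultiIndex.degree_le {d L : ℕ} (a : MultiIndex d L) : a.degree ≤ L := a.2

theorem card_multiIndex_degree_eq {d L j : ℕ} (hj : j ≤ L) :
    #{a : MultiIndex d L | a.degree = j} = (d + j - 1).choose j := by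
  have h := card_finsuppAntidiag_nat_eq_choose (s := (univ : Finset (Fin d))) j
  rw [card_univ, Fintype.card_fin] at h
  rw [← h]
  refine Finset.card_bij' (fun a _ => Finsupp.equivFunOnFinite.symm fun i => (a.1 i : ℕ))
    (fun f hf => ⟨fun i => ⟨f i, ?_⟩, ?_⟩) ?_ ?_ ?_ ?_
  · have h1 : ∑ i, f i = j := (mem_finsuppAntidiag.1 hf).1
    have h2 : f i ≤ ∑ i, f i := single_le_sum (f := fun i => f i) (fun _ _ => Nat.zero_le _) (mem_univ i)
    omega
  · have h1 : ∑ i, f i = j := (mem_finsuppAntidiag.1 hf).1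
    simpa [h1] using hj
  · intro a ha
    rw [mem_finsuppAntidiag]
    exact ⟨(mem_filter.1 ha).2, subset_univ _⟩
  · intro f hf
    have h1 : ∑ i, f i = j := (mem_finsuppAntidiag.1 hf).1
    exact mem_filter.2 ⟨mem_univ _, h1⟩
  · intro a _; rfl
  · intro f _; ext i; rfl

theorem sum_degree_multiIndex (d L : ℕ) : ∑ a : MultiIndex d L, a.degree = degreeSum d L := by
  have h1 : ∑ a : MultiIndex d L, a.degree =
      ∑ j ∈ range (L + 1), ∑ a : MultiIndex d L with a.degree = j, a.degree :=
    (sum_fiberwise_of_maps_to (fun a _ => mem_range.2 (Nat.lt_succ_of_le a.degree_le)) _).symm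
  have h2 : ∀ j ∈ range (L + 1), ∑ a : MultiIndex d L with a.degree = j, a.degree =
      j * (d + j - 1).choose j := by
    intro j hj
    rw [sum_congr rfl (fun a ha => (mem_filter.1 ha).2), sum_const, smul_eq_mul,
      card_multiIndex_degree_eq (Nat.lt_succ_iff.1 (mem_range.1 hj)), mul_comm]
  rw [h1, sum_congr rfl h2, degreeSum]
  refine (sum_subset (fun j hj => ?_) fun j hj hj' => ?_).symm
  · rw [mem_Icc] at hj; rw [mem_range]; omega
  · rw [mem_range] at hj; rw [mem_Icc] at hj'
    rw [show j = 0 by omega, zero_mul]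

/-- The matrix `∏_i ((z_a - x)_i / r)^{α_i}` of scaled local monomials at the points `z_a`. -/
noncomputable def scaledVandermonde {d L : ℕ} (x : RSpace d) (r : ℝ)
    (z : MultiIndex d L → RSpace d) : Matrix (MultiIndex d L) (MultiIndex d L) ℝ :=
  Matrix.of fun a b => ∏ i, ((z a i - x i) / r) ^ (b.1 i : ℕ)

/-- Nodes at which the local monomials are unisolvent. -/
theorem exists_det_scaledVandermonde_ne_zero (d L : ℕ) :
    ∃ w : MultiIndex d L → RSpace d, (scaledVandermonde 0 1 w).det ≠ 0 := by
  set e := Fintype.equivFin (MultiIndex d L) with he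
  -- A multi-index is read as the base `L+1` digits of an integer, so distinct multi-indices get
  -- distinct powers of two.
  let ν : Fin (Fintype.card (MultiIndex d L)) → ℝ :=
    fun c => 2 ^ (∑ i, (((e.symm c).1 i : Fin (L + 1)) : ℕ) * (L + 1) ^ (i : ℕ))
  have hν : Function.Injective ν := by
    intro c c' h
    have h1 := pow_right_injective₀ (M₀ := ℝ) (by norm_num : (0 : ℝ) < 2) (by norm_num) h
    have h2 : finFunctionFinEquiv (e.symm c).1 = finFunctionFinEquiv (e.symm c').1 :=
      Fin.ext (by simpa [finFunctionFinEquiv_apply] using h1)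
    exact e.symm.injective (Subtype.ext (finFunctionFinEquiv.injective h2))
  -- The node `a` is the coordinatewise `e a`-th power of one point whose monomials take the values
  -- `ν`; the matrix is then a transposed classical Vandermonde matrix.
  refine ⟨fun a => WithLp.toLp 2 fun i => ((2 : ℝ) ^ ((L + 1) ^ (i : ℕ))) ^ (e a : ℕ), ?_⟩
  have hM : scaledVandermonde 0 1
      (fun a : MultiIndex d L => (WithLp.toLp 2 fun i : Fin d => ((2 : ℝ) ^ ((L + 1) ^ (i : ℕ))) ^ (e a : ℕ)))
      = ((Matrix.vandermonde ν)ᵀ).submatrix e e := by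
    ext a b
    simp only [scaledVandermonde, Matrix.of_apply, Matrix.submatrix_apply, Matrix.transpose_apply,
      Matrix.vandermonde_apply, ν, Equiv.symm_apply_apply, PiLp.zero_apply, sub_zero, div_one]
    rw [← pow_mul, Finset.sum_mul, ← Finset.prod_pow_eq_pow_sum]
    refine Finset.prod_congr rfl fun i _ => ?_
    rw [← pow_mul, ← pow_mul]
    congr 1; ring
  rw [hM, Matrix.det_submatrix_equiv_self, Matrix.det_transpose]
  exact Matrix.det_vandermonde_ne_zero_iff.2 hν

theorem Polynomial.natDegree_prod_le_and_coeff {ι R : Type*} [CommRing R] (s : Finset ι)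
    (f : ι → Polynomial R) (n : ι → ℕ) (hf : ∀ i ∈ s, (f i).natDegree ≤ n i) :
    (∏ i ∈ s, f i).natDegree ≤ ∑ i ∈ s, n i ∧
      (∏ i ∈ s, f i).coeff (∑ i ∈ s, n i) = ∏ i ∈ s, (f i).coeff (n i) := by
  classical
  induction s using Finset.induction_on with
  | empty => simp
  | insert a s ha ih =>
    have ih' := ih fun i hi => hf i (mem_insert_of_mem hi)
    have ha' := hf a (mem_insert_self a s)
    rw [prod_insert ha, sum_insert ha, prod_insert ha]
    exact ⟨Polynomial.natDegree_mul_le_of_le ha' ih'.1,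
      by rw [Polynomial.coeff_mul_add_eq_of_natDegree_le ha' ih'.1, ih'.2]⟩

/-- Along a line the determinant of the scaled Vandermonde matrix is a polynomial of degree at most
the sum of the degrees of the monomials, whose top coefficient depends on the direction only. -/
theorem exists_polynomial_det_scaledVandermonde {d L : ℕ} (x : RSpace d) {r : ℝ} (hr : r ≠ 0)
    (z w : MultiIndex d L → RSpace d) :
    ∃ p : Polynomial ℝ, p.natDegree ≤ degreeSum d L ∧
      p.coeff (degreeSum d L) = (scaledVandermonde 0 1 w).det ∧
      ∀ s, p.eval s = (scaledVandermonde x r (z + (s * r) • w)).det := by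
  let V : Matrix (MultiIndex d L) (MultiIndex d L) (Polynomial ℝ) := Matrix.of fun a b =>
    ∏ i, (Polynomial.C (w a i) * Polynomial.X + Polynomial.C ((z a i - x i) / r)) ^ (b.1 i : ℕ)
  have hV : ∀ a b, (V a b).natDegree ≤ b.degree ∧
      (V a b).coeff b.degree = scaledVandermonde 0 1 w a b := by
    intro a b
    have h1 := Polynomial.natDegree_prod_le_and_coeff univ
      (fun i => (Polynomial.C (w a i) * Polynomial.X + Polynomial.C ((z a i - x i) / r))
        ^ (b.1 i : ℕ)) (fun i => (b.1 i : ℕ)) (fun i _ => by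
          simpa using Polynomial.natDegree_pow_le_of_le (b.1 i : ℕ)
            (Polynomial.natDegree_linear_le (a := w a i) (b := (z a i - x i) / r)))
    refine ⟨h1.1, h1.2.trans ?_⟩
    simp only [scaledVandermonde, Matrix.of_apply, PiLp.zero_apply, sub_zero, div_one]
    refine Finset.prod_congr rfl fun i _ => ?_
    have h2 := Polynomial.coeff_pow_of_natDegree_le (m := (b.1 i : ℕ))
      (Polynomial.natDegree_linear_le (a := w a i) (b := (z a i - x i) / r))
    simpa using h2
  -- Each term of the Leibniz formula takes one entry per column, and the degree bound depends on
  -- the column alone. All terms thus share the same degree bound, and their top coefficients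
  -- reassemble into the determinant for `w`.
  have hterm : ∀ σ : Equiv.Perm (MultiIndex d L),
      (∏ a, V (σ a) a).natDegree ≤ degreeSum d L ∧
      (∏ a, V (σ a) a).coeff (degreeSum d L) = ∏ a, scaledVandermonde 0 1 w (σ a) a := by
    intro σ
    have h1 := Polynomial.natDegree_prod_le_and_coeff univ (fun a => V (σ a) a)
      (fun a => a.degree) (fun a _ => (hV (σ a) a).1)
    rw [sum_degree_multiIndex] at h1
    exact ⟨h1.1, h1.2.trans (Finset.prod_congr rfl fun a _ => (hV (σ a) a).2)⟩
  refine ⟨V.det, ?_, ?_, fun s => ?_⟩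
  · rw [Matrix.det_apply]
    refine Polynomial.natDegree_sum_le_of_forall_le _ _ fun σ _ => ?_
    rw [Units.smul_def, zsmul_eq_mul]
    refine (Polynomial.natDegree_mul_le).trans ?_
    rw [Polynomial.natDegree_intCast, zero_add]
    exact (hterm σ).1
  · rw [Matrix.det_apply, Matrix.det_apply, Polynomial.finsetSum_coeff]
    refine Finset.sum_congr rfl fun σ _ => ?_
    rw [Units.smul_def, Units.smul_def, Polynomial.coeff_smul, (hterm σ).2]
  · rw [← Polynomial.coe_evalRingHom, RingHom.map_det]
    congr 1
    ext a b
    simp only [RingHom.mapMatrix_apply, Matrix.map_apply, V, Matrix.of_apply,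
      Polynomial.coe_evalRingHom, Polynomial.eval_prod, Polynomial.eval_pow, Polynomial.eval_add,
      Polynomial.eval_mul, Polynomial.eval_C, Polynomial.eval_X, scaledVandermonde, Pi.add_apply,
      Pi.smul_apply, PiLp.add_apply, PiLp.smul_apply, smul_eq_mul]
    refine Finset.prod_congr rfl fun i _ => ?_
    congr 1
    field_simp
    ring

theorem measurable_det_scaledVandermonde {d L : ℕ} :
    Measurable fun q : (RSpace d × ℝ) × (MultiIndex d L → RSpace d) =>
      (scaledVandermonde q.1.1 q.1.2 q.2).det := by
  simp only [Matrix.det_apply, scaledVandermonde, Matrix.of_apply, Units.smul_def, zsmul_eq_mul]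
  fun_prop

/-! ### Negative moments of the Vandermonde determinant -/

/-- `OuterMeasure.pi` is the largest outer measure dominated on boxes by the products of the masses,
and the smaller product measure is dominated in this way. -/
theorem MeasureTheory.Measure.pi_le_pi {ι E : Type*} [Fintype ι] [MeasurableSpace E]
    {μ ν : ι → Measure E} [∀ i, SigmaFinite (μ i)] (h : ∀ i, μ i ≤ ν i) :
    Measure.pi μ ≤ Measure.pi ν := by
  refine Measure.le_iff.2 fun s hs => ?_
  have h1 : (Measure.pi μ).toOuterMeasure ≤ OuterMeasure.pi fun i => (ν i).toOuterMeasure := by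
    refine OuterMeasure.le_pi.2 fun t _ => ?_
    change Measure.pi μ (Set.univ.pi t) ≤ _
    rw [Measure.pi_pi]
    exact Finset.prod_le_prod' fun i _ => h i (t i)
  refine (h1 s).trans ?_
  rw [Measure.pi_def]
  exact le_toMeasure_apply _ _ s

theorem MeasureTheory.Measure.pi_const_le_smul {ι E : Type*} [Fintype ι] [MeasurableSpace E]
    {μ ν : Measure E} [SigmaFinite μ] [SigmaFinite ν] {b : NNReal} (h : μ ≤ b • ν) :
    Measure.pi (fun _ : ι => μ) ≤ b ^ Fintype.card ι • Measure.pi (fun _ : ι => ν) := by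
  have h1 : Measure.pi (fun _ : ι => b • ν) = b ^ Fintype.card ι • Measure.pi (fun _ : ι => ν) := by
    refine Measure.pi_eq fun s _ => ?_
    simp only [Measure.smul_apply, Measure.pi_pi, ENNReal.smul_def, smul_eq_mul,
      Finset.prod_mul_distrib, prod_const, card_univ, ENNReal.coe_pow]
  rw [← h1]
  exact Measure.pi_le_pi fun _ => h

/-- The negative power of order `t` of the scaled Vandermonde determinant. -/
noncomputable def detWeight {d L : ℕ} (t : ℝ) (x : RSpace d) (r : ℝ)
    (z : MultiIndex d L → RSpace d) : ℝ≥0∞ :=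
  ENNReal.ofReal |(scaledVandermonde x r z).det| ^ (-t)

theorem measurable_detWeight {d L : ℕ} (t : ℝ) (x : RSpace d) (r : ℝ) :
    Measurable (detWeight (d := d) (L := L) t x r) := by
  have h := (measurable_det_scaledVandermonde (d := d) (L := L)).comp
    (f := fun z : MultiIndex d L → RSpace d => ((x, r), z)) (by fun_prop)
  unfold detWeight
  exact (ENNReal.measurable_ofReal.comp (continuous_abs.measurable.comp h)).pow_const _

/-- Shift the nodes by `s r w` with `det V(w) ≠ 0` and average over `s` in `[0,1]`. On each line the
determinant is a polynomial with fixed leading coefficient, so the integral in `s` is bounded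
uniformly in the base point. The shift only costs enlarging the ball by the factor `1 + W`. -/
theorem exists_lintegral_detWeight_volume_le (d L : ℕ) {t : ℝ} (ht : 0 ≤ t)
    (htD : t * degreeSum d L < 1) :
    ∃ C : ℝ≥0∞, C < ⊤ ∧ ∀ (x : RSpace d) (r : ℝ), 0 < r →
      ∫⁻ z in Set.univ.pi fun _ => Metric.closedBall x r, detWeight (L := L) t x r z ≤
        C * (volume (Metric.closedBall x r)) ^ numMonomials d L := by
  obtain ⟨w, hw⟩ := exists_det_scaledVandermonde_ne_zero d L
  obtain ⟨W, hW0, hW⟩ : ∃ W : ℝ, 0 ≤ W ∧ ∀ a, ‖w a‖ ≤ W :=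
    ⟨∑ a, ‖w a‖, by positivity, fun a =>
      single_le_sum (f := fun a => ‖w a‖) (fun _ _ => norm_nonneg _) (mem_univ a)⟩
  set C₁ : ℝ≥0∞ := ENNReal.ofReal |(scaledVandermonde 0 1 w).det| ^ (-t) *
    (1 + degreeSum d L * absNegMoment (t * degreeSum d L)) with hC₁
  have hC₁top : C₁ < ⊤ := by
    refine ENNReal.mul_lt_top ?_ (ENNReal.add_lt_top.2 ⟨ENNReal.one_lt_top,
      ENNReal.mul_lt_top (ENNReal.natCast_lt_top _) (absNegMoment_lt_top htD)⟩)
    rw [ENNReal.ofReal_rpow_of_pos (abs_pos.2 hw)]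
    exact ENNReal.ofReal_lt_top
  refine ⟨C₁ * ENNReal.ofReal ((1 + W) ^ d) ^ numMonomials d L,
    ENNReal.mul_lt_top hC₁top (ENNReal.pow_lt_top ENNReal.ofReal_lt_top), fun x r hr => ?_⟩
  set A := Set.univ.pi fun _ : MultiIndex d L => Metric.closedBall x r with hA
  set A' := Set.univ.pi fun _ : MultiIndex d L => Metric.closedBall x ((1 + W) * r) with hA'
  have hAm : MeasurableSet A := MeasurableSet.univ_pi fun _ => measurableSet_closedBall
  have hA'm : MeasurableSet A' := MeasurableSet.univ_pi fun _ => measurableSet_closedBall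
  have hφm := measurable_detWeight (L := L) t x r
  have hshift : ∀ s ∈ Set.Icc (0 : ℝ) 1, ∫⁻ z in A, detWeight t x r z ≤
      ∫⁻ z in A', detWeight t x r (z + (s * r) • w) := by
    intro s hs
    rw [← lintegral_indicator hAm, ← lintegral_indicator hA'm,
      ← lintegral_add_right_eq_self _ ((s * r) • w)]
    refine lintegral_mono fun z => ?_
    by_cases hz : z + (s * r) • w ∈ A
    · have hz' : z ∈ A' := by
        intro a _
        have h1 : ‖z a + (s * r) • w a - x‖ ≤ r := by simpa [dist_eq_norm] using hz a trivial
        have h2 : ‖(s * r) • w a‖ ≤ r * W := by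
          rw [norm_smul, Real.norm_eq_abs, abs_of_nonneg (mul_nonneg hs.1 hr.le)]
          calc s * r * ‖w a‖ ≤ 1 * r * W := by
                gcongr
                · exact hs.2
                · exact hW a
            _ = r * W := by ring
        rw [Metric.mem_closedBall, dist_eq_norm]
        calc ‖z a - x‖ = ‖(z a + (s * r) • w a - x) - (s * r) • w a‖ := by congr 1; abel
          _ ≤ r + r * W := (norm_sub_le _ _).trans (add_le_add h1 h2)
          _ = (1 + W) * r := by ring
      simp only [Set.indicator_of_mem hz, Set.indicator_of_mem hz', le_refl]
    · simp only [Set.indicator_of_notMem hz, zero_le]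
  have hmeas : Measurable fun q : ℝ × (MultiIndex d L → RSpace d) =>
      detWeight t x r (q.2 + (q.1 * r) • w) := hφm.comp (by fun_prop)
  calc ∫⁻ z in A, detWeight t x r z
      = ∫⁻ _s in Set.Icc (0 : ℝ) 1, ∫⁻ z in A, detWeight t x r z := by simp
    _ ≤ ∫⁻ s in Set.Icc (0 : ℝ) 1, ∫⁻ z in A', detWeight t x r (z + (s * r) • w) :=
        setLIntegral_mono' measurableSet_Icc hshift
    _ = ∫⁻ z in A', ∫⁻ s in Set.Icc (0 : ℝ) 1, detWeight t x r (z + (s * r) • w) :=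
        lintegral_lintegral_swap hmeas.aemeasurable
    _ ≤ ∫⁻ _z in A', C₁ := by
        refine lintegral_mono fun z => ?_
        obtain ⟨p, hp1, hp2, hp3⟩ := exists_polynomial_det_scaledVandermonde x hr.ne' z w
        have := lintegral_abs_eval_rpow_neg_le p hp1 (by rw [hp2]; exact hw) ht
        simp only [hp3, hp2] at this
        exact this
    _ = _ := by
        rw [lintegral_const, Measure.restrict_apply_univ, hA', volume_pi_pi, prod_const, card_univ,
          Measure.addHaar_closedBall_mul _ _ (by linarith) hr.le, mul_pow,
          Measure.addHaar_closedBall_center volume x r, finrank_euclideanSpace_fin, numMonomials]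
        ring

/-- A measure dominated by Lebesgue measure which charges the ball of radius `r` around `x` at least
as much as `r ^ d`, up to constants. -/
theorem exists_lintegral_detWeight_le (d L : ℕ) {t : ℝ} (ht : 0 ≤ t)
    (htD : t * degreeSum d L < 1) (b : NNReal) {a : ℝ} (ha : 0 < a) :
    ∃ C : ℝ≥0∞, C < ⊤ ∧ ∀ (P : Measure (RSpace d)) [IsFiniteMeasure P] (x : RSpace d) (r : ℝ),
      P ≤ b • volume → 0 < r → ENNReal.ofReal (a * r ^ d) ≤ P (Metric.closedBall x r) →
      ∫⁻ z, detWeight (L := L) t x r z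
          ∂(Measure.pi fun _ => P.restrict (Metric.closedBall x r)) ≤
        C * (P (Metric.closedBall x r)) ^ numMonomials d L := by
  obtain ⟨C, hC, h⟩ := exists_lintegral_detWeight_volume_le d L ht htD
  set v := volume (Metric.closedBall (0 : RSpace d) 1) with hv
  have hvtop : v < ⊤ := measure_closedBall_lt_top
  refine ⟨(b : ℝ≥0∞) ^ numMonomials d L * C *
    (v * ENNReal.ofReal a⁻¹) ^ numMonomials d L, ?_, fun P _ x r hP hr hlow => ?_⟩
  · exact ENNReal.mul_lt_top (ENNReal.mul_lt_top (ENNReal.pow_lt_top ENNReal.coe_lt_top) hC)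
      (ENNReal.pow_lt_top (ENNReal.mul_lt_top hvtop ENNReal.ofReal_lt_top))
  set B := Metric.closedBall x r with hB
  have h1 : P.restrict B ≤ b • (volume : Measure (RSpace d)).restrict B := by
    rw [← Measure.restrict_smul]
    exact Measure.restrict_mono le_rfl hP
  have h2 : volume B ≤ v * ENNReal.ofReal a⁻¹ * P B := by
    rw [hB, Measure.addHaar_closedBall _ _ hr.le, finrank_euclideanSpace_fin]
    calc ENNReal.ofReal (r ^ d) * volume (Metric.ball (0 : RSpace d) 1)
        ≤ ENNReal.ofReal (r ^ d) * v := by exact mul_le_mul' le_rfl (measure_mono Metric.ball_subset_closedBall)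
      _ = v * ENNReal.ofReal a⁻¹ * ENNReal.ofReal (a * r ^ d) := by
          rw [mul_assoc, ← ENNReal.ofReal_mul (by positivity), inv_mul_cancel_left₀ ha.ne', mul_comm]
      _ ≤ _ := by gcongr
  calc ∫⁻ z, detWeight (L := L) t x r z ∂(Measure.pi fun _ => P.restrict B)
      ≤ ∫⁻ z, detWeight (L := L) t x r z ∂(b ^ Fintype.card (MultiIndex d L) •
          Measure.pi fun _ : MultiIndex d L => (volume : Measure (RSpace d)).restrict B) :=
        lintegral_mono' (Measure.pi_const_le_smul h1) le_rfl
    _ = (b : ℝ≥0∞) ^ numMonomials d L *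
          ∫⁻ z in Set.univ.pi fun _ => B, detWeight (L := L) t x r z := by
        rw [lintegral_smul_measure, volume_pi, Measure.restrict_pi_pi, ENNReal.smul_def, smul_eq_mul,
          ENNReal.coe_pow, numMonomials]
    _ ≤ (b : ℝ≥0∞) ^ numMonomials d L * (C * (v * ENNReal.ofReal a⁻¹ * P B) ^ numMonomials d L) := by
        gcongr
        exact (h x r hr).trans (by gcongr)
    _ = _ := by rw [mul_pow]; ring

/-! ### Products over disjoint blocks of independent coordinates -/

theorem measurePreserving_comp_equiv {ι κ E : Type*} [Fintype ι] [Fintype κ] [MeasurableSpace E]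
    (μ : κ → Measure E) [∀ i, SigmaFinite (μ i)] (σ : ι ≃ κ) :
    MeasurePreserving (fun (X : κ → E) i => X (σ i)) (Measure.pi μ)
      (Measure.pi fun i => μ (σ i)) := by
  refine ⟨by fun_prop, (Measure.pi_eq fun s hs => ?_).symm⟩
  rw [Measure.map_apply (by fun_prop) (MeasurableSet.univ_pi hs)]
  have h : (fun (X : κ → E) i => X (σ i)) ⁻¹' (Set.univ.pi s) =
      Set.univ.pi fun k => s (σ.symm k) := by
    ext X
    simp only [Set.mem_preimage, Set.mem_pi, Set.mem_univ, forall_const]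
    exact ⟨fun h k => by simpa using h (σ.symm k), fun h i => by simpa using h (σ i)⟩
  rw [h, Measure.pi_pi, ← σ.prod_comp]
  simp

/-- Induction on the number of blocks, splitting off the coordinates of one block by Tonelli. A
coordinate outside the blocks contributes its total mass, which allows the restricted laws used
later. -/
theorem lintegral_prod_blocks_le {M E : Type*} [Fintype M] [MeasurableSpace E] {ν₀ : Measure E}
    [SigmaFinite ν₀] {f : (M → E) → ℝ≥0∞} (hf : Measurable f) {C : ℝ≥0∞}
    (hC : ∫⁻ z, f z ∂(Measure.pi fun _ => ν₀) ≤ C * ν₀ Set.univ ^ Fintype.card M) (m : ℕ) :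
    ∀ {ι : Type} [Fintype ι] (ν : ι → Measure E) [∀ i, SigmaFinite (ν i)] (e : Fin m × M ↪ ι),
      (∀ c, ν (e c) = ν₀) →
      ∫⁻ X, ∏ c, f (fun a => X (e (c, a))) ∂(Measure.pi ν) ≤ C ^ m * ∏ i, ν i Set.univ := by
  classical
  induction m with
  | zero => intro ι _ ν _ e _; simp [Measure.pi_univ]
  | succ m ih =>
    intro ι _ ν _ e he
    obtain ⟨p, hp⟩ : ∃ p : ι → Prop, p = fun i => i ∈ Set.range fun a => e (0, a) := ⟨_, rfl⟩
    obtain ⟨σ, hσe⟩ : ∃ σ : M ≃ {i // p i}, ∀ a, (σ a : ι) = e (0, a) := by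
      subst hp
      exact ⟨Equiv.ofInjective (fun a => e (0, a)) fun a b h => by simpa using e.injective h,
        fun a => rfl⟩
    have hnp : ∀ q : Fin m × M, ¬ p (e (q.1.succ, q.2)) := by
      subst hp
      rintro q ⟨a, ha⟩
      have := e.injective ha
      simp [Fin.ext_iff] at this
    let e' : Fin m × M ↪ {i // ¬ p i} := ⟨fun q => ⟨e (q.1.succ, q.2), hnp q⟩, fun q q' h => by
      have := e.injective (Subtype.ext_iff.1 h)
      simpa [Prod.ext_iff] using this⟩
    have hmp := measurePreserving_piEquivPiSubtypeProd ν p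
    let F : ({i // p i} → E) × ({i // ¬ p i} → E) → ℝ≥0∞ := fun Z =>
      f (fun a => Z.1 (σ a)) * ∏ c, f (fun a => Z.2 (e' (c, a)))
    have hF1 : Measurable fun Z : {i // p i} → E => f (fun a => Z (σ a)) := hf.comp (by fun_prop)
    have hF2 : Measurable fun Z : {i // ¬ p i} → E => ∏ c, f (fun a => Z (e' (c, a))) :=
      Finset.measurable_prod _ fun c _ => hf.comp (by fun_prop)
    have hFX : ∀ X : ι → E, ∏ c, f (fun a => X (e (c, a))) =
        F (MeasurableEquiv.piEquivPiSubtypeProd (fun _ => E) p X) := by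
      intro X
      rw [Fin.prod_univ_succ]
      simp_rw [← hσe]
      rfl
    have hσ : ∀ a, ν (σ a) = ν₀ := fun a => by rw [hσe, he]
    have h1 : ∫⁻ Z : {i // p i} → E, f (fun a => Z (σ a)) ∂(Measure.pi fun i : {i // p i} => ν i) ≤
        C * ν₀ Set.univ ^ Fintype.card M := by
      rw [(measurePreserving_comp_equiv (fun i : {i // p i} => ν i) σ).lintegral_comp hf]
      simpa only [hσ] using hC
    have h2 := ih (fun i : {i // ¬ p i} => ν i) e' fun q => he _
    simp_rw [hFX]
    rw [hmp.lintegral_comp (f := F) ((hF1.comp measurable_fst).mul (hF2.comp measurable_snd)),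
      lintegral_prod_mul hF1.aemeasurable hF2.aemeasurable]
    refine (mul_le_mul' h1 h2).trans (le_of_eq ?_)
    have h3 : ν₀ Set.univ ^ Fintype.card M = ∏ i : {i // p i}, ν i Set.univ := by
      rw [← σ.prod_comp]
      simp [hσ]
    rw [h3, ← Fintype.prod_subtype_mul_prod_subtype p]
    ring

/-- The average over blocks of the products of the determinantal weights of the groups in a block. -/
noncomputable def blockWeight {d L B G : ℕ} (t : ℝ) {ι : Type*} (x : RSpace d) (r : ℝ)
    (e : Fin B × Fin G × MultiIndex d L → ι) (X : ι → RSpace d) : ℝ≥0∞ :=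
  (B : ℝ≥0∞)⁻¹ * ∑ b, ∏ c, detWeight t x r fun a => X (e (b, c, a))

theorem measurable_blockWeight {d L B G : ℕ} (t : ℝ) {ι : Type*} (x : RSpace d) (r : ℝ)
    (e : Fin B × Fin G × MultiIndex d L → ι) : Measurable (blockWeight t x r e) := by
  unfold blockWeight
  refine Measurable.const_mul (Finset.measurable_sum _ fun b _ => Finset.measurable_prod _
    fun c _ => (measurable_detWeight t x r).comp (by fun_prop)) _

/-- Groups within a block use disjoint coordinates, so the integral of their product factorises.
Across blocks there is only an average, so linearity suffices. -/
theorem lintegral_blockWeight_le {d L B G : ℕ} {t : ℝ} {P : Measure (RSpace d)} [IsFiniteMeasure P]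
    {x : RSpace d} {r : ℝ} {C : ℝ≥0∞}
    (hC : ∫⁻ z, detWeight (L := L) t x r z
      ∂(Measure.pi fun _ => P.restrict (Metric.closedBall x r)) ≤
        C * (P (Metric.closedBall x r)) ^ numMonomials d L)
    {ι : Type} [Fintype ι] (e : Fin B × Fin G × MultiIndex d L ↪ ι) (A : ι → Set (RSpace d))
    (hA : ∀ q, A (e q) = Metric.closedBall x r) :
    ∫⁻ X in Set.univ.pi A, blockWeight t x r e X ∂(Measure.pi fun _ => P) ≤
      C ^ G * ∏ i, P (A i) := by
  rw [Measure.restrict_pi_pi]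
  unfold blockWeight
  have hm : ∀ b, Measurable fun X : ι → RSpace d =>
      ∏ c, detWeight t x r fun a => X (e (b, c, a)) := fun b =>
    Finset.measurable_prod _ fun c _ => (measurable_detWeight t x r).comp (by fun_prop)
  rw [lintegral_const_mul _ (Finset.measurable_sum _ fun b _ => hm b),
    lintegral_finsetSum _ fun b _ => hm b]
  have hb : ∀ b : Fin B, ∫⁻ X, ∏ c, detWeight t x r (fun a => X (e (b, c, a)))
      ∂(Measure.pi fun i => P.restrict (A i)) ≤ C ^ G * ∏ i, P (A i) := by
    intro b
    let eb : Fin G × MultiIndex d L ↪ ι :=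
      ⟨fun q => e (b, q), fun q q' h => (Prod.ext_iff.1 (e.injective h)).2⟩
    have h1 := lintegral_prod_blocks_le (measurable_detWeight (L := L) t x r)
      (ν₀ := P.restrict (Metric.closedBall x r)) (C := C)
      (by simpa [numMonomials] using hC) G (fun i => P.restrict (A i))
      eb (fun q => by
        change P.restrict (A (e (b, q))) = _
        rw [hA])
    simp only [Measure.restrict_apply_univ] at h1
    exact h1
  calc (B : ℝ≥0∞)⁻¹ * ∑ b : Fin B, ∫⁻ X, ∏ c, detWeight t x r (fun a => X (e (b, c, a)))
      ∂(Measure.pi fun i => P.restrict (A i))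
      ≤ (B : ℝ≥0∞)⁻¹ * ∑ _b : Fin B, (C ^ G * ∏ i, P (A i)) := by
        gcongr with b _; exact hb b
    _ = ((B : ℝ≥0∞)⁻¹ * B) * (C ^ G * ∏ i, P (A i)) := by
        rw [sum_const, card_univ, Fintype.card_fin, nsmul_eq_mul, mul_assoc]
    _ ≤ 1 * (C ^ G * ∏ i, P (A i)) := by
        gcongr
        exact ENNReal.inv_mul_le_one _
    _ = _ := one_mul _

/-! ### The weights of the local polynomial estimator -/

/-- The weight of the `i`-th response in the local polynomial estimate at `x`. -/
noncomputable def localWeight {d n : ℕ} (L k : ℕ) (X : Fin n → RSpace d) (x : RSpace d)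
    (i : Fin n) : ℝ :=
  if i ∈ knnIndices k X x then
    ∑ b, (localGram L k X x)⁻¹ (zeroIndex d L) b * localMonomial x (X i) b else 0

section weights

variable {d n L k : ℕ} {X : Fin n → RSpace d} {x : RSpace d}

theorem localPolyEstimate_eq_sum (Z : Fin n → ℝ) :
    localPolyEstimate L k X Z x = ∑ i, localWeight L k X x i * Z i := by
  classical
  simp only [localPolyEstimate, localCoeffs, Matrix.mulVec, dotProduct, localWeight, ite_mul,
    zero_mul, Finset.sum_ite_mem, univ_inter, Finset.mul_sum, Finset.sum_mul]
  rw [Finset.sum_comm]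
  exact Finset.sum_congr rfl fun i _ => Finset.sum_congr rfl fun b _ => by ring

/-- This is the zero row of `M⁻¹ M = 1`: the weights applied to a polynomial of degree at most `L`
return its value at `x`. -/
theorem sum_localWeight_mul_localMonomial (hM : IsUnit (localGram L k X x).det)
    (a : MultiIndex d L) :
    ∑ i, localWeight L k X x i * localMonomial x (X i) a = if zeroIndex d L = a then 1 else 0 := by
  classical
  have h := congrFun (congrFun (Matrix.nonsing_inv_mul _ hM) (zeroIndex d L)) a
  rw [Matrix.one_apply] at h
  rw [← h, Matrix.mul_apply]
  simp only [localWeight, ite_mul, zero_mul, Finset.sum_ite_mem, univ_inter, Finset.sum_mul]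
  rw [Finset.sum_comm]
  refine Finset.sum_congr rfl fun b _ => ?_
  simp only [localGram, Matrix.of_apply, Finset.mul_sum]
  exact Finset.sum_congr rfl fun i _ => by ring

/-- Expand one of the two factors of `w_i²` in the monomials at `X_i`; by reproduction only the
constant monomial survives. -/
theorem sum_sq_localWeight (hM : IsUnit (localGram L k X x).det) :
    ∑ i, localWeight L k X x i ^ 2 = (localGram L k X x)⁻¹ (zeroIndex d L) (zeroIndex d L) := by
  classical
  have h1 : ∀ i, localWeight L k X x i ^ 2 = ∑ b, (localGram L k X x)⁻¹ (zeroIndex d L) b *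
      (localWeight L k X x i * localMonomial x (X i) b) := by
    intro i
    by_cases hi : i ∈ knnIndices k X x
    · rw [sq]
      nth_rewrite 2 [localWeight]
      rw [if_pos hi, Finset.mul_sum]
      exact Finset.sum_congr rfl fun b _ => by ring
    · simp [localWeight, hi]
  simp only [h1]
  rw [Finset.sum_comm]
  simp only [← Finset.mul_sum, sum_localWeight_mul_localMonomial hM]
  simp

theorem localMonomial_eq_scaled {r : ℝ} (hr : r ≠ 0) (z : RSpace d) (a : MultiIndex d L) :
    localMonomial x z a = (∏ i, ((z i - x i) / r) ^ (a.1 i : ℕ)) * r ^ a.degree := by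
  rw [localMonomial, MultiIndex.degree, ← Finset.prod_pow_eq_pow_sum, ← Finset.prod_mul_distrib]
  refine Finset.prod_congr rfl fun i _ => ?_
  rw [← mul_pow, div_mul_cancel₀ _ hr]

theorem scaledVandermonde_mulVec {r : ℝ} (hr : r ≠ 0) (z : MultiIndex d L → RSpace d)
    (u : MultiIndex d L → ℝ) :
    (scaledVandermonde x r z) *ᵥ (fun b => u b * r ^ b.degree) =
      fun a => ∑ b, u b * localMonomial x (z a) b := by
  funext a
  simp only [Matrix.mulVec, dotProduct, scaledVandermonde, Matrix.of_apply]
  refine Finset.sum_congr rfl fun b _ => ?_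
  rw [localMonomial_eq_scaled hr]; ring

theorem abs_scaledVandermonde_le_one {r : ℝ} (hr : 0 < r) {z : MultiIndex d L → RSpace d}
    (hz : ∀ a, ‖z a - x‖ ≤ r) (a b : MultiIndex d L) : |scaledVandermonde x r z a b| ≤ 1 := by
  simp only [scaledVandermonde, Matrix.of_apply, Finset.abs_prod, abs_pow]
  refine Finset.prod_le_one (fun i _ => by positivity) fun i _ => pow_le_one₀ (abs_nonneg _) ?_
  rw [abs_div, abs_of_pos hr, div_le_one hr]
  have := PiLp.norm_apply_le (z a - x) i
  rw [PiLp.sub_apply, Real.norm_eq_abs] at this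
  exact this.trans (hz a)

/-- Every Leibniz term has exactly one factor from the new column and all others at most one in
absolute value. -/
theorem abs_det_updateCol_le {ι : Type*} [Fintype ι] [DecidableEq ι] {A : Matrix ι ι ℝ}
    (hA : ∀ a b, |A a b| ≤ 1) (o : ι) (y : ι → ℝ) :
    |(A.updateCol o y).det| ≤ (Fintype.card ι).factorial * √(∑ a, y a ^ 2) := by
  have hy : ∀ a, |y a| ≤ √(∑ a, y a ^ 2) := fun a => Real.abs_le_sqrt
    (Finset.single_le_sum (f := fun a => y a ^ 2) (fun _ _ => sq_nonneg _) (mem_univ a))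
  rw [Matrix.det_apply]
  refine (Finset.abs_sum_le_sum_abs _ _).trans ?_
  rw [← Fintype.card_perm, ← nsmul_eq_mul, ← card_univ]
  refine Finset.sum_le_card_nsmul _ _ _ fun σ _ => ?_
  rw [Units.smul_def, zsmul_eq_mul, abs_mul, ← Int.cast_abs, Int.isUnit_iff_abs_eq.1 σ.sign.isUnit,
    Int.cast_one, one_mul, Finset.abs_prod, ← Finset.mul_prod_erase _ _ (mem_univ o)]
  rw [Matrix.updateCol_self]
  refine (mul_le_of_le_one_right (abs_nonneg _) ?_).trans (hy _)
  refine Finset.prod_le_one (fun _ _ => abs_nonneg _) fun a ha => ?_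
  rw [Matrix.updateCol_ne (Finset.ne_of_mem_erase ha)]
  exact hA _ _

/-- A group of nearest neighbours with nonsingular Vandermonde matrix controls the total squared
weight by the squared weights of the group. -/
theorem det_sq_mul_sum_sq_localWeight_le (hM : IsUnit (localGram L k X x).det) {r : ℝ} (hr : 0 < r)
    {z : MultiIndex d L → Fin n} (hz : ∀ a, z a ∈ knnIndices k X x)
    (hzr : ∀ a, ‖X (z a) - x‖ ≤ r) :
    (scaledVandermonde x r fun a => X (z a)).det ^ 2 * (∑ i, localWeight L k X x i ^ 2) ^ 2 ≤
      ((numMonomials d L).factorial : ℝ) ^ 2 * ∑ a, localWeight L k X x (z a) ^ 2 := by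
  set A := scaledVandermonde x r fun a => X (z a) with hA
  set u : MultiIndex d L → ℝ := fun b => (localGram L k X x)⁻¹ (zeroIndex d L) b with hu
  have h1 : A *ᵥ (fun b => u b * r ^ b.degree) = fun a => localWeight L k X x (z a) := by
    rw [hA, scaledVandermonde_mulVec hr.ne']
    funext a
    rw [localWeight, if_pos (hz a)]
  -- Cramer's rule for the zero coordinate: the scaled vector `u` solves the system whose right-hand
  -- side is the weights of the group, and `u` at zero is the total squared weight, unaffected by
  -- the scaling `r ^ 0`.
  have h2 := congrFun (Matrix.cramer_eq_adjugate_mulVec A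
    (A *ᵥ (fun b => u b * r ^ b.degree))) (zeroIndex d L)
  rw [Matrix.mulVec_mulVec, Matrix.adjugate_mul, Matrix.smul_mulVec, Matrix.one_mulVec,
    Pi.smul_apply, smul_eq_mul, Matrix.cramer_apply, h1] at h2
  have h3 : (zeroIndex d L).degree = 0 := by simp [MultiIndex.degree, zeroIndex]
  rw [h3, pow_zero, mul_one, hu] at h2
  rw [sum_sq_localWeight hM, ← mul_pow, ← h2, ← sq_abs]
  calc _ ≤ (((numMonomials d L).factorial : ℝ) * √(∑ a, localWeight L k X x (z a) ^ 2)) ^ 2 := by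
        gcongr
        exact abs_det_updateCol_le (abs_scaledVandermonde_le_one hr hzr) _ _
    _ = _ := by rw [mul_pow, Real.sq_sqrt (Finset.sum_nonneg fun _ _ => sq_nonneg _)]

/-- For `u` in the kernel of `M`, the quadratic form at `u` is the sum of squares of a polynomial
over the neighbours. This polynomial vanishes at all of them, so the rescaled `u` is in the kernel
of the matrix of any group. -/
theorem det_scaledVandermonde_eq_zero (hM : ¬ IsUnit (localGram L k X x).det) {r : ℝ} (hr : 0 < r)
    {z : MultiIndex d L → Fin n} (hz : ∀ a, z a ∈ knnIndices k X x) :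
    (scaledVandermonde x r fun a => X (z a)).det = 0 := by
  have hM0 : (localGram L k X x).det = 0 := by simpa [isUnit_iff_ne_zero] using hM
  obtain ⟨u, hu0, hu⟩ := Matrix.exists_mulVec_eq_zero_iff.2 hM0
  have h1 : ∑ i ∈ knnIndices k X x, (∑ b, u b * localMonomial x (X i) b) ^ 2 = 0 := by
    have h2 : u ⬝ᵥ (localGram L k X x *ᵥ u) = 0 := by rw [hu, dotProduct_zero]
    rw [← h2]
    simp only [dotProduct, Matrix.mulVec, localGram, Matrix.of_apply, Finset.mul_sum,
      Finset.sum_mul, sq]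
    rw [Finset.sum_comm]
    refine Finset.sum_congr rfl fun b _ => ?_
    rw [Finset.sum_comm]
    exact Finset.sum_congr rfl fun c _ => Finset.sum_congr rfl fun i _ => by ring
  have h3 : ∀ i ∈ knnIndices k X x, ∑ b, u b * localMonomial x (X i) b = 0 := fun i hi =>
    pow_eq_zero_iff two_ne_zero |>.1
      ((Finset.sum_eq_zero_iff_of_nonneg fun i _ => sq_nonneg _).1 h1 i hi)
  refine Matrix.exists_mulVec_eq_zero_iff.1 ⟨fun b => u b * r ^ b.degree, ?_, ?_⟩
  · intro h
    refine hu0 (funext fun b => ?_)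
    have := congrFun h b
    simpa [hr.ne'] using this
  · rw [scaledVandermonde_mulVec hr.ne']
    exact funext fun a => h3 _ (hz a)

end weights

/-! ### Averaging the determinants over disjoint groups of neighbours. -/

section blocks

variable {d n L k B G : ℕ} {X : Fin n → RSpace d} {x : RSpace d} {r : ℝ}

theorem blockWeight_eq_top_of_det_eq_zero (hG : 0 < G) {e : Fin B × Fin G × MultiIndex d L → Fin n}
    (b : Fin B) (h : ∃ c, (scaledVandermonde x r fun a => X (e (b, c, a))).det = 0) :
    blockWeight (2 / G) x r e X = ⊤ := by
  have ht : (-(2 / (G : ℝ))) < 0 := by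
    have : (0 : ℝ) < G := by exact_mod_cast hG
    have := div_pos two_pos this
    linarith
  obtain ⟨c, hc⟩ := h
  have h1 : ∏ c, detWeight (2 / G) x r (fun a => X (e (b, c, a))) = ⊤ := by
    rw [← Finset.mul_prod_erase _ _ (mem_univ c)]
    have h2 : detWeight (2 / G) x r (fun a => X (e (b, c, a))) = ⊤ := by
      rw [detWeight, hc, abs_zero, ENNReal.ofReal_zero, ENNReal.zero_rpow_of_neg ht]
    rw [h2]
    refine ENNReal.top_mul (Finset.prod_ne_zero_iff.2 fun c _ => ?_)
    rw [detWeight, ne_eq, ENNReal.rpow_eq_zero_iff]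
    rintro (⟨_, h⟩ | ⟨h, _⟩)
    · linarith
    · exact ENNReal.ofReal_ne_top h
  rw [blockWeight, ← Finset.add_sum_erase _ _ (mem_univ b), h1, top_add]
  exact ENNReal.mul_top (ENNReal.inv_ne_zero.2 (ENNReal.natCast_ne_top _))

/-- An infinite weight at singular designs lets the later bounds hold at every sample, including
where the estimate is zero by convention. -/
theorem blockWeight_eq_top (hB : 0 < B) (hG : 0 < G) (hM : ¬ IsUnit (localGram L k X x).det)
    (hr : 0 < r) {e : Fin B × Fin G × MultiIndex d L → Fin n}
    (he : ∀ q, e q ∈ knnIndices k X x) : blockWeight (2 / G) x r e X = ⊤ :=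
  blockWeight_eq_top_of_det_eq_zero hG ⟨0, hB⟩
    ⟨⟨0, hG⟩, det_scaledVandermonde_eq_zero hM hr fun _ => he _⟩

/-- The groups are disjoint, so their squared weights sum to at most `v`. Adding the bounds of the
groups gives `(∑ det²) v² ≤ (K*!)² v`, and one power of `v` cancels. -/
theorem sum_det_sq_mul_sum_sq_localWeight_le (hM : IsUnit (localGram L k X x).det) (hr : 0 < r)
    (e : Fin B × Fin G × MultiIndex d L ↪ Fin n) (he : ∀ q, e q ∈ knnIndices k X x)
    (her : ∀ q, ‖X (e q) - x‖ ≤ r) :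
    (∑ b, ∑ c, (scaledVandermonde x r fun a => X (e (b, c, a))).det ^ 2) *
      ∑ i, localWeight L k X x i ^ 2 ≤ ((numMonomials d L).factorial : ℝ) ^ 2 := by
  set v := ∑ i, localWeight L k X x i ^ 2 with hv
  have hv0 : 0 ≤ v := Finset.sum_nonneg fun _ _ => sq_nonneg _
  rcases hv0.eq_or_lt with h0 | h0
  · rw [← h0, mul_zero]; positivity
  have h1 : ∑ q, localWeight L k X x (e q) ^ 2 ≤ v := by
    rw [← Finset.sum_map univ e fun i => localWeight L k X x i ^ 2]
    exact Finset.sum_le_sum_of_subset_of_nonneg (subset_univ _) fun _ _ _ => sq_nonneg _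
  have h2 : (∑ b, ∑ c, (scaledVandermonde x r fun a => X (e (b, c, a))).det ^ 2) * v ^ 2 ≤
      ((numMonomials d L).factorial : ℝ) ^ 2 * v := by
    rw [Finset.sum_mul]
    refine le_trans ?_ (mul_le_mul_of_nonneg_left h1 (by positivity))
    rw [Fintype.sum_prod_type, Finset.mul_sum]
    refine Finset.sum_le_sum fun b _ => ?_
    rw [Finset.sum_mul, Fintype.sum_prod_type, Finset.mul_sum]
    exact Finset.sum_le_sum fun c _ =>
      det_sq_mul_sum_sq_localWeight_le hM hr (fun _ => he _) fun _ => her _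
  rw [sq v, ← mul_assoc] at h2
  exact le_of_mul_le_mul_right h2 h0

/-- The arithmetic-geometric inequality, without its factor `G`. It turns a sum into a product, to
which independence applies, and leaves each determinant with only the exponent `2/G`. -/
theorem prod_rpow_le_sum_sq (hG : 0 < G) (y : Fin G → ℝ) :
    ∏ c, |y c| ^ (2 / (G : ℝ)) ≤ ∑ c, y c ^ 2 := by
  have hG' : (0 : ℝ) < G := by exact_mod_cast hG
  have h := Real.geom_mean_le_arith_mean_weighted univ (fun _ : Fin G => (1 / (G : ℝ)))
    (fun c => y c ^ 2) (fun _ _ => by positivity) (by simp [hG'.ne']) fun _ _ => sq_nonneg _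
  have h1 : ∀ c, (y c ^ 2) ^ (1 / (G : ℝ)) = |y c| ^ (2 / (G : ℝ)) := by
    intro c
    rw [← sq_abs, ← Real.rpow_natCast, ← Real.rpow_mul (abs_nonneg _)]
    congr 1; push_cast; ring
  simp only [h1] at h
  refine h.trans (Finset.sum_le_sum fun c _ => mul_le_of_le_one_left (sq_nonneg _) ?_)
  rw [div_le_one hG']
  exact_mod_cast hG

/-- The total squared weight is bounded by the block average of the determinantal weights. -/
theorem ofReal_sum_sq_localWeight_le (hB : 0 < B) (hG : 0 < G) (hr : 0 < r)
    (e : Fin B × Fin G × MultiIndex d L ↪ Fin n) (he : ∀ q, e q ∈ knnIndices k X x)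
    (her : ∀ q, ‖X (e q) - x‖ ≤ r) :
    ENNReal.ofReal (B * ∑ i, localWeight L k X x i ^ 2) ≤
      ENNReal.ofReal (((numMonomials d L).factorial : ℝ) ^ 2) * blockWeight (2 / G) x r e X := by
  have hB' : (0 : ℝ) < B := by exact_mod_cast hB
  have hK : ENNReal.ofReal (((numMonomials d L).factorial : ℝ) ^ 2) ≠ 0 := by
    rw [ne_eq, ENNReal.ofReal_eq_zero, not_le]
    have := Nat.factorial_pos (numMonomials d L)
    positivity
  by_cases hM : IsUnit (localGram L k X x).det
  swap
  · rw [blockWeight_eq_top hB hG hM hr he, ENNReal.mul_top hK]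
    exact le_top
  set y : Fin B → Fin G → ℝ := fun b c => (scaledVandermonde x r fun a => X (e (b, c, a))).det
    with hy
  by_cases h0 : ∃ b c, y b c = 0
  · obtain ⟨b, hc⟩ := h0
    rw [blockWeight_eq_top_of_det_eq_zero hG b hc, ENNReal.mul_top hK]
    exact le_top
  push Not at h0
  set v := ∑ i, localWeight L k X x i ^ 2 with hv
  have hv0 : 0 ≤ v := Finset.sum_nonneg fun _ _ => sq_nonneg _
  have hmain := sum_det_sq_mul_sum_sq_localWeight_le hM hr e he her
  set π : Fin B → ℝ := fun b => ∏ c, |y b c| ^ (2 / (G : ℝ)) with hπ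
  have hπ0 : ∀ b, 0 < π b := fun b => Finset.prod_pos fun c _ =>
    Real.rpow_pos_of_pos (abs_pos.2 (h0 b c)) _
  have h1 : (∑ b, π b) * v ≤ ((numMonomials d L).factorial : ℝ) ^ 2 := by
    refine le_trans ?_ hmain
    gcongr with b _
    exact prod_rpow_le_sum_sq hG _
  -- Cauchy-Schwarz between the `π b` and their inverses. The two powers of `B` gained here leave a
  -- factor `B` beside `v` after averaging, which pays for the number of neighbours in the bias.
  have h2 : (B : ℝ) ^ 2 ≤ (∑ b, π b) * ∑ b, (π b)⁻¹ := by
    have := Finset.sum_sq_le_sum_mul_sum_of_sq_le_mul univ (r := fun _ : Fin B => (1 : ℝ))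
      (f := π) (g := fun b => (π b)⁻¹) (fun b _ => (hπ0 b).le) (fun b _ => (inv_pos.2 (hπ0 b)).le)
      (fun b _ => by rw [mul_inv_cancel₀ (hπ0 b).ne', one_pow])
    simpa using this
  have hS0 : 0 ≤ ∑ b, (π b)⁻¹ := Finset.sum_nonneg fun b _ => (inv_pos.2 (hπ0 b)).le
  have h3 : B * v ≤ ((numMonomials d L).factorial : ℝ) ^ 2 * ((B : ℝ)⁻¹ * ∑ b, (π b)⁻¹) := by
    calc B * v = (B : ℝ)⁻¹ * ((B : ℝ) ^ 2 * v) := by field_simp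
      _ ≤ (B : ℝ)⁻¹ * (((∑ b, π b) * ∑ b, (π b)⁻¹) * v) := by gcongr
      _ = ((∑ b, π b) * v) * ((B : ℝ)⁻¹ * ∑ b, (π b)⁻¹) := by ring
      _ ≤ _ := by gcongr
  have h4 : blockWeight (2 / G) x r e X = ENNReal.ofReal ((B : ℝ)⁻¹ * ∑ b, (π b)⁻¹) := by
    rw [blockWeight, ENNReal.ofReal_mul (by positivity), ENNReal.ofReal_inv_of_pos hB',
      ENNReal.ofReal_natCast, ENNReal.ofReal_sum_of_nonneg fun b _ => (inv_pos.2 (hπ0 b)).le]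
    congr 1
    refine Finset.sum_congr rfl fun b _ => ?_
    rw [hπ]
    simp only
    rw [← Finset.prod_inv_distrib, ENNReal.ofReal_prod_of_nonneg fun c _ => by positivity]
    refine Finset.prod_congr rfl fun c _ => ?_
    rw [detWeight, ENNReal.ofReal_rpow_of_pos (abs_pos.2 (h0 b c)), Real.rpow_neg (abs_nonneg _)]
  rw [h4, ← ENNReal.ofReal_mul (by positivity)]
  exact ENNReal.ofReal_le_ofReal h3

end blocks

/-! ### Local Taylor approximation -/

/-- By induction: the derivative of a Taylor remainder is the remainder of the shifted chain, and
the mean value inequality on `[0,1]` keeps the same bound. Only the oscillation of the last function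
enters, as suits a Hölder hypothesis. -/
theorem abs_sub_taylor_chain_le {l : ℕ} {B : ℝ} : ∀ {f : ℕ → ℝ → ℝ},
    (∀ j < l, ∀ t ∈ Set.Icc (0 : ℝ) 1, HasDerivAt (f j) (f (j + 1) t) t) →
    (∀ t ∈ Set.Icc (0 : ℝ) 1, |f l t - f l 0| ≤ B) → ∀ t ∈ Set.Icc (0 : ℝ) 1,
    |f 0 t - ∑ j ∈ range (l + 1), (j.factorial : ℝ)⁻¹ * f j 0 * t ^ j| ≤ B := by
  induction l with
  | zero => intro f _ h t ht; simpa using h t ht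
  | succ l ih =>
    intro f hd h t ht
    have h1 := ih (f := fun j => f (j + 1)) (fun j hj => hd (j + 1) (by omega)) h
    set R : ℝ → ℝ := fun t => f 0 t - ∑ j ∈ range (l + 1 + 1), (j.factorial : ℝ)⁻¹ * f j 0 * t ^ j
      with hR
    have hderiv : ∀ t ∈ Set.Icc (0 : ℝ) 1, HasDerivWithinAt R
        (f 1 t - ∑ j ∈ range (l + 1), (j.factorial : ℝ)⁻¹ * f (j + 1) 0 * t ^ j)
        (Set.Icc 0 1) t := by
      intro t ht
      refine ((hd 0 (by omega) t ht).sub ?_).hasDerivWithinAt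
      have h2 : ∀ j ∈ range (l + 1 + 1), HasDerivAt
          (fun t : ℝ => (j.factorial : ℝ)⁻¹ * f j 0 * t ^ j)
          ((j.factorial : ℝ)⁻¹ * f j 0 * (j * t ^ (j - 1))) t := fun j _ =>
        (hasDerivAt_pow j t).const_mul _
      have h3 := HasDerivAt.fun_sum h2
      rw [Finset.sum_range_succ'] at h3
      refine h3.congr_deriv ?_
      simp only [Nat.cast_zero, zero_mul, mul_zero, add_zero, Nat.add_sub_cancel]
      refine Finset.sum_congr rfl fun j _ => ?_
      rw [Nat.factorial_succ]
      push_cast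
      have h4 : ((j : ℝ) + 1) ≠ 0 := by positivity
      have h5 : (j.factorial : ℝ) ≠ 0 := by positivity
      field_simp
    have hB : 0 ≤ B := (abs_nonneg _).trans (h t ht)
    have hmv := Convex.norm_image_sub_le_of_norm_hasDerivWithin_le hderiv
      (fun t ht => (Real.norm_eq_abs _).trans_le (h1 t ht)) (convex_Icc 0 1)
      (Set.left_mem_Icc.2 zero_le_one) ht
    have hR0 : R 0 = 0 := by
      rw [hR]
      simp only
      rw [Finset.sum_range_succ']
      simp
    rw [hR0, sub_zero, sub_zero, Real.norm_eq_abs, Real.norm_eq_abs] at hmv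
    refine hmv.trans (mul_le_of_le_one_right hB ?_)
    rw [abs_of_nonneg ht.1]
    exact ht.2

section taylor

variable {d l : ℕ}

theorem ContinuousMultilinearMap.apply_const_eq_sum {j : ℕ}
    (A : ContinuousMultilinearMap ℝ (fun _ : Fin j => RSpace d) ℝ) (v : RSpace d) :
    A (fun _ => v) = ∑ s : Fin j → Fin d,
      (∏ a, v (s a)) * A fun a => EuclideanSpace.single (s a) 1 := by
  have hv : v = ∑ i, v i • EuclideanSpace.single i (1 : ℝ) := by
    have := (EuclideanSpace.basisFun (Fin d) ℝ).sum_repr v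
    simpa using this.symm
  have h1 : A (fun _ => v) = A fun _ => ∑ i, v i • EuclideanSpace.single i (1 : ℝ) := by
    rw [← hv]
  rw [h1, ContinuousMultilinearMap.map_sum]
  refine Finset.sum_congr rfl fun s _ => ?_
  rw [ContinuousMultilinearMap.map_smul_univ, smul_eq_mul]

theorem prod_apply_eq_prod_pow {j : ℕ} (s : Fin j → Fin d) (v : Fin d → ℝ) :
    ∏ a, v (s a) = ∏ i, v i ^ #{a | s a = i} := by
  rw [← Finset.prod_fiberwise' univ s v]
  simp

/-- The Taylor polynomial of degree `l` at `x` is a combination of local monomials whose constant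
coefficient is the value at `x`. -/
theorem exists_coeff_taylor (D : ∀ j : ℕ, ContinuousMultilinearMap ℝ (fun _ : Fin j => RSpace d) ℝ)
    (x : RSpace d) : ∃ c : MultiIndex d l → ℝ, c (zeroIndex d l) = D 0 0 ∧
      ∀ z, ∑ j ∈ range (l + 1), (j.factorial : ℝ)⁻¹ * D j (fun _ => z - x) =
        ∑ a, c a * localMonomial x z a := by
  classical
  -- A tuple of directions contributes to the monomial whose exponents count how often each
  -- direction occurs.
  let P : ∀ j : ℕ, (Fin j → Fin d) → MultiIndex d l → Prop := fun j s a =>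
    ∀ i, (a.1 i : ℕ) = #{b | s b = i}
  refine ⟨fun a => ∑ j ∈ range (l + 1), (j.factorial : ℝ)⁻¹ * ∑ s : Fin j → Fin d,
    if P j s a then D j (fun b => EuclideanSpace.single (s b) 1) else 0, ?_, fun z => ?_⟩
  · simp only
    rw [Finset.sum_range_succ', Finset.sum_eq_zero, zero_add]
    · have h0 : ∀ s : Fin 0 → Fin d, P 0 s (zeroIndex d l) := fun s i => by simp [zeroIndex]
      simp only [h0, if_true, Nat.factorial_zero, Nat.cast_one, inv_one, one_mul]
      simp only [univ_unique, sum_singleton]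
      congr 1
      exact Subsingleton.elim _ _
    · intro j _
      rw [Finset.sum_eq_zero, mul_zero]
      intro s _
      rw [if_neg]
      intro h
      have h1 := h (s 0)
      have h2 : 0 < #{b | s b = s 0} := Finset.card_pos.2 ⟨0, by simp⟩
      simp only [zeroIndex, Fin.coe_ofNat_eq_mod, Nat.zero_mod] at h1
      omega
  · simp only [Finset.sum_mul, Finset.mul_sum]
    rw [Finset.sum_comm]
    refine Finset.sum_congr rfl fun j hj => ?_
    rw [Finset.sum_comm, ContinuousMultilinearMap.apply_const_eq_sum, Finset.mul_sum]
    refine Finset.sum_congr rfl fun s _ => ?_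
    have hsum : ∑ i, #{b | s b = i} = j := by
      have := Finset.card_eq_sum_card_fiberwise (f := s) (s := univ) (t := univ)
        (fun _ _ => mem_coe.2 (mem_univ _))
      simpa using this.symm
    have hle : ∀ i, #{b | s b = i} ≤ l := fun i => by
      have h1 := Finset.single_le_sum (f := fun i => #{b | s b = i}) (fun _ _ => Nat.zero_le _)
        (mem_univ i)
      have h2 := mem_range.1 hj
      omega
    let a₀ : MultiIndex d l := ⟨fun i => ⟨#{b | s b = i}, Nat.lt_succ_of_le (hle i)⟩, by
      have h2 := mem_range.1 hj
      simp only [hsum]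
      omega⟩
    rw [Finset.sum_eq_single a₀]
    · have hP : P j s a₀ := fun i => rfl
      rw [if_pos hP, prod_apply_eq_prod_pow s (fun i => (z - x) i), localMonomial]
      simp only [PiLp.sub_apply, a₀]
      ring
    · intro a _ ha
      rw [if_neg, mul_zero, zero_mul]
      intro h
      exact ha (Subtype.ext (funext fun i => Fin.ext (h i)))
    · intro h; exact absurd (mem_univ _) h

/-- Apply the one-variable Taylor bound on the segment from `x` to `z`, which lies in the convex
hull. Expanding the derivative of order `l` in coordinates gives `d ^ l` terms, each controlled by
the Hölder hypothesis. -/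
theorem exists_localPolynomial_approx {S U : Set (RSpace d)} {β Λ : ℝ} {g : RSpace d → ℝ}
    (hU : IsOpen U) (hUc : Convex ℝ U) (hSU : S ⊆ U) (hg : ContDiffOn ℝ l g U) (hβ : 0 < β)
    (hΛ : 0 ≤ Λ) (hH : PartialsHolderOn l β Λ g (convexHull ℝ S)) {x : RSpace d} (hx : x ∈ S) :
    ∃ c : MultiIndex d l → ℝ, c (zeroIndex d l) = g x ∧ ∀ z ∈ S,
      |g z - ∑ a, c a * localMonomial x z a| ≤ (d : ℝ) ^ l * Λ * ‖z - x‖ ^ ((l : ℝ) + β) := by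
  obtain ⟨c, hc0, hc⟩ := exists_coeff_taylor (l := l) (fun j => iteratedFDeriv ℝ j g x) x
  refine ⟨c, by simpa using hc0, fun z hz => ?_⟩
  set v := z - x with hv
  have hseg : ∀ t ∈ Set.Icc (0 : ℝ) 1, x + t • v ∈ convexHull ℝ S := fun t ht =>
    (convex_convexHull ℝ S).add_smul_sub_mem (subset_convexHull ℝ S hx)
      (subset_convexHull ℝ S hz) ht
  have hsegU : ∀ t ∈ Set.Icc (0 : ℝ) 1, x + t • v ∈ U := fun t ht =>
    convexHull_min hSU hUc (hseg t ht)
  have hchain := abs_sub_taylor_chain_le (l := l) (B := (d : ℝ) ^ l * Λ * ‖v‖ ^ ((l : ℝ) + β))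
    (f := fun j t => iteratedFDeriv ℝ j g (x + t • v) fun _ => v) ?_ ?_ 1
    (Set.right_mem_Icc.2 zero_le_one)
  · have h1 := hc z
    simp only [one_smul, iteratedFDeriv_zero_apply, one_pow, mul_one, zero_smul, add_zero,
      ← hv] at hchain h1
    rw [h1] at hchain
    simpa [hv] using hchain
  · intro j hj t ht
    have hcd : ContDiffAt ℝ ((j : ℕ∞) + 1 : ℕ∞) g (x + t • v) :=
      (hg.contDiffAt (hU.mem_nhds (hsegU t ht))).of_le (by exact_mod_cast hj)
    have hcd' : ContDiffAt ℝ (j + 1) g (x + t • v) := by exact_mod_cast hcd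
    rw [← hcd'.deriv_fderiv_add_smul]
    have h_diff : DifferentiableAt ℝ (iteratedFDeriv ℝ j g) (x + t • v) :=
      hcd'.differentiableAt_iteratedFDeriv (by norm_cast; exact lt_add_one j)
    exact DifferentiableAt.hasDerivAt (by fun_prop)
  · intro t ht
    simp only [zero_smul, add_zero]
    rw [ContinuousMultilinearMap.apply_const_eq_sum, ContinuousMultilinearMap.apply_const_eq_sum,
      ← Finset.sum_sub_distrib]
    refine (Finset.abs_sum_le_sum_abs _ _).trans ?_
    have hbound : ∀ s : Fin l → Fin d,
        |(∏ a, v (s a)) * iteratedFDeriv ℝ l g (x + t • v) (fun a => EuclideanSpace.single (s a) 1) -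
          (∏ a, v (s a)) * iteratedFDeriv ℝ l g x (fun a => EuclideanSpace.single (s a) 1)| ≤
        Λ * ‖v‖ ^ ((l : ℝ) + β) := by
      intro s
      rw [← mul_sub, abs_mul, Finset.abs_prod]
      have h1 : ∏ a, |v (s a)| ≤ ‖v‖ ^ l := by
        calc ∏ a, |v (s a)| ≤ ∏ _a : Fin l, ‖v‖ :=
              Finset.prod_le_prod (fun _ _ => abs_nonneg _) fun a _ => PiLp.norm_apply_le v (s a)
          _ = ‖v‖ ^ l := by simp
      have h2 := hH s (x + t • v) (hseg t ht) x (subset_convexHull ℝ S hx)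
      have h3 : ‖x + t • v - x‖ ^ β ≤ ‖v‖ ^ β := by
        refine Real.rpow_le_rpow (norm_nonneg _) ?_ hβ.le
        rw [add_sub_cancel_left, norm_smul, Real.norm_eq_abs, abs_of_nonneg ht.1]
        exact mul_le_of_le_one_left (norm_nonneg _) ht.2
      calc _ ≤ ‖v‖ ^ l * (Λ * ‖v‖ ^ β) := by
            refine mul_le_mul h1 (h2.trans (by gcongr)) (abs_nonneg _) (by positivity)
        _ = Λ * ‖v‖ ^ ((l : ℝ) + β) := by
            rw [Real.rpow_add_of_nonneg (norm_nonneg _) (by positivity) hβ.le, Real.rpow_natCast]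
            ring
    refine (Finset.sum_le_sum fun s _ => hbound s).trans (le_of_eq ?_)
    simp
    ring

end taylor

/-! ### The nearest-neighbour radius -/

section knn

variable {d n k : ℕ} {X : Fin n → RSpace d} {x : RSpace d}

theorem exists_isLeast_knn (hk : 1 ≤ k) (hkn : k ≤ n) (X : Fin n → RSpace d) (x : RSpace d) :
    ∃ j, IsLeast {r : ℝ | k ≤ #{i : Fin n | ‖X i - x‖ ≤ r}} ‖X j - x‖ := by
  classical
  set T : Finset (Fin n) := {j | k ≤ #{i : Fin n | ‖X i - x‖ ≤ ‖X j - x‖}} with hT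
  have hmax : ∀ r : ℝ, k ≤ #{i : Fin n | ‖X i - x‖ ≤ r} → ∃ j ∈ T, ‖X j - x‖ ≤ r := by
    intro r hr
    obtain ⟨j, hj, hjmax⟩ := Finset.exists_max_image ({i : Fin n | ‖X i - x‖ ≤ r} : Finset (Fin n))
      (fun i => ‖X i - x‖) (Finset.card_pos.1 (by omega))
    refine ⟨j, mem_filter.2 ⟨mem_univ _, hr.trans (Finset.card_le_card fun i hi => ?_)⟩,
      (mem_filter.1 hj).2⟩
    exact mem_filter.2 ⟨mem_univ _, hjmax i hi⟩
  have hTne : T.Nonempty := by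
    obtain ⟨j, hj, -⟩ := hmax (∑ i, ‖X i - x‖) (by
      rw [Finset.filter_true_of_mem fun i _ => Finset.single_le_sum
        (f := fun i => ‖X i - x‖) (fun _ _ => norm_nonneg _) (mem_univ i)]
      simpa using hkn)
    exact ⟨j, hj⟩
  obtain ⟨j, hj, hjmin⟩ := Finset.exists_min_image T (fun i => ‖X i - x‖) hTne
  refine ⟨j, (mem_filter.1 hj).2, fun r hr => ?_⟩
  obtain ⟨i, hi, hir⟩ := hmax r hr
  exact (hjmin i hi).trans hir

theorem le_card_knnIndices (hk : 1 ≤ k) (hkn : k ≤ n) : k ≤ #(knnIndices k X x) := by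
  obtain ⟨j, hj⟩ := exists_isLeast_knn hk hkn X x
  rw [knnIndices, knnRadius, hj.csInf_eq]
  exact hj.1

/-- Rational radii suffice, so the sublevel sets of the radius are countable unions of measurable
sets. -/
theorem knnRadius_lt_iff (hk : 1 ≤ k) (hkn : k ≤ n) {t : ℝ} :
    knnRadius k X x < t ↔ ∃ q : ℚ, (q : ℝ) < t ∧ k ≤ #{i : Fin n | ‖X i - x‖ ≤ q} := by
  obtain ⟨j, hj⟩ := exists_isLeast_knn hk hkn X x
  rw [knnRadius, hj.csInf_eq]
  constructor
  · intro h
    obtain ⟨q, hq1, hq2⟩ := exists_rat_btwn h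
    refine ⟨q, hq2, le_trans hj.1 (Finset.card_le_card fun i hi => ?_)⟩
    exact mem_filter.2 ⟨mem_univ _, (mem_filter.1 hi).2.trans hq1.le⟩
  · rintro ⟨q, hq, h⟩
    exact (hj.2 h).trans_lt hq

theorem measurable_knnRadius (hk : 1 ≤ k) (hkn : k ≤ n) :
    Measurable fun q : (Fin n → RSpace d) × RSpace d => knnRadius k q.1 q.2 := by
  refine measurable_of_Iio fun t => ?_
  have h : (fun q : (Fin n → RSpace d) × RSpace d => knnRadius k q.1 q.2) ⁻¹' Set.Iio t =
      ⋃ q : ℚ, ⋃ _ : (q : ℝ) < t, {p | k ≤ #{i : Fin n | ‖p.1 i - p.2‖ ≤ q}} := by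
    ext p
    simp only [Set.mem_preimage, Set.mem_Iio, knnRadius_lt_iff hk hkn, Set.mem_iUnion,
      Set.mem_ofPred_eq, exists_prop]
  rw [h]
  refine MeasurableSet.iUnion fun q => MeasurableSet.iUnion fun _ => ?_
  simp only [Finset.card_filter]
  refine measurableSet_le measurable_const (Finset.measurable_sum _ fun i _ => ?_)
  exact Measurable.ite (measurableSet_le (by fun_prop) measurable_const) measurable_const
    measurable_const

theorem measurableSet_mem_knnIndices (hk : 1 ≤ k) (hkn : k ≤ n) (i : Fin n) :
    MeasurableSet {q : (Fin n → RSpace d) × RSpace d | i ∈ knnIndices k q.1 q.2} := by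
  simp only [knnIndices, mem_filter, mem_univ, true_and]
  exact measurableSet_le (by fun_prop) (measurable_knnRadius hk hkn)

theorem measurable_localMonomial {L : ℕ} (i : Fin n) (a : MultiIndex d L) :
    Measurable fun q : (Fin n → RSpace d) × RSpace d => localMonomial q.2 (q.1 i) a := by
  unfold localMonomial
  fun_prop

theorem measurable_matrix_det {α ι : Type*} [MeasurableSpace α] [Fintype ι] [DecidableEq ι]
    {M : α → Matrix ι ι ℝ} (h : ∀ a b, Measurable fun q => M q a b) :
    Measurable fun q => (M q).det := by
  simp only [Matrix.det_apply, Units.smul_def, zsmul_eq_mul]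
  exact Finset.measurable_sum _ fun σ _ =>
    (Finset.measurable_prod _ fun a _ => h _ _).const_mul _

theorem measurable_matrix_inv {α ι : Type*} [MeasurableSpace α] [Fintype ι] [DecidableEq ι]
    {M : α → Matrix ι ι ℝ} (h : ∀ a b, Measurable fun q => M q a b) (a b : ι) :
    Measurable fun q => (M q)⁻¹ a b := by
  simp only [Matrix.inv_def, Ring.inverse_eq_inv', Matrix.smul_apply, smul_eq_mul,
    Matrix.adjugate_apply]
  refine (measurable_matrix_det h).inv.mul (measurable_matrix_det fun c e => ?_)
  simp only [Matrix.updateRow_apply]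
  split_ifs
  · exact measurable_const
  · exact h c e

theorem measurable_localWeight {L : ℕ} (hk : 1 ≤ k) (hkn : k ≤ n) (i : Fin n) :
    Measurable fun q : (Fin n → RSpace d) × RSpace d => localWeight L k q.1 q.2 i := by
  classical
  have hgram : ∀ a b, Measurable fun q : (Fin n → RSpace d) × RSpace d =>
      localGram L k q.1 q.2 a b := by
    intro a b
    have h : ∀ q : (Fin n → RSpace d) × RSpace d, localGram L k q.1 q.2 a b =
        ∑ i, if i ∈ knnIndices k q.1 q.2 then
          localMonomial q.2 (q.1 i) a * localMonomial q.2 (q.1 i) b else 0 := by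
      intro q
      simp [localGram, Finset.sum_ite_mem]
    simp only [h]
    exact Finset.measurable_sum _ fun i _ => Measurable.ite (measurableSet_mem_knnIndices hk hkn i)
      ((measurable_localMonomial i a).mul (measurable_localMonomial i b)) measurable_const
  have hinv := measurable_matrix_inv hgram
  unfold localWeight
  exact Measurable.ite (measurableSet_mem_knnIndices hk hkn i)
    (Finset.measurable_sum _ fun b _ => (hinv _ b).mul (measurable_localMonomial i b))
    measurable_const

end knn

/-! ### Singling out the `k`-th neighbour. -/

section leaveOneOut

variable {d n k : ℕ} {X : Fin (n + 1) → RSpace d} {x : RSpace d}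

theorem card_filter_succAbove (p : Fin (n + 1) → Prop) [DecidablePred p] (j : Fin (n + 1)) :
    #{i | p i} = (if p j then 1 else 0) + #{i : Fin n | p (j.succAbove i)} := by
  simp only [Finset.card_filter]
  exact Fin.sum_univ_succAbove _ j

/-- One of the points is the `k`-th nearest neighbour: `k - 1` of the other ones are at most as
distant, the remaining ones at least as distant. -/
theorem exists_kth_neighbour (hk : 1 ≤ k) (hkn : k ≤ n + 1) (X : Fin (n + 1) → RSpace d)
    (x : RSpace d) : ∃ j : Fin (n + 1), ∃ J ∈ powersetCard (k - 1) (univ : Finset (Fin n)),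
      (∀ i ∈ J, ‖X (j.succAbove i) - x‖ ≤ ‖X j - x‖) ∧
      ∀ i ∉ J, ‖X j - x‖ ≤ ‖X (j.succAbove i) - x‖ := by
  classical
  obtain ⟨j, hj⟩ := exists_isLeast_knn hk hkn X x
  have h1 : #{i : Fin n | ‖X (j.succAbove i) - x‖ < ‖X j - x‖} ≤ k - 1 := by
    by_contra hcon
    obtain ⟨i₀, hi₀, hmax⟩ := Finset.exists_max_image
      ({i : Fin n | ‖X (j.succAbove i) - x‖ < ‖X j - x‖} : Finset (Fin n))
      (fun i => ‖X (j.succAbove i) - x‖) (Finset.card_pos.1 (by omega))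
    refine absurd (hj.2 (show k ≤ _ from ?_)) (not_le.2 (mem_filter.1 hi₀).2)
    rw [card_filter_succAbove _ j]
    refine le_trans (show k ≤ #{i : Fin n | ‖X (j.succAbove i) - x‖ < ‖X j - x‖} by omega)
      (le_trans (Finset.card_le_card fun i hi => ?_) (Nat.le_add_left _ _))
    exact mem_filter.2 ⟨mem_univ _, hmax i hi⟩
  have h2 : k - 1 ≤ #{i : Fin n | ‖X (j.succAbove i) - x‖ ≤ ‖X j - x‖} := by
    have := hj.1
    rw [Set.mem_ofPred_eq, card_filter_succAbove _ j, if_pos le_rfl] at this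
    omega
  -- At most `k - 1` other points are strictly closer and at least `k - 1` are no farther, so ties
  -- leave room for a set of exactly that size in between.
  obtain ⟨J, hJ1, hJ2, hJ3⟩ := Finset.exists_subsuperset_card_eq
    (Finset.monotone_filter_right univ fun i _ (hi : ‖X (j.succAbove i) - x‖ < ‖X j - x‖) => hi.le)
    h1 h2
  refine ⟨j, J, mem_powersetCard.2 ⟨subset_univ _, hJ3⟩, fun i hi => (mem_filter.1 (hJ2 hi)).2,
    fun i hi => ?_⟩
  by_contra hcon
  exact hi (hJ1 (mem_filter.2 ⟨mem_univ _, not_le.1 hcon⟩))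

theorem card_filter_le_kth {j : Fin (n + 1)} {J : Finset (Fin n)} (hk : 1 ≤ k) (hJ : #J = k - 1)
    (h1 : ∀ i ∈ J, ‖X (j.succAbove i) - x‖ ≤ ‖X j - x‖)
    (h2 : ∀ i ∉ J, ‖X j - x‖ < ‖X (j.succAbove i) - x‖) :
    #{i | ‖X i - x‖ ≤ ‖X j - x‖} = k := by
  rw [card_filter_succAbove _ j, if_pos le_rfl]
  have h3 : ({i : Fin n | ‖X (j.succAbove i) - x‖ ≤ ‖X j - x‖} : Finset (Fin n)) = J := by
    ext i
    simp only [mem_filter, mem_univ, true_and]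
    refine ⟨fun h => ?_, h1 i⟩
    by_contra hi
    exact absurd h (not_le.2 (h2 i hi))
  rw [h3, hJ]
  omega

theorem knnRadius_eq_kth {j : Fin (n + 1)} {J : Finset (Fin n)} (hk : 1 ≤ k) (hJ : #J = k - 1)
    (h1 : ∀ i ∈ J, ‖X (j.succAbove i) - x‖ ≤ ‖X j - x‖)
    (h2 : ∀ i ∉ J, ‖X j - x‖ < ‖X (j.succAbove i) - x‖) :
    knnRadius k X x = ‖X j - x‖ := by
  have hcard := card_filter_le_kth hk hJ h1 h2
  refine IsLeast.csInf_eq ⟨hcard.ge, fun r hr => ?_⟩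
  by_contra hlt
  rw [not_le] at hlt
  have h3 : #{i | ‖X i - x‖ ≤ r} < #{i | ‖X i - x‖ ≤ ‖X j - x‖} := by
    refine Finset.card_lt_card (Finset.ssubset_iff_subset_ne.2 ⟨fun i hi => ?_, fun h => ?_⟩)
    · exact mem_filter.2 ⟨mem_univ _, (mem_filter.1 hi).2.trans hlt.le⟩
    · have : j ∈ ({i | ‖X i - x‖ ≤ r} : Finset (Fin (n + 1))) := by
        rw [h]; simp
      exact absurd (mem_filter.1 this).2 (not_le.2 hlt)
  rw [hcard] at h3
  exact absurd hr (not_le.2 h3)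

/-- Without ties at its radius the `k`-th neighbour is identified by that radius; the inner set then
follows. This makes the events `kthEvent` disjoint. -/
theorem kth_neighbour_unique {j j' : Fin (n + 1)} {J J' : Finset (Fin n)} (hk : 1 ≤ k)
    (hJ : #J = k - 1) (hJ' : #J' = k - 1)
    (h1 : ∀ i ∈ J, ‖X (j.succAbove i) - x‖ < ‖X j - x‖)
    (h2 : ∀ i ∉ J, ‖X j - x‖ < ‖X (j.succAbove i) - x‖)
    (h1' : ∀ i ∈ J', ‖X (j'.succAbove i) - x‖ < ‖X j' - x‖)
    (h2' : ∀ i ∉ J', ‖X j' - x‖ < ‖X (j'.succAbove i) - x‖) : j = j' ∧ J = J' := by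
  have e1 := knnRadius_eq_kth hk hJ (fun i hi => (h1 i hi).le) h2
  have e2 := knnRadius_eq_kth hk hJ' (fun i hi => (h1' i hi).le) h2'
  have hr : ‖X j' - x‖ = ‖X j - x‖ := by rw [← e1, ← e2]
  have hj : j = j' := by
    by_contra hne
    obtain ⟨i, rfl⟩ := Fin.exists_succAbove_eq (Ne.symm hne)
    by_cases hi : i ∈ J
    · exact absurd hr (h1 i hi).ne
    · exact absurd hr (h2 i hi).ne'
  subst hj
  refine ⟨rfl, ?_⟩
  ext i
  constructor
  · intro hi
    by_contra hi'
    exact absurd (h1 i hi) (not_lt.2 (h2' i hi').le)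
  · intro hi
    by_contra hi'
    exact absurd (h1' i hi) (not_lt.2 (h2 i hi').le)

theorem exists_subset_knnIndices_succAbove (hk : 1 ≤ k) (hkn : k ≤ n + 1) (j : Fin (n + 1)) :
    ∃ T ∈ powersetCard (k - 1) (univ : Finset (Fin n)),
      ∀ i ∈ T, j.succAbove i ∈ knnIndices k X x := by
  classical
  have h1 := le_card_knnIndices (X := X) (x := x) hk hkn
  have h2 := card_filter_succAbove (fun i => i ∈ knnIndices k X x) j
  rw [Finset.filter_mem_eq_inter, univ_inter] at h2
  have h3 : k - 1 ≤ #{i : Fin n | j.succAbove i ∈ knnIndices k X x} := by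
    split_ifs at h2 <;> omega
  obtain ⟨T, hT, hTc⟩ := Finset.exists_subset_card_eq h3
  exact ⟨T, mem_powersetCard.2 ⟨subset_univ _, hTc⟩, fun i hi => (mem_filter.1 (hT hi)).2⟩

end leaveOneOut

/-! ### Pointwise bound for the bias -/

/-- The bias at `x` of the local polynomial estimate, given the covariates. -/
noncomputable def localBias {d n : ℕ} (L k : ℕ) (g : RSpace d → ℝ) (X : Fin n → RSpace d)
    (x : RSpace d) : ℝ :=
  (∑ i, localWeight L k X x i * g (X i)) - g x

/-- The function `g` is approximated around `x`, at the points of `S`, by local polynomials of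
degree `L` up to `A` times the distance to the power `s`. -/
def LocallyPolynomialOn {d : ℕ} (L : ℕ) (A s : ℝ) (S : Set (RSpace d)) (g : RSpace d → ℝ) : Prop :=
  ∀ x ∈ S, ∃ c : MultiIndex d L → ℝ, c (zeroIndex d L) = g x ∧
    ∀ z ∈ S, |g z - ∑ a, c a * localMonomial x z a| ≤ A * ‖z - x‖ ^ s

section bias

variable {d n L k : ℕ} {X : Fin n → RSpace d} {x : RSpace d} {S : Set (RSpace d)}
  {g : RSpace d → ℝ} {A s : ℝ}

/-- Reproduction replaces `g` by its error of local approximation, at most `A τ ^ s` at each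
neighbour. Cauchy-Schwarz separates these errors from the weights. -/
theorem localBias_sq_le (hg : LocallyPolynomialOn L A s S g) (hs : 0 ≤ s) (hA : 0 ≤ A)
    (hx : x ∈ S) (hX : ∀ i, X i ∈ S) (hM : IsUnit (localGram L k X x).det) :
    localBias L k g X x ^ 2 ≤
      A ^ 2 * knnRadius k X x ^ (2 * s) * (#(knnIndices k X x) * ∑ i, localWeight L k X x i ^ 2) := by
  classical
  obtain ⟨c, hc0, hc⟩ := hg x hx
  set τ := knnRadius k X x with hτ
  rcases (knnIndices k X x).eq_empty_or_nonempty with hempty | ⟨i₀, hi₀⟩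
  · exfalso
    have := sum_localWeight_mul_localMonomial hM (zeroIndex d L)
    simp [localWeight, hempty] at this
  have hτ0 : 0 ≤ τ := (norm_nonneg _).trans (mem_filter.1 hi₀).2
  have h1 : localBias L k g X x =
      ∑ i ∈ knnIndices k X x, localWeight L k X x i *
        (g (X i) - ∑ a, c a * localMonomial x (X i) a) := by
    have h2 : ∑ i, localWeight L k X x i * ∑ a, c a * localMonomial x (X i) a = g x := by
      simp only [Finset.mul_sum]
      rw [Finset.sum_comm]
      calc _ = ∑ a, c a * ∑ i, localWeight L k X x i * localMonomial x (X i) a := by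
            refine Finset.sum_congr rfl fun a _ => ?_
            rw [Finset.mul_sum]
            exact Finset.sum_congr rfl fun i _ => by ring
        _ = g x := by
            simp only [sum_localWeight_mul_localMonomial hM]
            simp [hc0]
    rw [localBias, ← h2, ← Finset.sum_sub_distrib]
    rw [← Finset.sum_subset (subset_univ (knnIndices k X x))]
    · exact Finset.sum_congr rfl fun i _ => by ring
    · intro i _ hi
      simp [localWeight, hi]
  rw [h1]
  refine (Finset.sum_mul_sq_le_sq_mul_sq _ _ _).trans ?_
  have h3 : ∑ i ∈ knnIndices k X x, localWeight L k X x i ^ 2 ≤ ∑ i, localWeight L k X x i ^ 2 :=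
    Finset.sum_le_sum_of_subset_of_nonneg (subset_univ _) fun _ _ _ => sq_nonneg _
  have h4 : ∑ i ∈ knnIndices k X x, (g (X i) - ∑ a, c a * localMonomial x (X i) a) ^ 2 ≤
      #(knnIndices k X x) * (A ^ 2 * τ ^ (2 * s)) := by
    rw [← nsmul_eq_mul]
    refine Finset.sum_le_card_nsmul _ _ _ fun i hi => ?_
    rw [← sq_abs, mul_comm 2 s, Real.rpow_mul hτ0, Real.rpow_two, ← mul_pow]
    refine pow_le_pow_left₀ (abs_nonneg _) ((hc _ (hX i)).trans ?_) 2
    gcongr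
    exact (mem_filter.1 hi).2
  refine (mul_le_mul h3 h4 (Finset.sum_nonneg fun _ _ => sq_nonneg _)
    (Finset.sum_nonneg fun _ _ => sq_nonneg _)).trans (le_of_eq ?_)
  ring

/-- The factor `B` in the weight bound absorbs the number of neighbours up to `κ`. If the matrix is
singular the right side is infinite, its other factors being positive. -/
theorem ofReal_localBias_sq_le {B G : ℕ} {r : ℝ} {κ : ℕ} (hB : 0 < B) (hG : 0 < G) (hr : 0 < r)
    (hg : LocallyPolynomialOn L A s S g) (hs : 0 ≤ s) (hA : 0 < A)
    (hx : x ∈ S) (hX : ∀ i, X i ∈ S) (hτ : knnRadius k X x = r)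
    (hcard : #(knnIndices k X x) ≤ κ * B) (hκ : 0 < κ)
    (e : Fin B × Fin G × MultiIndex d L ↪ Fin n) (he : ∀ q, e q ∈ knnIndices k X x) :
    ENNReal.ofReal (localBias L k g X x ^ 2) ≤
      ENNReal.ofReal (r ^ (2 * s)) *
        (ENNReal.ofReal (A ^ 2 * κ * ((numMonomials d L).factorial : ℝ) ^ 2) *
          blockWeight (2 / G) x r e X) := by
  have hfac := Nat.factorial_pos (numMonomials d L)
  by_cases hM : IsUnit (localGram L k X x).det
  · have her : ∀ q, ‖X (e q) - x‖ ≤ r := fun q => by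
      have := (mem_filter.1 (he q)).2
      rwa [hτ] at this
    have h1 := ofReal_sum_sq_localWeight_le (X := X) (x := x) (k := k) hB hG hr e he her
    have h2 := localBias_sq_le hg hs hA.le hx hX hM
    set v := ∑ i, localWeight L k X x i ^ 2 with hv
    have hv0 : 0 ≤ v := Finset.sum_nonneg fun _ _ => sq_nonneg _
    have h3 : localBias L k g X x ^ 2 ≤ r ^ (2 * s) * (A ^ 2 * κ) * (B * v) := by
      refine h2.trans ?_
      rw [hτ]
      have h4 : (#(knnIndices k X x) : ℝ) ≤ κ * B := by exact_mod_cast hcard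
      calc A ^ 2 * r ^ (2 * s) * (#(knnIndices k X x) * v)
          ≤ A ^ 2 * r ^ (2 * s) * ((κ * B) * v) := by gcongr
        _ = _ := by ring
    refine (ENNReal.ofReal_le_ofReal h3).trans ?_
    rw [ENNReal.ofReal_mul (by positivity), ENNReal.ofReal_mul (by positivity),
      ENNReal.ofReal_mul (p := A ^ 2 * κ) (by positivity), mul_assoc, mul_assoc]
    gcongr
  · rw [blockWeight_eq_top hB hG hM hr he]
    rw [ENNReal.mul_top, ENNReal.mul_top]
    · exact le_top
    · rw [ne_eq, ENNReal.ofReal_eq_zero, not_le]; positivity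
    · rw [ne_eq, ENNReal.ofReal_eq_zero, not_le]; positivity

end bias

theorem exists_embedding_mem {α ι : Type*} [Fintype α] (J : Finset ι)
    (h : Fintype.card α ≤ #J) : ∃ e : α ↪ ι, ∀ q, e q ∈ J := by
  obtain ⟨f⟩ := Function.Embedding.nonempty_of_card_le (α := α) (β := J) (by simpa using h)
  exact ⟨f.trans (Function.Embedding.subtype _), fun q => (f q).2⟩

/-! ### Isolating one coordinate of a sample -/

theorem lintegral_pi_insertNth {E : Type*} [MeasurableSpace E] {P : Measure E} [SigmaFinite P]
    {n : ℕ} (j : Fin (n + 1)) {Ψ : (Fin (n + 1) → E) → ℝ≥0∞} (hΨ : Measurable Ψ) :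
    ∫⁻ X, Ψ X ∂(Measure.pi fun _ => P) =
      ∫⁻ y, ∫⁻ Z, Ψ (j.insertNth y Z) ∂(Measure.pi fun _ : Fin n => P) ∂P := by
  have hmp := (measurePreserving_piFinSuccAbove (fun _ : Fin (n + 1) => P) j).symm
  rw [← hmp.lintegral_comp hΨ]
  exact lintegral_prod _ (hΨ.comp hmp.measurable).aemeasurable

/-! ### The law of the `k`-th nearest neighbour distance -/

section kth

variable {d : ℕ} {P : Measure (RSpace d)} {x : RSpace d}

/-- The mass of the closed ball around `x` with `y` on its boundary. -/
noncomputable def ballMass (P : Measure (RSpace d)) (x y : RSpace d) : ℝ≥0∞ :=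
  P (Metric.closedBall x ‖y - x‖)

/-- The mass of the complement of the closed ball around `x` with `y` on its boundary. -/
noncomputable def coballMass (P : Measure (RSpace d)) (x y : RSpace d) : ℝ≥0∞ :=
  P (Metric.closedBall x ‖y - x‖)ᶜ

theorem measurable_ballMass : Measurable (ballMass P x) := by
  have h : Monotone fun r : ℝ => P (Metric.closedBall x r) := fun r s h =>
    measure_mono (Metric.closedBall_subset_closedBall h)
  exact h.measurable.comp (by fun_prop)

theorem measurable_coballMass : Measurable (coballMass P x) := by
  have h : Antitone fun r : ℝ => P (Metric.closedBall x r)ᶜ := fun r s h =>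
    measure_mono (Set.compl_subset_compl.2 (Metric.closedBall_subset_closedBall h))
  exact h.measurable.comp (by fun_prop)

/-- The number of ways to choose a point among `N + 1` and then `m` other ones. -/
def kthCount (N m : ℕ) : ℕ := (N + 1) * N.choose m

theorem kthCount_step (N m : ℕ) : (N + 1) * kthCount N m ≤ (m + 1) * kthCount (N + 1) (m + 1) := by
  unfold kthCount
  have h := Nat.add_one_mul_choose_eq N m
  nlinarith [Nat.zero_le (N.choose m), Nat.zero_le ((N + 1).choose (m + 1))]

/-- A lower bound for a quotient of normalising constants, obtained by iterating `kthCount_step`; it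
replaces an evaluation of beta integrals. -/
theorem kthCount_pow_le (N m q : ℕ) :
    (N + 1) ^ q * kthCount N m ≤ (m + q) ^ q * kthCount (N + q) (m + q) := by
  induction q with
  | zero => simp
  | succ q ih =>
    calc (N + 1) ^ (q + 1) * kthCount N m = (N + 1) * ((N + 1) ^ q * kthCount N m) := by ring
      _ ≤ (N + q + 1) * ((m + q) ^ q * kthCount (N + q) (m + q)) :=
          Nat.mul_le_mul (by omega) ih
      _ = (m + q) ^ q * ((N + q + 1) * kthCount (N + q) (m + q)) := by ring
      _ ≤ (m + q + 1) ^ q * ((m + q + 1) * kthCount (N + q + 1) (m + q + 1)) :=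
          Nat.mul_le_mul (Nat.pow_le_pow_left (by omega) q) (kthCount_step _ _)
      _ = _ := by rw [pow_succ]; simp only [← add_assoc]; ring

theorem prod_mem_eq_pow {N m : ℕ} {J : Finset (Fin N)} (hJ : #J = m) (u v : ℝ≥0∞) :
    ∏ i, (if i ∈ J then u else v) = u ^ m * v ^ (N - m) := by
  classical
  rw [Finset.prod_ite]
  simp only [prod_const]
  have h1 : #{i : Fin N | i ∈ J} = m := by
    rw [Finset.filter_mem_eq_inter, univ_inter, hJ]
  have h2 : #{i : Fin N | i ∉ J} = N - m := by
    have := Finset.card_filter_add_card_filter_not (s := (univ : Finset (Fin N))) (fun i => i ∈ J)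
    rw [card_univ, Fintype.card_fin] at this
    omega
  rw [h1, h2]

theorem measure_ball_eq_ballMass (hS : ∀ r : ℝ, P (Metric.sphere x r) = 0) (y : RSpace d) :
    P (Metric.ball x ‖y - x‖) = ballMass P x y := by
  rw [ballMass, ← Metric.ball_union_sphere]
  refine le_antisymm (measure_mono Set.subset_union_left) ?_
  refine (measure_union_le _ _).trans ?_
  rw [hS, add_zero]

theorem measure_compl_ball_eq_coballMass [IsProbabilityMeasure P]
    (hS : ∀ r : ℝ, P (Metric.sphere x r) = 0)
    (y : RSpace d) : P (Metric.ball x ‖y - x‖)ᶜ = coballMass P x y := by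
  rw [coballMass, prob_compl_eq_one_sub measurableSet_ball,
    prob_compl_eq_one_sub measurableSet_closedBall, measure_ball_eq_ballMass hS, ballMass]

/-- The event that, apart from the `j`-th point, exactly the points of index in `J` are strictly
closer to `x` than the `j`-th one, the others being strictly farther away. -/
def kthEvent {d N : ℕ} (x : RSpace d) (j : Fin (N + 1)) (J : Finset (Fin N)) :
    Set (Fin (N + 1) → RSpace d) :=
  {X | (∀ i ∈ J, ‖X (j.succAbove i) - x‖ < ‖X j - x‖) ∧
    ∀ i ∉ J, ‖X j - x‖ < ‖X (j.succAbove i) - x‖}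

theorem measurableSet_kthEvent {N : ℕ} (j : Fin (N + 1)) (J : Finset (Fin N)) :
    MeasurableSet (kthEvent x j J) := by
  have h : kthEvent x j J = (⋂ i ∈ J, {X | ‖X (j.succAbove i) - x‖ < ‖X j - x‖}) ∩
      ⋂ i, ⋂ _ : i ∉ J, {X | ‖X j - x‖ < ‖X (j.succAbove i) - x‖} := by
    ext X
    simp [kthEvent]
  rw [h]
  exact (Finset.measurableSet_biInter _ fun i _ =>
    measurableSet_lt (by fun_prop) (by fun_prop)).inter
    (MeasurableSet.iInter fun i => MeasurableSet.iInter fun _ =>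
      measurableSet_lt (by fun_prop) (by fun_prop))

/-- Fix the position of the `j`-th point; the others are independent, `m` of them inside its ball
and `N - m` outside. Spheres are null, so open and closed balls have the same mass. -/
theorem measure_kthEvent [IsProbabilityMeasure P]
    (hS : ∀ r : ℝ, P (Metric.sphere x r) = 0) {N m : ℕ} (j : Fin (N + 1))
    {J : Finset (Fin N)} (hJ : #J = m) :
    Measure.pi (fun _ => P) (kthEvent x j J) =
      ∫⁻ y, ballMass P x y ^ m * coballMass P x y ^ (N - m) ∂P := by
  classical
  rw [← lintegral_indicator_one (measurableSet_kthEvent j J),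
    lintegral_pi_insertNth j (measurable_one.indicator (measurableSet_kthEvent j J))]
  refine lintegral_congr fun y => ?_
  have h : ∀ Z : Fin N → RSpace d, (kthEvent x j J).indicator (1 : (Fin (N + 1) → RSpace d) → ℝ≥0∞) (j.insertNth y Z) =
      (Set.univ.pi fun i => if i ∈ J then Metric.ball x ‖y - x‖ else
        (Metric.closedBall x ‖y - x‖)ᶜ).indicator 1 Z := by
    intro Z
    refine Set.indicator_eq_indicator ?_ rfl
    simp only [kthEvent, Set.mem_ofPred_eq, Fin.insertNth_apply_succAbove,
      Fin.insertNth_apply_same, Set.mem_pi, Set.mem_univ, forall_const]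
    constructor
    · rintro ⟨h1, h2⟩ i
      by_cases hi : i ∈ J
      · simpa [hi, dist_eq_norm] using h1 i hi
      · simpa [hi, dist_eq_norm] using h2 i hi
    · intro h
      refine ⟨fun i hi => ?_, fun i hi => ?_⟩
      · simpa [hi, dist_eq_norm] using h i
      · simpa [hi, dist_eq_norm] using h i
  simp_rw [h]
  rw [lintegral_indicator_one, Measure.pi_pi]
  · rw [← prod_mem_eq_pow hJ]
    refine Finset.prod_congr rfl fun i _ => ?_
    split_ifs
    · exact measure_ball_eq_ballMass hS y
    · rfl
  · refine MeasurableSet.univ_pi fun i => ?_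
    split_ifs
    · exact measurableSet_ball
    · exact measurableSet_closedBall.compl

/-- The density of the `k`-th nearest neighbour has total mass at most one. -/
theorem kthCount_mul_lintegral_le_one [IsProbabilityMeasure P]
    (hS : ∀ r : ℝ, P (Metric.sphere x r) = 0) (N m : ℕ) :
    (kthCount N m : ℝ≥0∞) * ∫⁻ y, ballMass P x y ^ m * coballMass P x y ^ (N - m) ∂P ≤ 1 := by
  classical
  set T : Finset (Fin (N + 1) × Finset (Fin N)) :=
    (univ : Finset (Fin (N + 1))) ×ˢ powersetCard m (univ : Finset (Fin N)) with hT
  have hcard : #T = kthCount N m := by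
    simp [hT, kthCount]
  have hdisj : (T : Set (Fin (N + 1) × Finset (Fin N))).PairwiseDisjoint
      fun q => kthEvent x q.1 q.2 := by
    rintro ⟨j, J⟩ hq ⟨j', J'⟩ hq' hne
    refine Set.disjoint_left.2 fun X hX hX' => hne ?_
    have hJ := (mem_powersetCard.1 (mem_product.1 (mem_coe.1 hq)).2).2
    have hJ' := (mem_powersetCard.1 (mem_product.1 (mem_coe.1 hq')).2).2
    obtain ⟨rfl, rfl⟩ := kth_neighbour_unique (k := m + 1) (by omega) (by simpa using hJ)
      (by simpa using hJ') hX.1 hX.2 hX'.1 hX'.2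
    rfl
  have h1 := measure_biUnion_finset (μ := Measure.pi fun _ : Fin (N + 1) => P) hdisj
    fun q _ => measurableSet_kthEvent q.1 q.2
  have h2 : ∀ q ∈ T, Measure.pi (fun _ => P) (kthEvent x q.1 q.2) =
      ∫⁻ y, ballMass P x y ^ m * coballMass P x y ^ (N - m) ∂P := fun q hq =>
    measure_kthEvent hS q.1 (mem_powersetCard.1 (mem_product.1 hq).2).2
  rw [Finset.sum_congr rfl h2, sum_const, hcard, nsmul_eq_mul] at h1
  rw [← h1]
  exact prob_le_one

/-- Multiplication by the `q`-th power of the ball mass turns the unnormalised density for `(N, m)`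
into the one for `(N + q, m + q)`. That one has normalised mass at most one, and `kthCount_pow_le`
compares the constants. -/
theorem lintegral_ballMass_moment_le [IsProbabilityMeasure P]
    (hS : ∀ r : ℝ, P (Metric.sphere x r) = 0) (N m q : ℕ) :
    (kthCount N m : ℝ≥0∞) * ∫⁻ y, (ballMass P x y * ((N + 1 : ℕ) / (m + 1 : ℕ))) ^ q *
      (ballMass P x y ^ m * coballMass P x y ^ (N - m)) ∂P ≤ (q + 1 : ℕ) ^ q := by
  have h1 := kthCount_mul_lintegral_le_one (x := x) hS (N + q) (m + q)
  rw [Nat.add_sub_add_right] at h1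
  set I := ∫⁻ y, ballMass P x y ^ (m + q) * coballMass P x y ^ (N - m) ∂P with hI
  have hm0 : ((m + 1 : ℕ) : ℝ≥0∞) ^ q ≠ 0 := by positivity
  have hmt : ((m + 1 : ℕ) : ℝ≥0∞) ^ q ≠ ⊤ := ENNReal.pow_ne_top (ENNReal.natCast_ne_top _)
  have h2 : ∫⁻ y, (ballMass P x y * ((N + 1 : ℕ) / (m + 1 : ℕ))) ^ q *
      (ballMass P x y ^ m * coballMass P x y ^ (N - m)) ∂P =
      ((N + 1 : ℕ) / (m + 1 : ℕ)) ^ q * I := by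
    rw [hI, ← lintegral_const_mul _ (by
      exact (measurable_ballMass.pow_const _).mul (measurable_coballMass.pow_const _))]
    refine lintegral_congr fun y => ?_
    rw [mul_pow, pow_add]; ring
  have h3 : ((N + 1 : ℕ) : ℝ≥0∞) ^ q * kthCount N m ≤
      ((m + 1 : ℕ) : ℝ≥0∞) ^ q * (q + 1 : ℕ) ^ q * kthCount (N + q) (m + q) := by
    have h4 := kthCount_pow_le N m q
    have h5 : (m + q) ^ q ≤ (m + 1) ^ q * (q + 1) ^ q := by
      rw [← mul_pow]
      exact Nat.pow_le_pow_left (by nlinarith [Nat.zero_le (m * q)]) q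
    exact_mod_cast h4.trans (Nat.mul_le_mul_right _ h5)
  rw [h2, ENNReal.div_eq_inv_mul, mul_pow, ← ENNReal.inv_pow]
  calc (kthCount N m : ℝ≥0∞) * (((((m + 1 : ℕ) : ℝ≥0∞) ^ q)⁻¹ * (N + 1 : ℕ) ^ q) * I)
      = (((m + 1 : ℕ) : ℝ≥0∞) ^ q)⁻¹ * ((((N + 1 : ℕ) : ℝ≥0∞) ^ q * kthCount N m) * I) := by ring
    _ ≤ (((m + 1 : ℕ) : ℝ≥0∞) ^ q)⁻¹ *
        ((((m + 1 : ℕ) : ℝ≥0∞) ^ q * (q + 1 : ℕ) ^ q * kthCount (N + q) (m + q)) * I) := by gcongr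
    _ = ((((m + 1 : ℕ) : ℝ≥0∞) ^ q)⁻¹ * ((m + 1 : ℕ) : ℝ≥0∞) ^ q) *
        ((q + 1 : ℕ) ^ q * (kthCount (N + q) (m + q) * I)) := by ring
    _ ≤ 1 * ((q + 1 : ℕ) ^ q * 1) := by
        gcongr
        exact (ENNReal.inv_mul_cancel hm0 hmt).le
    _ = _ := by rw [one_mul, mul_one]

end kth

/-! ### The mean squared bias at a point -/

/-- Quantitative regularity of a probability measure carried by a bounded set `S`: it has bounded
density, and balls centred in `S` have mass at least of the order of their volume. -/
structure IsRegularOn {d : ℕ} (P : Measure (RSpace d)) (S : Set (RSpace d)) (a : ℝ) (b : NNReal) :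
    Prop where
  le_smul : P ≤ b • volume
  le_closedBall : ∀ x ∈ S, ∀ r : ℝ, 0 < r → r ≤ Metric.diam S →
    ENNReal.ofReal (a * r ^ d) ≤ P (Metric.closedBall x r)
  compl_null : P Sᶜ = 0
  isBounded : Bornology.IsBounded S

theorem IsRegularOn.measure_sphere {d : ℕ} (hd : 0 < d) {P : Measure (RSpace d)}
    {S : Set (RSpace d)} {a : ℝ} {b : NNReal} (h : IsRegularOn P S a b) (x : RSpace d) (r : ℝ) :
    P (Metric.sphere x r) = 0 := by
  have : Nonempty (Fin d) := ⟨⟨0, hd⟩⟩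
  have h1 := h.le_smul (Metric.sphere x r)
  rw [Measure.smul_apply, Measure.addHaar_sphere (volume : Measure (RSpace d)), smul_zero] at h1
  exact le_antisymm h1 zero_le

theorem measurable_localBias {d n L k : ℕ} (hk : 1 ≤ k) (hkn : k ≤ n) {g : RSpace d → ℝ}
    (hg : Measurable g) :
    Measurable fun q : (Fin n → RSpace d) × RSpace d => localBias L k g q.1 q.2 := by
  unfold localBias
  refine Measurable.sub (Finset.measurable_sum _ fun i _ => ?_) (hg.comp measurable_snd)
  exact (measurable_localWeight hk hkn i).mul (hg.comp (by fun_prop))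

theorem blockWeight_insertNth {d L B G N : ℕ} (t : ℝ) (x : RSpace d) (r : ℝ)
    (e : Fin B × Fin G × MultiIndex d L → Fin N) (j : Fin (N + 1)) (y : RSpace d)
    (Z : Fin N → RSpace d) :
    blockWeight t x r (fun q => j.succAbove (e q)) (j.insertNth (α := fun _ => RSpace d) y Z) =
      blockWeight t x r e Z := by
  simp only [blockWeight, Fin.insertNth_apply_succAbove]

section bound

variable {d L : ℕ} {P : Measure (RSpace d)} [IsProbabilityMeasure P] {x : RSpace d}

/-- The events with weak inequalities cover every sample, ties included; overlaps only increase the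
upper bound. Each event is then integrated with its `j`-th point fixed, and there are `kthCount N m`
of them. -/
theorem lintegral_le_sum_kth {N m : ℕ} (hm : m ≤ N)
    {Ψ : (Fin (N + 1) → RSpace d) → ℝ≥0∞} (hΨ : Measurable Ψ) {R : RSpace d → ℝ≥0∞}
    (hR : ∀ᵐ y ∂P, ∀ (j : Fin (N + 1)) (J : Finset (Fin N)), #J = m →
      ∫⁻ Z in Set.univ.pi fun i => if i ∈ J then Metric.closedBall x ‖y - x‖ else
        (Metric.ball x ‖y - x‖)ᶜ, Ψ (j.insertNth y Z) ∂(Measure.pi fun _ => P) ≤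
          R y * (ballMass P x y ^ m * coballMass P x y ^ (N - m))) :
    ∫⁻ X, Ψ X ∂(Measure.pi fun _ => P) ≤ kthCount N m *
      ∫⁻ y, R y * (ballMass P x y ^ m * coballMass P x y ^ (N - m)) ∂P := by
  classical
  let E : Fin (N + 1) → Finset (Fin N) → Set (Fin (N + 1) → RSpace d) := fun j J =>
    (⋂ i ∈ J, {X | ‖X (j.succAbove i) - x‖ ≤ ‖X j - x‖}) ∩
      ⋂ i, ⋂ _ : i ∉ J, {X | ‖X j - x‖ ≤ ‖X (j.succAbove i) - x‖}
  have hE : ∀ j J, MeasurableSet (E j J) := fun j J =>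
    (Finset.measurableSet_biInter _ fun i _ =>
      measurableSet_le (by fun_prop) (by fun_prop)).inter
      (MeasurableSet.iInter fun i => MeasurableSet.iInter fun _ =>
        measurableSet_le (by fun_prop) (by fun_prop))
  have hcover : ∀ X, Ψ X ≤ ∑ j, ∑ J ∈ powersetCard m (univ : Finset (Fin N)),
      (E j J).indicator Ψ X := by
    intro X
    obtain ⟨j, J, hJ, h1, h2⟩ := exists_kth_neighbour (k := m + 1) (by omega) (by omega) X x
    have hX : X ∈ E j J := by
      simp only [E, Set.mem_inter_iff, Set.mem_iInter, Set.mem_ofPred_eq]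
      exact ⟨h1, h2⟩
    calc Ψ X = (E j J).indicator Ψ X := (Set.indicator_of_mem hX _).symm
      _ ≤ ∑ J ∈ powersetCard m (univ : Finset (Fin N)), (E j J).indicator Ψ X :=
          Finset.single_le_sum (f := fun J => (E j J).indicator Ψ X) (fun _ _ => zero_le) hJ
      _ ≤ _ := Finset.single_le_sum (f := fun j => ∑ J ∈ powersetCard m (univ : Finset (Fin N)),
          (E j J).indicator Ψ X) (fun _ _ => zero_le) (mem_univ j)
  have hterm : ∀ j, ∀ J ∈ powersetCard m (univ : Finset (Fin N)),
      ∫⁻ X, (E j J).indicator Ψ X ∂(Measure.pi fun _ => P) ≤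
        ∫⁻ y, R y * (ballMass P x y ^ m * coballMass P x y ^ (N - m)) ∂P := by
    intro j J hJ
    rw [lintegral_pi_insertNth j (hΨ.indicator (hE j J))]
    refine lintegral_mono_ae ?_
    filter_upwards [hR] with y hy
    refine le_trans (le_of_eq ?_) (hy j J (mem_powersetCard.1 hJ).2)
    rw [← lintegral_indicator (MeasurableSet.univ_pi fun i => by
      split_ifs
      · exact measurableSet_closedBall
      · exact measurableSet_ball.compl)]
    refine lintegral_congr fun Z => ?_
    have hiff : (j.insertNth y Z : Fin (N + 1) → RSpace d) ∈ E j J ↔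
        Z ∈ Set.univ.pi fun i => if i ∈ J then Metric.closedBall x ‖y - x‖ else
          (Metric.ball x ‖y - x‖)ᶜ := by
      simp only [E, Set.mem_inter_iff, Set.mem_iInter, Set.mem_ofPred_eq,
        Fin.insertNth_apply_succAbove, Fin.insertNth_apply_same, Set.mem_pi, Set.mem_univ,
        forall_const]
      constructor
      · rintro ⟨h1, h2⟩ i
        by_cases hi : i ∈ J
        · simpa [hi, dist_eq_norm] using h1 i hi
        · simpa [hi, dist_eq_norm] using h2 i hi
      · intro h
        refine ⟨fun i hi => ?_, fun i hi => ?_⟩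
        · simpa [hi, dist_eq_norm] using h i
        · simpa [hi, dist_eq_norm] using h i
    by_cases hZ : (j.insertNth y Z : Fin (N + 1) → RSpace d) ∈ E j J
    · rw [Set.indicator_of_mem hZ, Set.indicator_of_mem (hiff.1 hZ)]
    · rw [Set.indicator_of_notMem hZ, Set.indicator_of_notMem fun h => hZ (hiff.2 h)]
  calc ∫⁻ X, Ψ X ∂(Measure.pi fun _ => P)
      ≤ ∫⁻ X, ∑ j, ∑ J ∈ powersetCard m (univ : Finset (Fin N)), (E j J).indicator Ψ X
          ∂(Measure.pi fun _ => P) := lintegral_mono hcover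
    _ = ∑ j, ∑ J ∈ powersetCard m (univ : Finset (Fin N)),
          ∫⁻ X, (E j J).indicator Ψ X ∂(Measure.pi fun _ => P) := by
        rw [lintegral_finsetSum _ fun j _ => Finset.measurable_sum _ fun J _ =>
          hΨ.indicator (hE j J)]
        refine Finset.sum_congr rfl fun j _ => ?_
        rw [lintegral_finsetSum _ fun J _ => hΨ.indicator (hE j J)]
    _ ≤ ∑ _j : Fin (N + 1), ∑ _J ∈ powersetCard m (univ : Finset (Fin N)),
          ∫⁻ y, R y * (ballMass P x y ^ m * coballMass P x y ^ (N - m)) ∂P :=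
        Finset.sum_le_sum fun j _ => Finset.sum_le_sum fun J hJ => hterm j J hJ
    _ = _ := by
        simp only [sum_const, card_univ, Fintype.card_fin, card_powersetCard, nsmul_eq_mul,
          kthCount]
        push_cast
        ring

/-- The integrated squared bias, on the event that the `k`-th nearest neighbour is a given point. -/
theorem setLIntegral_localBias_sq_le {S : Set (RSpace d)} {g : RSpace d → ℝ} {A s : ℝ}
    (hsphere : ∀ r : ℝ, P (Metric.sphere x r) = 0) (hPS : P Sᶜ = 0)
    (hg : LocallyPolynomialOn L A s S g) (hs : 0 ≤ s) (hA : 0 < A) (hx : x ∈ S)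
    {y : RSpace d} (hy : y ∈ S) (hyx : y ≠ x) {G κ B N m : ℕ} (hG : 0 < G) (hB : 0 < B)
    (hκ : 0 < κ) (hBm : B * (G * numMonomials d L) ≤ m) (hmκ : m + 1 ≤ κ * B) {C : ℝ≥0∞}
    (hC : ∫⁻ z, detWeight (L := L) (2 / G) x ‖y - x‖ z
      ∂(Measure.pi fun _ => P.restrict (Metric.closedBall x ‖y - x‖)) ≤
        C * (P (Metric.closedBall x ‖y - x‖)) ^ numMonomials d L)
    (j : Fin (N + 1)) {J : Finset (Fin N)} (hJ : #J = m) :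
    ∫⁻ Z in Set.univ.pi fun i => if i ∈ J then Metric.closedBall x ‖y - x‖ else
        (Metric.ball x ‖y - x‖)ᶜ,
        ENNReal.ofReal (localBias L (m + 1) g (j.insertNth y Z) x ^ 2) ∂(Measure.pi fun _ => P) ≤
      (ENNReal.ofReal (‖y - x‖ ^ (2 * s)) *
        (ENNReal.ofReal (A ^ 2 * κ * ((numMonomials d L).factorial : ℝ) ^ 2) * C ^ G)) *
          (ballMass P x y ^ m * coballMass P x y ^ (N - m)) := by
  classical
  set r := ‖y - x‖ with hr
  have hr0 : 0 < r := norm_pos_iff.2 (sub_ne_zero.2 hyx)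
  -- All groups are taken inside `J`. The `k`-th neighbour is left out because its position is fixed
  -- here and it is not distributed like the inner points.
  obtain ⟨e, he⟩ := exists_embedding_mem (α := Fin B × Fin G × MultiIndex d L) J (by
    simpa [hJ, numMonomials] using hBm)
  set Aset : Fin N → Set (RSpace d) := fun i => if i ∈ J then Metric.closedBall x r else
        (Metric.ball x r)ᶜ with hAset
  have hAm : MeasurableSet (Set.univ.pi Aset) := MeasurableSet.univ_pi fun i => by
    simp only [hAset]
    split_ifs
    · exact measurableSet_closedBall
    · exact measurableSet_ball.compl
  -- Off the null sphere the outer inequalities become strict, so the neighbours are exactly `j` and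
  -- `J`, that is `m + 1` points.
  have hae : ∀ᵐ Z ∂(Measure.pi fun _ : Fin N => P), ∀ i, Z i ∈ S ∧ Z i ∉ Metric.sphere x r := by
    refine ae_all_iff.2 fun i => ?_
    have h1 : ∀ᵐ z ∂P, z ∈ S ∧ z ∉ Metric.sphere x r := by
      filter_upwards [show ∀ᵐ z ∂P, z ∈ S from hPS,
        measure_eq_zero_iff_ae_notMem.1 (hsphere r)] with z h1 h2 using ⟨h1, h2⟩
    exact (Measure.quasiMeasurePreserving_eval (μ := fun _ : Fin N => P) i).ae h1
  set c₀ := ENNReal.ofReal (A ^ 2 * κ * ((numMonomials d L).factorial : ℝ) ^ 2) with hc₀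
  have hpt : ∀ᵐ Z ∂(Measure.pi fun _ : Fin N => P), Z ∈ Set.univ.pi Aset →
      ENNReal.ofReal (localBias L (m + 1) g (j.insertNth y Z) x ^ 2) ≤
        ENNReal.ofReal (r ^ (2 * s)) * (c₀ * blockWeight (2 / G) x r e Z) := by
    filter_upwards [hae] with Z hZ hZA
    have h1 : ∀ i ∈ J, ‖Z i - x‖ ≤ r := fun i hi => by
      have := hZA i (Set.mem_univ i)
      simpa [hAset, hi, dist_eq_norm] using this
    have h2 : ∀ i ∉ J, r < ‖Z i - x‖ := fun i hi => by
      have h3 := hZA i (Set.mem_univ i)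
      have h4 : r ≤ ‖Z i - x‖ := by simpa [hAset, hi, dist_eq_norm] using h3
      refine lt_of_le_of_ne h4 fun h => (hZ i).2 ?_
      rw [mem_sphere_iff_norm, ← h]
    set X : Fin (N + 1) → RSpace d := j.insertNth y Z with hX
    have hXj : X j = y := by simp [hX]
    have hXs : ∀ i, X (j.succAbove i) = Z i := fun i => by simp [hX]
    have h1' : ∀ i ∈ J, ‖X (j.succAbove i) - x‖ ≤ ‖X j - x‖ := fun i hi => by
      rw [hXs, hXj]; exact h1 i hi
    have h2' : ∀ i ∉ J, ‖X j - x‖ < ‖X (j.succAbove i) - x‖ := fun i hi => by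
      rw [hXs, hXj]; exact h2 i hi
    have hτ := knnRadius_eq_kth (k := m + 1) (by omega) (by simpa using hJ) h1' h2'
    have hcard := card_filter_le_kth (k := m + 1) (by omega) (by simpa using hJ) h1' h2'
    have hXS : ∀ i, X i ∈ S := by
      intro i
      rcases eq_or_ne i j with rfl | hij
      · rwa [hXj]
      · obtain ⟨i', rfl⟩ := Fin.exists_succAbove_eq hij
        rw [hXs]; exact (hZ i').1
    have hkey := ofReal_localBias_sq_le (k := m + 1) (κ := κ) (X := X) hB hG hr0 hg hs hA hx hXS
      (by rw [hτ, hXj]) (by rw [knnIndices, hτ, hcard]; exact hmκ) hκ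
      (e.trans (Fin.succAboveEmb j)) (fun q => by
        refine mem_filter.2 ⟨mem_univ _, ?_⟩
        rw [hτ]
        exact h1' _ (he q))
    rwa [show blockWeight (2 / G) x r (e.trans (Fin.succAboveEmb j)) X =
      blockWeight (2 / G) x r e Z from blockWeight_insertNth _ _ _ _ _ _ _] at hkey
  calc _ ≤ ∫⁻ Z in Set.univ.pi Aset, ENNReal.ofReal (r ^ (2 * s)) *
          (c₀ * blockWeight (2 / G) x r e Z) ∂(Measure.pi fun _ => P) :=
        lintegral_mono_ae ((ae_restrict_iff' hAm).2 hpt)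
    _ = ENNReal.ofReal (r ^ (2 * s)) * (c₀ * ∫⁻ Z in Set.univ.pi Aset,
          blockWeight (2 / G) x r e Z ∂(Measure.pi fun _ => P)) := by
        rw [lintegral_const_mul _ ((measurable_blockWeight _ _ _ _).const_mul _),
          lintegral_const_mul _ (measurable_blockWeight _ _ _ _)]
    _ ≤ ENNReal.ofReal (r ^ (2 * s)) * (c₀ * (C ^ G * ∏ i, P (Aset i))) := by
        gcongr
        exact lintegral_blockWeight_le hC e Aset fun q => by simp only [hAset, if_pos (he q)]
    _ = _ := by
        have h3 : ∏ i, P (Aset i) = ballMass P x y ^ m * coballMass P x y ^ (N - m) := by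
          rw [← prod_mem_eq_pow hJ]
          refine Finset.prod_congr rfl fun i _ => ?_
          simp only [hAset]
          split_ifs
          · rfl
          · exact measure_compl_ball_eq_coballMass hsphere y
        rw [h3]; ring

end bound

/-- Here `f` stands for the ball mass and `ν` for `n/k`. The real power `s / d` of `f ν` is replaced
by one plus an integer power, since integer moments of the ball mass are available. -/
theorem rpow_le_moment_bound {d : ℕ} (hd : 0 < d) {a r f ν s : ℝ} {q : ℕ} (ha : 0 < a) (hr : 0 ≤ r)
    (hν : 0 < ν) (hs : 0 ≤ s) (hsq : s / d ≤ q) (hf : a * r ^ d ≤ f) :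
    r ^ s ≤ ((1 + a⁻¹) ^ q * ν⁻¹ ^ (s / d)) * (1 + (f * ν) ^ q) := by
  have hd' : (0 : ℝ) < d := by exact_mod_cast hd
  have hf0 : 0 ≤ f := le_trans (by positivity) hf
  have hp : 0 ≤ s / d := by positivity
  have h1 : r ^ s = (r ^ d) ^ (s / d) := by
    rw [← Real.rpow_natCast, ← Real.rpow_mul hr]
    congr 1
    field_simp
  have h2 : r ^ d ≤ a⁻¹ * (ν⁻¹ * (f * ν)) := by
    have : a⁻¹ * (ν⁻¹ * (f * ν)) = a⁻¹ * f := by field_simp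
    rw [this]
    calc r ^ d = a⁻¹ * (a * r ^ d) := by field_simp
      _ ≤ _ := by gcongr
  have h3 : a⁻¹ ^ (s / d) ≤ (1 + a⁻¹) ^ q := by
    have hai : 0 ≤ a⁻¹ := by positivity
    calc a⁻¹ ^ (s / d) ≤ (1 + a⁻¹) ^ (s / d) := Real.rpow_le_rpow hai (by linarith) hp
      _ ≤ (1 + a⁻¹) ^ (q : ℝ) := Real.rpow_le_rpow_of_exponent_le (by linarith) hsq
      _ = _ := Real.rpow_natCast _ _
  have h4 : (f * ν) ^ (s / d) ≤ 1 + (f * ν) ^ q := by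
    have hfν : 0 ≤ f * ν := by positivity
    rcases le_total (f * ν) 1 with h | h
    · exact (Real.rpow_le_one hfν h hp).trans (by linarith [pow_nonneg hfν q])
    · refine (Real.rpow_le_rpow_of_exponent_le h hsq).trans ?_
      rw [Real.rpow_natCast]; linarith
  calc r ^ s ≤ (a⁻¹ * (ν⁻¹ * (f * ν))) ^ (s / d) := by
        rw [h1]; exact Real.rpow_le_rpow (by positivity) h2 hp
    _ = a⁻¹ ^ (s / d) * (ν⁻¹ ^ (s / d) * (f * ν) ^ (s / d)) := by
        rw [Real.mul_rpow (by positivity) (by positivity),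
          Real.mul_rpow (by positivity) (by positivity)]
    _ ≤ (1 + a⁻¹) ^ q * (ν⁻¹ ^ (s / d) * (1 + (f * ν) ^ q)) := by gcongr
    _ = _ := by ring

/-- Uniform bound for the mean squared bias at a point of the support. -/
theorem exists_lintegral_localBias_sq_le {d : ℕ} (hd : 0 < d) (l : ℕ) {a : ℝ} (ha : 0 < a)
    (b : NNReal) : ∃ C : ℝ, 0 < C ∧ ∀ (P : Measure (RSpace d)) [IsProbabilityMeasure P]
      (S : Set (RSpace d)) (g : RSpace d → ℝ) (β Λ : ℝ), IsRegularOn P S a b → Measurable g →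
      LocallyPolynomialOn l ((d : ℝ) ^ l * Λ) (l + β) S g → 0 < β → β ≤ 1 → 0 < Λ →
      ∀ (k n : ℕ), k ≤ n → (2 * degreeSum d l + 1) * numMonomials d l + 1 ≤ k → ∀ x ∈ S,
      ∫⁻ X, ENNReal.ofReal (localBias l k g X x ^ 2) ∂(Measure.pi fun _ : Fin n => P) ≤
        ENNReal.ofReal (C * Λ ^ 2 * ((k : ℝ) / n) ^ (2 * ((l : ℝ) + β) / d)) := by
  -- The least integer `G` with `(2 / G) * D < 1`, the condition for a finite negative moment.
  set G := 2 * degreeSum d l + 1 with hG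
  have hG0 : 0 < G := by omega
  have hK0 : 0 < numMonomials d l := Fintype.card_pos_iff.2 ⟨zeroIndex d l⟩
  set q₀ := G * numMonomials d l with hq₀
  have hq₀0 : 0 < q₀ := Nat.mul_pos hG0 hK0
  have hGR : (0 : ℝ) < G := by exact_mod_cast hG0
  have htD : 2 / (G : ℝ) * degreeSum d l < 1 := by
    rw [div_mul_eq_mul_div, div_lt_one hGR, hG]
    push_cast; linarith
  obtain ⟨C₁, hC₁top, hC₁⟩ := exists_lintegral_detWeight_le d l (t := 2 / (G : ℝ)) (by positivity)
    htD b ha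
  set q := 2 * (l + 1) with hq
  set κ := 2 * q₀ with hκ
  have hC₂top : C₁ ^ G < ⊤ := ENNReal.pow_lt_top hC₁top
  set C₂ := (C₁ ^ G).toReal with hC₂
  set C₃ : ℝ := ((d : ℝ) ^ l) ^ 2 * κ * ((numMonomials d l).factorial : ℝ) ^ 2 with hC₃
  set C : ℝ := C₃ * C₂ * (1 + a⁻¹) ^ q * (1 + (q + 1 : ℕ) ^ q) with hC
  have hC₂0 : 0 ≤ C₂ := ENNReal.toReal_nonneg
  have hC₃0 : 0 ≤ C₃ := by positivity
  have hC0 : 0 ≤ C := by positivity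
  refine ⟨C + 1, by positivity, fun P _ S g β Λ hP hgm hg hβ hβ1 hΛ k n hkn hk x hx => ?_⟩
  obtain ⟨m, rfl⟩ : ∃ m, k = m + 1 := ⟨k - 1, by omega⟩
  obtain ⟨N, rfl⟩ : ∃ N, n = N + 1 := ⟨n - 1, by omega⟩
  have hmN : m ≤ N := by omega
  have hq₀m : q₀ ≤ m := by omega
  set B := m / q₀ with hB
  have hB0 : 0 < B := Nat.div_pos hq₀m hq₀0
  have hBm : B * q₀ ≤ m := Nat.div_mul_le_self m q₀
  have hmκ : m + 1 ≤ κ * B := by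
    have h1 : m < q₀ * (B + 1) := Nat.lt_mul_div_succ m hq₀0
    have h2 : q₀ * 1 ≤ q₀ * B := Nat.mul_le_mul_left _ hB0
    rw [hκ]; nlinarith
  set s : ℝ := l + β with hs
  have hs0 : 0 ≤ s := by positivity
  set A : ℝ := (d : ℝ) ^ l * Λ with hA
  have hd' : (1 : ℝ) ≤ d := by exact_mod_cast hd
  have hA0 : 0 < A := by positivity
  have hsphere := hP.measure_sphere hd x
  set ν : ℝ := ((N + 1 : ℕ) : ℝ) / ((m + 1 : ℕ) : ℝ) with hν
  have hν0 : 0 < ν := by positivity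
  have hsq : 2 * s / d ≤ q := by
    have h1 : 2 * s ≤ q := by
      rw [hs, hq]; push_cast; linarith
    exact (div_le_self (by positivity) hd').trans h1
  set c₀ := ENNReal.ofReal (A ^ 2 * κ * ((numMonomials d l).factorial : ℝ) ^ 2) with hc₀
  set M : ℝ := (1 + a⁻¹) ^ q * ν⁻¹ ^ (2 * s / d) with hM
  have hM0 : 0 ≤ M := by positivity
  set H : RSpace d → ℝ≥0∞ := fun y => ballMass P x y ^ m * coballMass P x y ^ (N - m) with hH
  have hHm : Measurable H := (measurable_ballMass.pow_const _).mul (measurable_coballMass.pow_const _)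
  set W : RSpace d → ℝ≥0∞ := fun y => (ballMass P x y * ((N + 1 : ℕ) / (m + 1 : ℕ))) ^ q with hW
  have hWm : Measurable W := (measurable_ballMass.mul_const _).pow_const _
  have hPS : ∀ᵐ y ∂P, y ∈ S := hP.compl_null
  have hPx : ∀ᵐ y ∂P, y ≠ x := by
    have h1 := measure_eq_zero_iff_ae_notMem.1 (hsphere 0)
    filter_upwards [h1] with y hy hyx
    exact hy (by simp [hyx])
  have hdiam : ∀ y ∈ S, ‖y - x‖ ≤ Metric.diam S := fun y hy => by
    rw [← dist_eq_norm]; exact Metric.dist_le_diam_of_mem hP.isBounded hy hx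
  have hlow : ∀ y ∈ S, y ≠ x → ENNReal.ofReal (a * ‖y - x‖ ^ d) ≤ ballMass P x y :=
    fun y hy hyx => hP.le_closedBall x hx _ (norm_pos_iff.2 (sub_ne_zero.2 hyx)) (hdiam y hy)
  have hmain := lintegral_le_sum_kth (P := P) (x := x) hmN
    (Ψ := fun X => ENNReal.ofReal (localBias l (m + 1) g X x ^ 2))
    (ENNReal.measurable_ofReal.comp (((measurable_localBias (k := m + 1) (by omega) hkn hgm).comp
      (f := fun X : Fin (N + 1) → RSpace d => (X, x)) (by fun_prop)).pow_const 2))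
    (R := fun y => (c₀ * C₁ ^ G * ENNReal.ofReal M) * (1 + W y)) (by
      filter_upwards [hPS, hPx] with y hy hyx j J hJ
      refine (setLIntegral_localBias_sq_le hsphere hP.compl_null hg hs0 hA0 hx hy hyx hG0 hB0
        (by omega) hBm hmκ (hC₁ P x _ hP.le_smul (norm_pos_iff.2 (sub_ne_zero.2 hyx))
          (hlow y hy hyx)) j hJ).trans ?_
      refine mul_le_mul' ?_ le_rfl
      have hfin : ballMass P x y ≠ ⊤ := measure_ne_top _ _
      have h1 := rpow_le_moment_bound (s := 2 * s) (ν := ν) hd ha (norm_nonneg (y - x)) hν0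
        (by positivity) hsq ((ENNReal.ofReal_le_iff_le_toReal hfin).1 (hlow y hy hyx))
      have h2 : ENNReal.ofReal (‖y - x‖ ^ (2 * s)) ≤ ENNReal.ofReal M * (1 + W y) := by
        refine (ENNReal.ofReal_le_ofReal h1).trans (le_of_eq ?_)
        rw [ENNReal.ofReal_mul hM0, ENNReal.ofReal_add zero_le_one (by positivity),
          ENNReal.ofReal_one, ENNReal.ofReal_pow (by positivity),
          ENNReal.ofReal_mul ENNReal.toReal_nonneg, ENNReal.ofReal_toReal hfin, hν,
          ENNReal.ofReal_div_of_pos (by positivity), ENNReal.ofReal_natCast,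
          ENNReal.ofReal_natCast]
      calc _ ≤ (ENNReal.ofReal M * (1 + W y)) * (c₀ * C₁ ^ G) := by gcongr
        _ = _ := by ring)
  have hI1 := kthCount_mul_lintegral_le_one (x := x) hsphere N m
  have hI2 := lintegral_ballMass_moment_le (x := x) hsphere N m q
  have hfinal : (kthCount N m : ℝ≥0∞) * ∫⁻ y, (c₀ * C₁ ^ G * ENNReal.ofReal M) * (1 + W y) * H y ∂P
      ≤ (c₀ * C₁ ^ G * ENNReal.ofReal M) * (1 + (q + 1 : ℕ) ^ q) := by
    have h1 : ∫⁻ y, (c₀ * C₁ ^ G * ENNReal.ofReal M) * (1 + W y) * H y ∂P =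
        (c₀ * C₁ ^ G * ENNReal.ofReal M) * (∫⁻ y, H y ∂P + ∫⁻ y, W y * H y ∂P) := by
      have h2 : Measurable fun y => H y + W y * H y := hHm.add (hWm.mul hHm)
      rw [← lintegral_add_left hHm, ← lintegral_const_mul _ h2]
      refine lintegral_congr fun y => ?_
      ring
    rw [h1]
    calc _ = (c₀ * C₁ ^ G * ENNReal.ofReal M) * ((kthCount N m : ℝ≥0∞) * ∫⁻ y, H y ∂P +
          (kthCount N m : ℝ≥0∞) * ∫⁻ y, W y * H y ∂P) := by ring
      _ ≤ _ := by gcongr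
  refine hmain.trans (hfinal.trans ?_)
  have hc₀' : c₀ = ENNReal.ofReal (C₃ * Λ ^ 2) := by
    rw [hc₀, hC₃, hA]; congr 1; ring
  have hq1 : (1 + ((q + 1 : ℕ) : ℝ≥0∞) ^ q) = ENNReal.ofReal (1 + ((q + 1 : ℕ) : ℝ) ^ q) := by
    rw [ENNReal.ofReal_add zero_le_one (by positivity), ENNReal.ofReal_one,
      ENNReal.ofReal_pow (by positivity), ENNReal.ofReal_natCast]
  rw [hc₀', ← ENNReal.ofReal_toReal hC₂top.ne, ← hC₂, hq1, ← ENNReal.ofReal_mul (by positivity),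
    ← ENNReal.ofReal_mul (by positivity), ← ENNReal.ofReal_mul (by positivity)]
  refine ENNReal.ofReal_le_ofReal ?_
  have hνi : ν⁻¹ = ((m + 1 : ℕ) : ℝ) / ((N + 1 : ℕ) : ℝ) := by rw [hν, inv_div]
  rw [hM, hνi]
  calc _ = C * Λ ^ 2 * (((m + 1 : ℕ) : ℝ) / ((N + 1 : ℕ) : ℝ)) ^ (2 * s / d) := by rw [hC]; ring
    _ ≤ _ := by gcongr; linarith

/-! ### Moments of the weights -/

theorem IsRegularOn.diam_pos {d : ℕ} (hd : 0 < d) {P : Measure (RSpace d)} [IsProbabilityMeasure P]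
    {S : Set (RSpace d)} {a : ℝ} {b : NNReal} (h : IsRegularOn P S a b) {x : RSpace d}
    (hx : x ∈ S) : 0 < Metric.diam S := by
  have h1 : ∀ᵐ y ∂P, y ∈ S ∧ y ≠ x := by
    filter_upwards [show ∀ᵐ y ∂P, y ∈ S from h.compl_null,
      measure_eq_zero_iff_ae_notMem.1 (h.measure_sphere hd x 0)] with y hy hyx
    exact ⟨hy, fun e => hyx (by simp [e])⟩
  obtain ⟨y, hy, hyx⟩ := h1.exists
  exact (dist_pos.2 hyx).trans_le (Metric.dist_le_diam_of_mem h.isBounded hy hx)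

/-- Only finiteness matters, for integrability of the estimator. The `i`-th point is kept at an
arbitrary `y`, one block is formed from `k - 1` other neighbours, and a sum over all possible index
sets `T` removes the dependence on which ones they are. The scale is the diameter of `S`, so
restricting `P` to the ball changes nothing. -/
theorem exists_lintegral_abs_localWeight_le {d : ℕ} (hd : 0 < d) (l : ℕ) {a : ℝ} (ha : 0 < a)
    {b : NNReal} {P : Measure (RSpace d)} [IsProbabilityMeasure P] {S : Set (RSpace d)}
    (hP : IsRegularOn P S a b) {k N : ℕ} (hkn : k ≤ N + 1)
    (hk : (2 * degreeSum d l + 1) * numMonomials d l + 1 ≤ k) (i : Fin (N + 1)) :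
    ∃ C : ℝ≥0∞, C < ⊤ ∧ ∀ x ∈ S, ∀ y,
      ∫⁻ Z, ENNReal.ofReal |localWeight l k (i.insertNth y Z) x i| ∂(Measure.pi fun _ => P) ≤ C := by
  classical
  set G := 2 * degreeSum d l + 1 with hG
  have hG0 : 0 < G := by omega
  have hGR : (0 : ℝ) < G := by exact_mod_cast hG0
  have htD : 2 / (G : ℝ) * degreeSum d l < 1 := by
    rw [div_mul_eq_mul_div, div_lt_one hGR, hG]
    push_cast; linarith
  obtain ⟨C₁, hC₁top, hC₁⟩ := exists_lintegral_detWeight_le d l (t := 2 / (G : ℝ)) (by positivity)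
    htD b ha
  obtain ⟨m, rfl⟩ : ∃ m, k = m + 1 := ⟨k - 1, by omega⟩
  have hemb : ∀ T : {T : Finset (Fin N) // #T = m}, ∃ e : Fin 1 × Fin G × MultiIndex d l ↪ Fin N,
      ∀ q, e q ∈ T.1 := fun T => exists_embedding_mem T.1 (by
    rw [T.2]
    simpa [numMonomials] using hk)
  choose e he using hemb
  set c := ENNReal.ofReal (((numMonomials d l).factorial : ℝ) ^ 2) with hc
  refine ⟨1 + c * ∑ _T : {T : Finset (Fin N) // #T = m}, C₁ ^ G, ?_, fun x hx y => ?_⟩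
  · refine ENNReal.add_lt_top.2 ⟨ENNReal.one_lt_top, ENNReal.mul_lt_top ENNReal.ofReal_lt_top ?_⟩
    exact ENNReal.sum_lt_top.2 fun _ _ => ENNReal.pow_lt_top hC₁top
  set r := Metric.diam S with hr
  have hr0 : 0 < r := hP.diam_pos hd hx
  have hSB : ∀ z ∈ S, ‖z - x‖ ≤ r := fun z hz => by
    rw [← dist_eq_norm]; exact Metric.dist_le_diam_of_mem hP.isBounded hz hx
  have hae : ∀ᵐ Z ∂(Measure.pi fun _ : Fin N => P), ∀ i, Z i ∈ S :=
    ae_all_iff.2 fun i => (Measure.quasiMeasurePreserving_eval (μ := fun _ : Fin N => P) i).ae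
      (show ∀ᵐ z ∂P, z ∈ S from hP.compl_null)
  have hpt : ∀ᵐ Z ∂(Measure.pi fun _ : Fin N => P),
      ENNReal.ofReal |localWeight l (m + 1) (i.insertNth y Z) x i| ≤
        1 + c * ∑ T, blockWeight (2 / G) x r (e T) Z := by
    filter_upwards [hae] with Z hZ
    set X : Fin (N + 1) → RSpace d := i.insertNth y Z with hX
    have hXs : ∀ i', X (i.succAbove i') = Z i' := fun i' => by simp [hX]
    obtain ⟨T, hT, hTk⟩ := exists_subset_knnIndices_succAbove (k := m + 1) (X := X) (x := x)
      (by omega) hkn i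
    have hTm : #T = m := by simpa using (mem_powersetCard.1 hT).2
    have h1 := ofReal_sum_sq_localWeight_le (X := X) (x := x) (k := m + 1) (r := r) one_pos hG0 hr0
      ((e ⟨T, hTm⟩).trans (Fin.succAboveEmb i)) (fun q => hTk _ (he _ q)) (fun q => by
        change ‖X (i.succAbove _) - x‖ ≤ r
        rw [hXs]
        exact hSB _ (hZ _))
    rw [show blockWeight (2 / G) x r ((e ⟨T, hTm⟩).trans (Fin.succAboveEmb i)) X =
      blockWeight (2 / G) x r (e ⟨T, hTm⟩) Z from blockWeight_insertNth _ _ _ _ _ _ _] at h1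
    have h2 : |localWeight l (m + 1) X x i| ≤
        1 + ((1 : ℕ) : ℝ) * ∑ i, localWeight l (m + 1) X x i ^ 2 := by
      have h3 := Finset.single_le_sum (f := fun i => localWeight l (m + 1) X x i ^ 2)
        (fun _ _ => sq_nonneg _) (mem_univ i)
      rw [← sq_abs] at h3
      push_cast
      nlinarith [sq_nonneg (|localWeight l (m + 1) X x i| - 1)]
    refine (ENNReal.ofReal_le_ofReal h2).trans ?_
    rw [ENNReal.ofReal_add zero_le_one (mul_nonneg (Nat.cast_nonneg _)
      (Finset.sum_nonneg fun _ _ => sq_nonneg _)), ENNReal.ofReal_one]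
    gcongr
    refine h1.trans ?_
    gcongr
    exact Finset.single_le_sum (f := fun T => blockWeight (2 / G) x r (e T) Z)
      (fun _ _ => zero_le) (mem_univ _)
  have hball : (Measure.pi fun _ : Fin N => P).restrict
      (Set.univ.pi fun _ => Metric.closedBall x r) = Measure.pi fun _ => P :=
    Measure.restrict_eq_self_of_ae_mem (by
      filter_upwards [hae] with Z hZ i _
      rw [mem_closedBall_iff_norm]
      exact hSB _ (hZ i))
  have hbw : ∀ T, ∫⁻ Z, blockWeight (2 / G) x r (e T) Z ∂(Measure.pi fun _ => P) ≤ C₁ ^ G := by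
    intro T
    have h1 := lintegral_blockWeight_le
      (hC₁ P x r hP.le_smul hr0 (hP.le_closedBall x hx r hr0 le_rfl)) (e T)
      (fun _ => Metric.closedBall x r) fun _ => rfl
    rw [hball] at h1
    refine h1.trans (mul_le_of_le_one_right' ?_)
    exact Finset.prod_le_one' fun _ _ => prob_le_one
  calc _ ≤ ∫⁻ Z, (1 + c * ∑ T, blockWeight (2 / G) x r (e T) Z) ∂(Measure.pi fun _ => P) :=
        lintegral_mono_ae hpt
    _ = 1 + c * ∑ T, ∫⁻ Z, blockWeight (2 / G) x r (e T) Z ∂(Measure.pi fun _ => P) := by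
        rw [lintegral_add_left measurable_const, lintegral_const_mul _
          (Finset.measurable_sum _ fun T _ => measurable_blockWeight _ _ _ _),
          lintegral_finsetSum _ fun T _ => measurable_blockWeight _ _ _ _]
        simp
    _ ≤ _ := by
        gcongr with T _
        exact hbw T

/-! ### Conditional expectation of the estimator given the covariates -/

/-- Fubini: with the covariate and the independent variable fixed, integrating `h` against the
kernel gives `g`. Integrability passes to `g` because its absolute value is at most the conditional
mean of that of `h`. -/
theorem integral_mul_eq_of_regression {E α : Type*} [MeasurableSpace E] [MeasurableSpace α]
    {P : Measure E} [IsProbabilityMeasure P] {ρ : Measure α} [IsProbabilityMeasure ρ]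
    {κ : Kernel E ℝ} [IsMarkovKernel κ] {h : E → ℝ → ℝ} {g : E → ℝ}
    (hh : Measurable (Function.uncurry h)) (hg : Measurable g)
    (hreg : ∀ᵐ x ∂P, g x = ∫ y, h x y ∂(κ x)) {ψ : E × α → ℝ} (hψ : Measurable ψ)
    (hf : Integrable (fun q : (E × ℝ) × α => ψ (q.1.1, q.2) * h q.1.1 q.1.2) ((P ⊗ₘ κ).prod ρ)) :
    Integrable (fun q : E × α => ψ q * g q.1) (P.prod ρ) ∧
      ∫ q, ψ (q.1.1, q.2) * h q.1.1 q.1.2 ∂((P ⊗ₘ κ).prod ρ) = ∫ q, ψ q * g q.1 ∂(P.prod ρ) := by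
  have hh' : Measurable fun p : E × ℝ => h p.1 p.2 := hh
  have hint : Integrable (fun q : E × α => ψ q * g q.1) (P.prod ρ) := by
    refine ⟨(hψ.mul (hg.comp measurable_fst)).aestronglyMeasurable, ?_⟩
    refine lt_of_le_of_lt ?_ hf.2
    have hm1 : Measurable fun q : (E × ℝ) × α => ‖ψ (q.1.1, q.2) * h q.1.1 q.1.2‖ₑ :=
      ((hψ.comp (by fun_prop)).mul (hh'.comp measurable_fst)).enorm
    have hm2 : Measurable fun p : E × ℝ => ∫⁻ a, ‖ψ (p.1, a)‖ₑ * ‖h p.1 p.2‖ₑ ∂ρ := by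
      have : Measurable fun q : (E × ℝ) × α => ‖ψ (q.1.1, q.2)‖ₑ * ‖h q.1.1 q.1.2‖ₑ :=
        ((hψ.comp (by fun_prop)).enorm).mul ((hh'.comp measurable_fst).enorm)
      exact this.lintegral_prod_right'
    have hm3 : Measurable fun q : E × α => ‖ψ q * g q.1‖ₑ :=
      (hψ.mul (hg.comp measurable_fst)).enorm
    rw [lintegral_prod _ hm3.aemeasurable, lintegral_prod _ hm1.aemeasurable]
    simp only [enorm_mul]
    rw [Measure.lintegral_compProd hm2]
    refine lintegral_mono_ae ?_
    filter_upwards [hreg] with y hy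
    have hmψ : Measurable fun a => ‖ψ (y, a)‖ₑ := (hψ.comp measurable_prodMk_left).enorm
    have hmh : Measurable fun u => ‖h y u‖ₑ := (hh'.comp measurable_prodMk_left).enorm
    rw [lintegral_mul_const _ hmψ]
    simp_rw [lintegral_mul_const _ hmψ]
    rw [lintegral_const_mul _ hmh]
    gcongr
    rw [hy]
    exact enorm_integral_le_lintegral_enorm _
  refine ⟨hint, ?_⟩
  rw [integral_prod_symm _ hf, integral_prod_symm _ hint]
  refine integral_congr_ae ?_
  filter_upwards [hf.prod_left_ae] with a ha
  rw [Measure.integral_compProd ha]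
  refine integral_congr_ae ?_
  filter_upwards [hreg] with y hy
  rw [integral_const_mul, hy]

section sample

variable {d N m : ℕ} {Ω : Type*} [MeasurableSpace Ω] {μ : Measure Ω} [IsProbabilityMeasure μ]
  {P Q : Measure (RSpace d)} [IsProbabilityMeasure P]
  {κ : Kernel (RSpace d) ℝ} [IsMarkovKernel κ]

theorem IsCovariateShiftSample.measurePreserving {n : ℕ} {R : Measure (RSpace d × ℝ)}
    [IsProbabilityMeasure R]
    {X : Fin n → Ω → RSpace d} {Y : Fin n → Ω → ℝ} {Xs : Fin m → Ω → RSpace d}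
    (hs : IsCovariateShiftSample μ R Q X Y Xs) (j : Fin m) :
    MeasurePreserving (fun ω => ((fun i => (X i ω, Y i ω)), Xs j ω)) μ
      ((Measure.pi fun _ => R).prod Q) := by
  have hXY : ∀ i, Measurable fun ω => (X i ω, Y i ω) := fun i =>
    (hs.measurable_X i).prodMk (hs.measurable_Y i)
  have hV : Measurable fun ω (i : Fin n) => (X i ω, Y i ω) := measurable_pi_lambda _ hXY
  refine ⟨hV.prodMk (hs.measurable_Xs j), ?_⟩
  have h1 : IndepFun (fun ω (i : Fin n) => (X i ω, Y i ω)) (Xs j) μ :=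
    hs.indep_source_target.comp measurable_id (measurable_pi_apply j)
  rw [h1.map_prod_eq_prod_map_map hV.aemeasurable (hs.measurable_Xs j).aemeasurable,
    hs.law_target j, (iIndepFun_iff_map_fun_eq_pi_map fun i => (hXY i).aemeasurable).1
      hs.indep_source]
  simp only [hs.law_source]

variable [IsProbabilityMeasure Q]

theorem measurePreserving_fst_compProd :
    MeasurePreserving (Prod.fst : RSpace d × ℝ → RSpace d) (P ⊗ₘ κ) P :=
  ⟨measurable_fst, Measure.fst_compProd P κ⟩

theorem IsCovariateShiftSample.measurePreserving_covariates {n : ℕ}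
    {X : Fin n → Ω → RSpace d} {Y : Fin n → Ω → ℝ} {Xs : Fin m → Ω → RSpace d}
    (hs : IsCovariateShiftSample μ (P ⊗ₘ κ) Q X Y Xs) (j : Fin m) :
    MeasurePreserving (fun ω => ((fun i => X i ω), Xs j ω)) μ
      ((Measure.pi fun _ => P).prod Q) := by
  have h1 : MeasurePreserving (fun (v : Fin n → RSpace d × ℝ) i => (v i).1)
      (Measure.pi fun _ => P ⊗ₘ κ) (Measure.pi fun _ => P) :=
    measurePreserving_pi _ _ fun _ => measurePreserving_fst_compProd
  exact (h1.prod (MeasurePreserving.id Q)).comp (hs.measurePreserving j)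

theorem IsCovariateShiftSample.measurePreserving_isolate
    {X : Fin (N + 1) → Ω → RSpace d} {Y : Fin (N + 1) → Ω → ℝ} {Xs : Fin m → Ω → RSpace d}
    (hs : IsCovariateShiftSample μ (P ⊗ₘ κ) Q X Y Xs) (i : Fin (N + 1)) (j : Fin m) :
    MeasurePreserving (fun ω => ((X i ω, Y i ω), (fun i' => X (i.succAbove i') ω), Xs j ω)) μ
      ((P ⊗ₘ κ).prod ((Measure.pi fun _ => P).prod Q)) := by
  have h1 : MeasurePreserving (fun (v : Fin N → RSpace d × ℝ) i => (v i).1)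
      (Measure.pi fun _ => P ⊗ₘ κ) (Measure.pi fun _ => P) :=
    measurePreserving_pi _ _ fun _ => measurePreserving_fst_compProd
  have h2 := measurePreserving_piFinSuccAbove (fun _ : Fin (N + 1) => P ⊗ₘ κ) i
  have h3 := ((MeasurePreserving.id (P ⊗ₘ κ)).prod h1).comp h2
  have h4 := (h3.prod (MeasurePreserving.id Q)).comp (hs.measurePreserving j)
  exact (measurePreserving_prodAssoc _ _ _).comp h4

theorem insertNth_succAbove_eq {E : Type*} (i : Fin (N + 1)) (X : Fin (N + 1) → E) :
    (i.insertNth (X i) fun i' => X (i.succAbove i') : Fin (N + 1) → E) = X :=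
  Fin.insertNth_self_removeNth i X

theorem measurable_insertNth {E : Type*} [MeasurableSpace E] (i : Fin (N + 1)) :
    Measurable fun q : E × (Fin N → E) => (i.insertNth q.1 q.2 : Fin (N + 1) → E) :=
  (MeasurableEquiv.piFinSuccAbove (fun _ : Fin (N + 1) => E) i).symm.measurable

variable {h : RSpace d → ℝ → ℝ} {g : RSpace d → ℝ}

/-- In an expectation weighted by a function of the covariates, the response can be replaced with
the regression function. -/
theorem IsCovariateShiftSample.integral_mul_response
    (hh : Measurable (Function.uncurry h)) (hg : Measurable g)
    (hreg : ∀ᵐ x ∂P, g x = ∫ y, h x y ∂(κ x))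
    {X : Fin (N + 1) → Ω → RSpace d} {Y : Fin (N + 1) → Ω → ℝ} {Xs : Fin m → Ω → RSpace d}
    (hs : IsCovariateShiftSample μ (P ⊗ₘ κ) Q X Y Xs) (i : Fin (N + 1)) (j : Fin m)
    {φ : (Fin (N + 1) → RSpace d) × RSpace d → ℝ} (hφ : Measurable φ)
    (hint : Integrable (fun ω => φ ((fun i => X i ω), Xs j ω) * h (X i ω) (Y i ω)) μ) :
    Integrable (fun ω => φ ((fun i => X i ω), Xs j ω) * g (X i ω)) μ ∧
      ∫ ω, φ ((fun i => X i ω), Xs j ω) * h (X i ω) (Y i ω) ∂μ =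
        ∫ ω, φ ((fun i => X i ω), Xs j ω) * g (X i ω) ∂μ := by
  have hmp := hs.measurePreserving_isolate i j
  let ψ : RSpace d × ((Fin N → RSpace d) × RSpace d) → ℝ := fun q =>
    φ (i.insertNth q.1 q.2.1, q.2.2)
  have hψ : Measurable ψ := hφ.comp
    (((measurable_insertNth i).comp (by fun_prop : Measurable
      fun q : RSpace d × ((Fin N → RSpace d) × RSpace d) => (q.1, q.2.1))).prodMk (by fun_prop))
  have hψX : ∀ ω, ψ (X i ω, (fun i' => X (i.succAbove i') ω), Xs j ω) =
      φ ((fun i => X i ω), Xs j ω) := fun ω => by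
    simp only [ψ, insertNth_succAbove_eq i fun i => X i ω]
  have hmp' : MeasurePreserving (fun ω => (X i ω, (fun i' => X (i.succAbove i') ω), Xs j ω)) μ
      (P.prod ((Measure.pi fun _ => P).prod Q)) :=
    (measurePreserving_fst_compProd.prod (MeasurePreserving.id _)).comp hmp
  have hFm : Measurable fun q : (RSpace d × ℝ) × ((Fin N → RSpace d) × RSpace d) =>
      ψ (q.1.1, q.2) * h q.1.1 q.1.2 :=
    (hψ.comp (by fun_prop)).mul (hh.comp measurable_fst)
  have hGm : Measurable fun q : RSpace d × ((Fin N → RSpace d) × RSpace d) => ψ q * g q.1 :=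
    hψ.mul (hg.comp measurable_fst)
  have hint' : Integrable (fun q : (RSpace d × ℝ) × ((Fin N → RSpace d) × RSpace d) =>
      ψ (q.1.1, q.2) * h q.1.1 q.1.2) ((P ⊗ₘ κ).prod ((Measure.pi fun _ => P).prod Q)) := by
    rw [← hmp.integrable_comp hFm.aestronglyMeasurable]
    simpa only [Function.comp_def, hψX] using hint
  obtain ⟨h1, h2⟩ := integral_mul_eq_of_regression hh hg hreg hψ hint'
  refine ⟨?_, ?_⟩
  · have h3 := (hmp'.integrable_comp hGm.aestronglyMeasurable).2 h1
    simpa only [Function.comp_def, hψX] using h3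
  · rw [← hmp.map_eq, ← hmp'.map_eq, integral_map hmp.measurable.aemeasurable
      hFm.aestronglyMeasurable, integral_map hmp'.measurable.aemeasurable
      hGm.aestronglyMeasurable] at h2
    simpa only [hψX] using h2

/-- The weight depends on `X_i` as well as on the other points. A bound on its mean uniform in the
value `y` of `X_i` separates it from the response, so that integrability of `h` is enough. -/
theorem IsCovariateShiftSample.integrable_mul_response
    (hh : Measurable (Function.uncurry h)) (hhint : Integrable (Function.uncurry h) (P ⊗ₘ κ))
    {X : Fin (N + 1) → Ω → RSpace d} {Y : Fin (N + 1) → Ω → ℝ} {Xs : Fin m → Ω → RSpace d}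
    (hs : IsCovariateShiftSample μ (P ⊗ₘ κ) Q X Y Xs) (i : Fin (N + 1)) (j : Fin m)
    {φ : (Fin (N + 1) → RSpace d) × RSpace d → ℝ} (hφ : Measurable φ) {C : ℝ≥0∞} (hC : C < ⊤)
    (hφC : ∀ᵐ x ∂Q, ∀ y, ∫⁻ Z, ENNReal.ofReal |φ (i.insertNth y Z, x)|
      ∂(Measure.pi fun _ => P) ≤ C) :
    Integrable (fun ω => φ ((fun i => X i ω), Xs j ω) * h (X i ω) (Y i ω)) μ := by
  have hmp := hs.measurePreserving_isolate i j
  let ψ : RSpace d × ((Fin N → RSpace d) × RSpace d) → ℝ := fun q =>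
    φ (i.insertNth q.1 q.2.1, q.2.2)
  have hψ : Measurable ψ := hφ.comp
    (((measurable_insertNth i).comp (by fun_prop : Measurable
      fun q : RSpace d × ((Fin N → RSpace d) × RSpace d) => (q.1, q.2.1))).prodMk (by fun_prop))
  have hψX : ∀ ω, ψ (X i ω, (fun i' => X (i.succAbove i') ω), Xs j ω) =
      φ ((fun i => X i ω), Xs j ω) := fun ω => by
    simp only [ψ, insertNth_succAbove_eq i fun i => X i ω]
  have hFm : Measurable fun q : (RSpace d × ℝ) × ((Fin N → RSpace d) × RSpace d) =>
      ψ (q.1.1, q.2) * h q.1.1 q.1.2 :=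
    (hψ.comp (by fun_prop)).mul (hh.comp measurable_fst)
  have hint' : Integrable (fun q : (RSpace d × ℝ) × ((Fin N → RSpace d) × RSpace d) =>
      ψ (q.1.1, q.2) * h q.1.1 q.1.2) ((P ⊗ₘ κ).prod ((Measure.pi fun _ => P).prod Q)) := by
    refine ⟨hFm.aestronglyMeasurable, ?_⟩
    rw [hasFiniteIntegral_iff_enorm, lintegral_prod _ hFm.enorm.aemeasurable]
    simp only [enorm_mul]
    have hle : ∀ p : RSpace d × ℝ, ∫⁻ q, ‖ψ (p.1, q)‖ₑ * ‖h p.1 p.2‖ₑ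
        ∂((Measure.pi fun _ => P).prod Q) ≤ C * ‖h p.1 p.2‖ₑ := by
      intro p
      have hm : Measurable fun q => ‖ψ (p.1, q)‖ₑ := (hψ.comp measurable_prodMk_left).enorm
      rw [lintegral_mul_const _ hm]
      gcongr
      rw [lintegral_prod_symm _ hm.aemeasurable]
      calc _ ≤ ∫⁻ _x, C ∂Q := by
            refine lintegral_mono_ae ?_
            filter_upwards [hφC] with x hx
            simpa only [ψ, Real.enorm_eq_ofReal_abs] using hx p.1
        _ = C := by simp
    refine lt_of_le_of_lt (lintegral_mono hle) ?_
    rw [lintegral_const_mul _ (by exact hh.enorm)]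
    exact ENNReal.mul_lt_top hC (hasFiniteIntegral_iff_enorm.1 hhint.2)
  have h3 := (hmp.integrable_comp hFm.aestronglyMeasurable).2 hint'
  simpa only [Function.comp_def, hψX] using h3

end sample

/-- Nonnegativity of the variance, the case of an infinite second moment being trivial. -/
theorem ofReal_sq_integral_le {α : Type*} [MeasurableSpace α] {ν : Measure α}
    [IsProbabilityMeasure ν] {f : α → ℝ} (hf : AEStronglyMeasurable f ν) :
    ENNReal.ofReal ((∫ x, f x ∂ν) ^ 2) ≤ ∫⁻ x, ENNReal.ofReal (f x ^ 2) ∂ν := by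
  by_cases htop : ∫⁻ x, ENNReal.ofReal (f x ^ 2) ∂ν = ⊤
  · simp [htop]
  have hsq : Integrable (fun x => f x ^ 2) ν := by
    refine ⟨hf.pow 2, ?_⟩
    rw [hasFiniteIntegral_iff_ofReal (ae_of_all _ fun x => sq_nonneg _)]
    exact lt_top_iff_ne_top.2 htop
  rw [← ofReal_integral_eq_lintegral_ofReal hsq (ae_of_all _ fun x => sq_nonneg _)]
  refine ENNReal.ofReal_le_ofReal ?_
  have h1 := variance_nonneg f ν
  rw [variance_eq_sub ((memLp_two_iff_integrable_sq hf).2 hsq)] at h1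
  simpa using h1

section sample

variable {d N m k l : ℕ} {Ω : Type*} [MeasurableSpace Ω] {μ : Measure Ω} [IsProbabilityMeasure μ]
  {P Q : Measure (RSpace d)} [IsProbabilityMeasure P] [IsProbabilityMeasure Q]
  {κ : Kernel (RSpace d) ℝ} [IsMarkovKernel κ] {h : RSpace d → ℝ → ℝ} {g : RSpace d → ℝ}
  {X : Fin (N + 1) → Ω → RSpace d} {Y : Fin (N + 1) → Ω → ℝ} {Xs : Fin m → Ω → RSpace d}

/-- The indicator of an event of the source covariates can be absorbed into `φ`. -/
theorem IsCovariateShiftSample.setIntegral_mul_response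
    (hs : IsCovariateShiftSample μ (P ⊗ₘ κ) Q X Y Xs)
    (hh : Measurable (Function.uncurry h)) (hg : Measurable g)
    (hreg : ∀ᵐ x ∂P, g x = ∫ y, h x y ∂(κ x)) (i : Fin (N + 1)) (j : Fin m)
    {φ : (Fin (N + 1) → RSpace d) × RSpace d → ℝ} (hφ : Measurable φ)
    (hint : Integrable (fun ω => φ ((fun i => X i ω), Xs j ω) * h (X i ω) (Y i ω)) μ)
    {A : Set (Fin (N + 1) → RSpace d)} (hA : MeasurableSet A) :
    ∫ ω in (fun ω i => X i ω) ⁻¹' A, φ ((fun i => X i ω), Xs j ω) * h (X i ω) (Y i ω) ∂μ =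
      ∫ ω in (fun ω i => X i ω) ⁻¹' A, φ ((fun i => X i ω), Xs j ω) * g (X i ω) ∂μ := by
  have hX : Measurable fun ω (i : Fin (N + 1)) => X i ω :=
    measurable_pi_lambda _ hs.measurable_X
  have hA' := hX hA
  have hind : ∀ f : Ω → ℝ, (fun ω => (A ×ˢ Set.univ).indicator φ ((fun i => X i ω), Xs j ω) * f ω) =
      ((fun ω i => X i ω) ⁻¹' A).indicator
        (fun ω => φ ((fun i => X i ω), Xs j ω) * f ω) := by
    intro f
    funext ω
    by_cases hω : (fun i => X i ω) ∈ A
    · rw [Set.indicator_of_mem (show ω ∈ (fun ω i => X i ω) ⁻¹' A from hω),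
        Set.indicator_of_mem (show _ ∈ A ×ˢ Set.univ from ⟨hω, Set.mem_univ _⟩)]
    · rw [Set.indicator_of_notMem (show ω ∉ (fun ω i => X i ω) ⁻¹' A from hω),
        Set.indicator_of_notMem (show _ ∉ A ×ˢ Set.univ from fun h' => hω h'.1), zero_mul]
  have h1 := (hs.integral_mul_response hh hg hreg i j
    (hφ.indicator (hA.prod MeasurableSet.univ))
    (by rw [hind]; exact hint.indicator hA')).2
  rw [hind, hind, integral_indicator hA', integral_indicator hA'] at h1
  exact h1

theorem IsCovariateShiftSample.setIntegral_covariates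
    (hs : IsCovariateShiftSample μ (P ⊗ₘ κ) Q X Y Xs) (j : Fin m)
    {f : (Fin (N + 1) → RSpace d) × RSpace d → ℝ} (hf : Measurable f)
    (hint : Integrable (fun ω => f ((fun i => X i ω), Xs j ω)) μ) :
    Integrable (fun ω => ∫ x, f ((fun i => X i ω), x) ∂Q) μ ∧
    ∀ {A : Set (Fin (N + 1) → RSpace d)}, MeasurableSet A →
      ∫ ω in (fun ω i => X i ω) ⁻¹' A, f ((fun i => X i ω), Xs j ω) ∂μ =
        ∫ ω in (fun ω i => X i ω) ⁻¹' A, ∫ x, f ((fun i => X i ω), x) ∂Q ∂μ := by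
  have hmp := hs.measurePreserving_covariates j
  have hX : MeasurePreserving (fun ω (i : Fin (N + 1)) => X i ω) μ (Measure.pi fun _ => P) :=
    measurePreserving_fst.comp hmp
  have hint' : Integrable f ((Measure.pi fun _ => P).prod Q) :=
    (hmp.integrable_comp hf.aestronglyMeasurable).1 hint
  have hB : StronglyMeasurable fun Z : Fin (N + 1) → RSpace d => ∫ x, f (Z, x) ∂Q :=
    hf.stronglyMeasurable.integral_prod_right'
  refine ⟨(hX.integrable_comp hB.aestronglyMeasurable).2 hint'.integral_prod_left, fun {A} hA => ?_⟩
  have h1 := setIntegral_map (μ := μ) (g := fun ω => ((fun i => X i ω), Xs j ω)) (f := f)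
    (hA.prod MeasurableSet.univ) hf.aestronglyMeasurable hmp.measurable.aemeasurable
  have h2 := setIntegral_map (μ := μ) (g := fun ω (i : Fin (N + 1)) => X i ω) hA
    hB.aestronglyMeasurable hX.measurable.aemeasurable
  rw [hmp.map_eq, setIntegral_prod _ hint'.integrableOn] at h1
  rw [hX.map_eq] at h2
  rw [← h2]
  simp only [Measure.restrict_univ] at h1
  rw [h1]
  congr 2
  ext ω
  simp

/-- Integrability of the estimator, and its bias given the covariates. -/
theorem IsCovariateShiftSample.conditionalBias_eq
    (hs : IsCovariateShiftSample μ (P ⊗ₘ κ) Q X Y Xs)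
    (hh : Measurable (Function.uncurry h)) (hg : Measurable g)
    (hhint : Integrable (Function.uncurry h) (P ⊗ₘ κ)) (hgint : Integrable g Q)
    (hreg : ∀ᵐ x ∂P, g x = ∫ y, h x y ∂(κ x)) (hk : 1 ≤ k) (hkn : k ≤ N + 1) (hm : 1 ≤ m)
    (hw : ∀ i : Fin (N + 1), ∃ C : ℝ≥0∞, C < ⊤ ∧ ∀ᵐ x ∂Q, ∀ y,
      ∫⁻ Z, ENNReal.ofReal |localWeight l k (i.insertNth y Z) x i| ∂(Measure.pi fun _ => P) ≤ C) :
    Integrable (estimatorRV l k h X Y Xs) μ ∧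
    conditionalBias μ l k h (∫ x, g x ∂Q) X Y Xs =ᵐ[μ]
      fun ω => ∫ x, localBias l k g (fun i => X i ω) x ∂Q := by
  set e := ∫ x, g x ∂Q with he
  have hX : Measurable fun ω (i : Fin (N + 1)) => X i ω :=
    measurable_pi_lambda _ hs.measurable_X
  have hW : ∀ i j, Integrable (fun ω => localWeight l k (fun i => X i ω) (Xs j ω) i *
      h (X i ω) (Y i ω)) μ := fun i j => by
    obtain ⟨C, hC, hC'⟩ := hw i
    exact hs.integrable_mul_response hh hhint i j (measurable_localWeight (L := l) hk hkn i) hC hC'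
  have hV : ∀ i j, Integrable (fun ω => localWeight l k (fun i => X i ω) (Xs j ω) i *
      g (X i ω)) μ := fun i j =>
    (hs.integral_mul_response hh hg hreg i j (measurable_localWeight (L := l) hk hkn i) (hW i j)).1
  have hXs : ∀ j, MeasurePreserving (Xs j) μ Q := fun j => ⟨hs.measurable_Xs j, hs.law_target j⟩
  have hgX : ∀ j, Integrable (fun ω => g (Xs j ω)) μ := fun j =>
    ((hXs j).integrable_comp hg.aestronglyMeasurable).2 hgint
  have hT : ∀ j, Integrable (fun ω => localPolyEstimate l k (fun i => X i ω)
      (fun i => h (X i ω) (Y i ω)) (Xs j ω)) μ := fun j => by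
    simp only [localPolyEstimate_eq_sum]
    exact integrable_finsetSum _ fun i _ => hW i j
  have hE : Integrable (estimatorRV l k h X Y Xs) μ :=
    (integrable_finsetSum _ fun j _ => hT j).const_mul _
  refine ⟨hE, ?_⟩
  have hmR : (m : ℝ) ≠ 0 := by positivity
  have hL : ∀ j, Integrable (fun ω => localBias l k g (fun i => X i ω) (Xs j ω)) μ := fun j =>
    (integrable_finsetSum _ fun i _ => hV i j).sub (hgX j)
  have hBm := measurable_localBias (L := l) hk hkn hg
  have hB : StronglyMeasurable fun Z : Fin (N + 1) → RSpace d => ∫ x, localBias l k g Z x ∂Q :=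
    hBm.stronglyMeasurable.integral_prod_right'
  -- Each target point has the same integral over every event of the source covariates, so the
  -- average over `j` does too.
  have hset : ∀ j, ∀ A : Set (Fin (N + 1) → RSpace d), MeasurableSet A →
      ∫ ω in (fun ω i => X i ω) ⁻¹' A, (localPolyEstimate l k (fun i => X i ω)
        (fun i => h (X i ω) (Y i ω)) (Xs j ω) - e) ∂μ =
      ∫ ω in (fun ω i => X i ω) ⁻¹' A, ∫ x, localBias l k g (fun i => X i ω) x ∂Q ∂μ := by
    intro j A hA
    have h1 := (hs.setIntegral_covariates j hBm (hL j)).2 hA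
    have h2 := (hs.setIntegral_covariates j (hg.comp measurable_snd) (hgX j)).2 hA
    simp only [Function.comp_apply] at h2
    rw [← h1, integral_sub (hT j).integrableOn (integrable_const _), ← h2]
    simp only [localBias, localPolyEstimate_eq_sum]
    rw [integral_sub (integrable_finsetSum _ fun i _ => (hV i j).integrableOn)
      (hgX j).integrableOn, integral_finsetSum _ fun i _ => (hW i j).integrableOn,
      integral_finsetSum _ fun i _ => (hV i j).integrableOn]
    congr 1
    refine Finset.sum_congr rfl fun i _ => ?_
    exact hs.setIntegral_mul_response hh hg hreg i j (measurable_localWeight (L := l) hk hkn i)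
      (hW i j) hA
  have hBint : Integrable (fun ω => ∫ x, localBias l k g (fun i => X i ω) x ∂Q) μ :=
    (hs.setIntegral_covariates ⟨0, hm⟩ hBm (hL _)).1
  refine (ae_eq_condExp_of_forall_setIntegral_eq hX.comap_le (hE.sub (integrable_const e))
    (fun s _ _ => hBint.integrableOn) (fun s hs' _ => ?_)
    (hB.comp_measurable (comap_measurable _)).aestronglyMeasurable).symm
  obtain ⟨A, hA, rfl⟩ := hs'
  have hsum : ∀ ω, estimatorRV l k h X Y Xs ω - e = (1 / (m : ℝ)) * ∑ j,
      (localPolyEstimate l k (fun i => X i ω) (fun i => h (X i ω) (Y i ω)) (Xs j ω) - e) := by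
    intro ω
    simp only [estimatorRV, targetEstimate, Finset.sum_sub_distrib, Finset.sum_const,
      Finset.card_univ, Fintype.card_fin, nsmul_eq_mul]
    field_simp
  simp only [Pi.sub_apply, hsum]
  have hTe : ∀ j, Integrable (fun ω => localPolyEstimate l k (fun i => X i ω)
      (fun i => h (X i ω) (Y i ω)) (Xs j ω) - e) μ := fun j => (hT j).sub (integrable_const e)
  rw [integral_const_mul, integral_finsetSum _ fun j _ => (hTe j).integrableOn]
  simp only [fun j => hset j A hA]
  simp [hmR]

end sample

/-- A bound for the pointwise mean squared bias is a bound for the mean squared conditional bias. -/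
theorem IsCovariateShiftSample.integral_conditionalBias_sq_le {d N m k l : ℕ} {Ω : Type*}
    [MeasurableSpace Ω] {μ : Measure Ω} [IsProbabilityMeasure μ]
    {P Q : Measure (RSpace d)} [IsProbabilityMeasure P] [IsProbabilityMeasure Q]
    {κ : Kernel (RSpace d) ℝ} [IsMarkovKernel κ] {h : RSpace d → ℝ → ℝ} {g : RSpace d → ℝ}
    {X : Fin (N + 1) → Ω → RSpace d} {Y : Fin (N + 1) → Ω → ℝ} {Xs : Fin m → Ω → RSpace d}
    (hs : IsCovariateShiftSample μ (P ⊗ₘ κ) Q X Y Xs) (hg : Measurable g) (hk : 1 ≤ k)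
    (hkn : k ≤ N + 1) (hm : 1 ≤ m) {e K : ℝ} (hK : 0 ≤ K)
    (hB : conditionalBias μ l k h e X Y Xs =ᵐ[μ]
      fun ω => ∫ x, localBias l k g (fun i => X i ω) x ∂Q)
    (hle : ∀ᵐ x ∂Q, ∫⁻ Z, ENNReal.ofReal (localBias l k g Z x ^ 2)
      ∂(Measure.pi fun _ : Fin (N + 1) => P) ≤ ENNReal.ofReal K) :
    Integrable (fun ω => conditionalBias μ l k h e X Y Xs ω ^ 2) μ ∧
      ∫ ω, conditionalBias μ l k h e X Y Xs ω ^ 2 ∂μ ≤ K := by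
  have hX : MeasurePreserving (fun ω (i : Fin (N + 1)) => X i ω) μ (Measure.pi fun _ => P) :=
    measurePreserving_fst.comp (hs.measurePreserving_covariates ⟨0, hm⟩)
  have hBm := measurable_localBias (L := l) hk hkn hg
  have hBs : StronglyMeasurable fun Z : Fin (N + 1) → RSpace d => ∫ x, localBias l k g Z x ∂Q :=
    hBm.stronglyMeasurable.integral_prod_right'
  have hsq : Measurable fun q : (Fin (N + 1) → RSpace d) × RSpace d =>
      ENNReal.ofReal (localBias l k g q.1 q.2 ^ 2) := (hBm.pow_const 2).ennreal_ofReal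
  have hbound : ∫⁻ Z, ENNReal.ofReal ((∫ x, localBias l k g Z x ∂Q) ^ 2)
      ∂(Measure.pi fun _ : Fin (N + 1) => P) ≤ ENNReal.ofReal K := by
    -- Jensen for `Q`, then Tonelli, so that the pointwise bound can be integrated over `Q`.
    calc _ ≤ ∫⁻ Z, ∫⁻ x, ENNReal.ofReal (localBias l k g Z x ^ 2) ∂Q
          ∂(Measure.pi fun _ : Fin (N + 1) => P) := lintegral_mono fun Z =>
            ofReal_sq_integral_le (hBm.comp measurable_prodMk_left).aestronglyMeasurable
      _ = ∫⁻ x, ∫⁻ Z, ENNReal.ofReal (localBias l k g Z x ^ 2)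
          ∂(Measure.pi fun _ : Fin (N + 1) => P) ∂Q := lintegral_lintegral_swap hsq.aemeasurable
      _ ≤ ∫⁻ _x, ENNReal.ofReal K ∂Q := lintegral_mono_ae hle
      _ = ENNReal.ofReal K := by simp
  have hsq' : (fun ω => conditionalBias μ l k h e X Y Xs ω ^ 2) =ᵐ[μ]
      fun ω => (∫ x, localBias l k g (fun i => X i ω) x ∂Q) ^ 2 := by
    filter_upwards [hB] with ω hω
    rw [hω]
  have hlin : ∫⁻ ω, ENNReal.ofReal ((∫ x, localBias l k g (fun i => X i ω) x ∂Q) ^ 2) ∂μ ≤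
      ENNReal.ofReal K := by
    have h1 := hX.lintegral_comp (f := fun Z : Fin (N + 1) → RSpace d =>
      ENNReal.ofReal ((∫ x, localBias l k g Z x ∂Q) ^ 2))
      ((hBs.measurable.pow_const 2).ennreal_ofReal)
    rw [h1]
    exact hbound
  have hm' : AEStronglyMeasurable (fun ω => (∫ x, localBias l k g (fun i => X i ω) x ∂Q) ^ 2) μ :=
    ((hBs.comp_measurable hX.measurable).measurable.pow_const 2).aestronglyMeasurable
  rw [integrable_congr hsq', integral_congr_ae hsq']
  refine ⟨⟨hm', ?_⟩, ?_⟩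
  · rw [hasFiniteIntegral_iff_ofReal (ae_of_all _ fun _ => sq_nonneg _)]
    exact hlin.trans_lt ENNReal.ofReal_lt_top
  · rw [integral_eq_lintegral_of_nonneg_ae (ae_of_all _ fun _ => sq_nonneg _) hm']
    exact ENNReal.toReal_le_of_le_ofReal hK hlin

/-! ### Regularity of the covariate distribution -/

theorem HasDensityOn.exists_isRegularOn {d : ℕ} {P : Measure (RSpace d)} {S : Set (RSpace d)}
    {p : RSpace d → ℝ} {pinf psup : ℝ} (hP : HasDensityOn P S p) (hS : IsCompact S)
    (hvol : BallVolumeCondition S) (hpinf : 0 < pinf) (hinf : ∀ x ∈ S, pinf ≤ p x)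
    (hsup : ∀ x ∈ S, p x ≤ psup) : ∃ a : ℝ, ∃ b : NNReal, 0 < a ∧ IsRegularOn P S a b := by
  obtain ⟨c, hc, hball⟩ := hvol
  set v := (volume : Measure (RSpace d)) (Metric.closedBall 0 1) with hv
  have hvtop : v ≠ ⊤ := measure_closedBall_lt_top.ne
  have hv0 : 0 < v.toReal := ENNReal.toReal_pos
    (Metric.measure_closedBall_pos volume _ one_pos).ne' hvtop
  have hmeas := hS.measurableSet
  refine ⟨pinf * (c * v.toReal), psup.toNNReal, by positivity, ?_, fun x hx r hr hrS => ?_,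
    hP.compl_null, hS.isBounded⟩
  · refine Measure.le_iff.2 fun A hA => ?_
    calc P A = P (A ∩ S) := (measure_inter_conull hP.compl_null).symm
      _ = ∫⁻ x in A ∩ S, ENNReal.ofReal (p x) := by
          rw [hP.eq_withDensity, withDensity_apply _ (hA.inter hmeas)]
      _ ≤ ∫⁻ _x in A ∩ S, ENNReal.ofReal psup :=
          setLIntegral_mono measurable_const fun x hx => ENNReal.ofReal_le_ofReal (hsup x hx.2)
      _ = ENNReal.ofReal psup * volume (A ∩ S) := setLIntegral_const _ _
      _ ≤ ENNReal.ofReal psup * volume A := by gcongr; exact Set.inter_subset_left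
      _ = (psup.toNNReal • volume : Measure (RSpace d)) A := rfl
  · have h1 : (volume : Measure (RSpace d)) (Metric.closedBall x r) = ENNReal.ofReal (r ^ d) * v := by
      rw [Measure.addHaar_closedBall' _ _ hr.le, finrank_euclideanSpace_fin]
    calc ENNReal.ofReal (pinf * (c * v.toReal) * r ^ d)
        = ENNReal.ofReal pinf * (ENNReal.ofReal c * volume (Metric.closedBall x r)) := by
          rw [h1, ← ENNReal.ofReal_toReal hvtop, ← ENNReal.ofReal_mul (by positivity),
            ← ENNReal.ofReal_mul (by positivity), ← ENNReal.ofReal_mul (by positivity),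
            ENNReal.toReal_ofReal hv0.le]
          congr 1; ring
      _ ≤ ENNReal.ofReal pinf * volume (Metric.closedBall x r ∩ S) := by
          gcongr; exact hball x hx r hr.le hrS
      _ = ∫⁻ _x in Metric.closedBall x r ∩ S, ENNReal.ofReal pinf := (setLIntegral_const _ _).symm
      _ ≤ ∫⁻ x in Metric.closedBall x r ∩ S, ENNReal.ofReal (p x) :=
          setLIntegral_mono hP.measurable.ennreal_ofReal fun x hx =>
            ENNReal.ofReal_le_ofReal (hinf x hx.2)
      _ = P (Metric.closedBall x r ∩ S) := by
          rw [hP.eq_withDensity, withDensity_apply _ (measurableSet_closedBall.inter hmeas)]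
      _ ≤ P (Metric.closedBall x r) := measure_mono Set.inter_subset_left

/-- A point of `S` outside the closed set `T` would have a small ball missing `T`, hence null,
against the lower mass bound. Applied both ways to compact domains, this shows that `P` determines
its domain. -/
theorem IsRegularOn.subset_of_isClosed {d : ℕ} (hd : 0 < d) {P : Measure (RSpace d)}
    [IsProbabilityMeasure P] {S T : Set (RSpace d)} {a : ℝ} {b : NNReal} (ha : 0 < a)
    (h : IsRegularOn P S a b) (hT : IsClosed T) (hPT : P Tᶜ = 0) : S ⊆ T := by
  intro x hx
  by_contra hxT
  obtain ⟨r, hr, hrT⟩ := Metric.nhds_basis_closedBall.mem_iff.1 (hT.isOpen_compl.mem_nhds hxT)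
  have hdiam := h.diam_pos hd hx
  have h1 := h.le_closedBall x hx (min r (Metric.diam S)) (lt_min hr hdiam) (min_le_right _ _)
  have h2 : P (Metric.closedBall x (min r (Metric.diam S))) = 0 :=
    measure_mono_null ((Metric.closedBall_subset_closedBall (min_le_left _ _)).trans hrT) hPT
  rw [h2, nonpos_iff_eq_zero, ENNReal.ofReal_eq_zero] at h1
  have : 0 < min r (Metric.diam S) := lt_min hr hdiam
  have : 0 < a * min r (Metric.diam S) ^ d := by positivity
  linarith

/-- Cutting `g` off outside `U` gives a globally measurable function without changing its values on
`S`, where both covariate laws live. -/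
theorem exists_measurable_extension {d l : ℕ} {U S : Set (RSpace d)} {g : RSpace d → ℝ} {β Λ : ℝ}
    (hU : IsOpen U) (hUc : Convex ℝ U) (hSU : S ⊆ U) (hg : ContDiffOn ℝ l g U) (hβ : 0 < β)
    (hΛ : 0 ≤ Λ) (hH : PartialsHolderOn l β Λ g (convexHull ℝ S)) :
    ∃ f : RSpace d → ℝ, Measurable f ∧ Set.EqOn f g S ∧
      LocallyPolynomialOn l ((d : ℝ) ^ l * Λ) (l + β) S f := by
  classical
  refine ⟨U.indicator g, ?_, fun x hx => Set.indicator_of_mem (hSU hx) g, fun x hx => ?_⟩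
  · rw [← Set.piecewise_eq_indicator]
    exact hg.continuousOn.measurable_piecewise continuousOn_const hU.measurableSet
  · obtain ⟨c, hc, hcz⟩ := exists_localPolynomial_approx hU hUc hSU hg hβ hΛ hH hx
    refine ⟨c, by rw [Set.indicator_of_mem (hSU hx), hc], fun z hz => ?_⟩
    rw [Set.indicator_of_mem (hSU hz)]
    exact hcz z hz

/-! ### The mean squared conditional bias -/

theorem mainTheorem7 (d : ℕ) (hd : 0 < d) (l : ℕ)
    (P : Measure (RSpace d)) [IsProbabilityMeasure P] :
    ∃ C : ℝ, 0 < C ∧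
      -- the domain and the covariate distributions
      ∀ (S : Set (RSpace d)) (p : RSpace d → ℝ) (pinf psup : ℝ)
        (Q : Measure (RSpace d)) [IsProbabilityMeasure Q] (q : RSpace d → ℝ) (qsup : ℝ),
      IsCompact S → BallVolumeCondition S →
      HasDensityOn P S p → 0 < pinf → (∀ x ∈ S, pinf ≤ p x) → (∀ x ∈ S, p x ≤ psup) →
      HasDensityOn Q S q → (∀ x ∈ S, q x ≤ qsup) →
      -- the conditional distributions of the labels and the common regression function `g`
      ∀ (κ κs : Kernel (RSpace d) ℝ) [IsMarkovKernel κ] [IsMarkovKernel κs]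
        (h : RSpace d → ℝ → ℝ) (g : RSpace d → ℝ),
      Measurable (Function.uncurry h) →
      Integrable (Function.uncurry h) (P ⊗ₘ κ) → Integrable (Function.uncurry h) (Q ⊗ₘ κs) →
      (∀ᵐ x ∂P, g x = ∫ y, h x y ∂(κ x)) → (∀ᵐ x ∂Q, g x = ∫ y, h x y ∂(κs x)) →
      -- regularity of `g`
      ∀ (U : Set (RSpace d)) (β Λ : ℝ), IsOpen U → Convex ℝ U → S ⊆ U →
      ContDiffOn ℝ l g U → 0 < β → β ≤ 1 → 0 < Λ →
      PartialsHolderOn l β Λ g (convexHull ℝ S) →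
      -- the samples
      ∀ (k n m : ℕ), k ≤ n → 1 ≤ m →
      (2 * degreeSum d l + 1) * numMonomials d l + 1 ≤ k →
      ∀ (Ω : Type*) [MeasurableSpace Ω] (μ : Measure Ω) [IsProbabilityMeasure μ]
        (X : Fin n → Ω → RSpace d) (Y : Fin n → Ω → ℝ) (Xs : Fin m → Ω → RSpace d),
      IsCovariateShiftSample μ (P ⊗ₘ κ) Q X Y Xs →
      Integrable (estimatorRV l k h X Y Xs) μ ∧
      Integrable (fun ω => conditionalBias μ l k h
        (∫ z, h z.1 z.2 ∂(Q ⊗ₘ κs)) X Y Xs ω ^ 2) μ ∧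
      ∫ ω, conditionalBias μ l k h (∫ z, h z.1 z.2 ∂(Q ⊗ₘ κs)) X Y Xs ω ^ 2 ∂μ
        ≤ C * Λ ^ 2 * ((k : ℝ) / (n : ℝ)) ^ (2 * ((l : ℝ) + β) / (d : ℝ)) := by
  classical
  -- The constants `a` and `b` are chosen from `P` before any domain is given. If no regular compact
  -- domain exists, the claim is vacuous and any positive constant serves.
  by_cases hex : ∃ (S₀ : Set (RSpace d)) (a : ℝ) (b : NNReal),
      0 < a ∧ IsCompact S₀ ∧ IsRegularOn P S₀ a b
  swap
  · refine ⟨1, one_pos, ?_⟩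
    intro S p pinf psup Q _ q qsup hS hvol hP hpinf hinf hsup
    obtain ⟨a, b, ha, hreg⟩ := hP.exists_isRegularOn hS hvol hpinf hinf hsup
    exact absurd ⟨S, a, b, ha, hS, hreg⟩ hex
  obtain ⟨S₀, a, b, ha, hS₀, hP₀⟩ := hex
  obtain ⟨C, hC, hmain⟩ := exists_lintegral_localBias_sq_le hd l ha b
  refine ⟨C, hC, ?_⟩
  intro S p pinf psup Q _ q qsup hS hvol hP hpinf hinf hsup hQ hqsup κ κs _ _ h g hh hhP hhQ
    hgP hgQ U β Λ hU hUc hSU hg hβ hβ1 hΛ hH k n m hkn hm hk Ω _ μ _ X Y Xs hs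
  -- The given domain coincides with the one chosen in advance, so the bound with constants from
  -- `S₀` applies to it.
  obtain rfl : S = S₀ := by
    obtain ⟨a', b', ha', hP'⟩ := hP.exists_isRegularOn hS hvol hpinf hinf hsup
    exact (hP'.subset_of_isClosed hd ha' hS₀.isClosed hP₀.compl_null).antisymm
      (hP₀.subset_of_isClosed hd ha hS.isClosed hP'.compl_null)
  obtain ⟨f, hf, hfg, hfpoly⟩ := exists_measurable_extension hU hUc hSU hg hβ hΛ.le hH
  have hPS : ∀ᵐ x ∂P, x ∈ S := hP.compl_null
  have hQS : ∀ᵐ x ∂Q, x ∈ S := hQ.compl_null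
  have hfP : ∀ᵐ x ∂P, f x = ∫ y, h x y ∂(κ x) := by
    filter_upwards [hPS, hgP] with x hx hx'
    rw [hfg hx, hx']
  have hfQ : ∀ᵐ x ∂Q, f x = ∫ y, h x y ∂(κs x) := by
    filter_upwards [hQS, hgQ] with x hx hx'
    rw [hfg hx, hx']
  have hfint : Integrable f Q := by
    refine ((Measure.integrable_compProd_iff hhQ.aestronglyMeasurable).1 hhQ).2.mono'
      hf.aestronglyMeasurable ?_
    filter_upwards [hfQ] with x hx
    rw [hx]
    exact norm_integral_le_integral_norm _
  have he : ∫ z, h z.1 z.2 ∂(Q ⊗ₘ κs) = ∫ x, f x ∂Q := by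
    refine (Measure.integral_compProd hhQ).trans (integral_congr_ae ?_)
    filter_upwards [hfQ] with x hx
    rw [hx]
    rfl
  rw [he]
  obtain ⟨N, rfl⟩ : ∃ N, n = N + 1 := ⟨n - 1, by omega⟩
  have hk1 : 1 ≤ k := by omega
  obtain ⟨h1, h2⟩ := hs.conditionalBias_eq hh hf hhP hfint hfP hk1 hkn hm fun i => by
    obtain ⟨K, hK, hK'⟩ := exists_lintegral_abs_localWeight_le hd l ha hP₀ hkn hk i
    exact ⟨K, hK, hQS.mono hK'⟩
  refine ⟨h1, hs.integral_conditionalBias_sq_le hf hk1 hkn hm (by positivity) h2 ?_⟩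
  exact hQS.mono (hmain P S f β Λ hP₀ hf hfpoly hβ hβ1 hΛ k (N + 1) hkn hk)
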